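/- Let $\mathcal G$ be a connected, locally finite graph with countable vertex set, without loops or multiple edges, in which each edge $e$ is identified with a real interval of finite length $\ell_e>0$. Equip $\mathcal G$ with Lebesgue measure on its edges and with the geodesic distance, and let $\overline{\mathcal G}$ be its metric completion. Assume that $\overline{\mathcal G}$ is compact and weakly connected: for any distinct $x,y\in\overline{\mathcal G}$ there are a finite set $W\subset\mathcal G$ and disjoint open sets $A\ni x$, $B\ni y$ with $\overline{\mathcal G}\setminus W=A\cup B$. Let $\partial\overline{\mathcal G}$ consist of the vertices of degree one together with the points of $\overline{\mathcal G}\setminus\mathcal G$, and assume $\partial\overline{\mathcal G}\neq\emptyset$. Let $q:\mathcal G\to[0,\infty)$ be integrable over $\mathcal G$, and suppose there is an edge weight $\omega(e)>0$ with $\sum_e\omega(e)<\infty$ and $\sum_e\int_e(\omega(e)^{-1}q)^2\,\omega(e)\,dx<\infty$. A function $u$ on $\mathcal G$ is $q$-harmonic if it is continuous, $u'$ is absolutely continuous on each closed edge with $u''=qu$ almost everywhere, and at each vertex of degree at least two the derivatives of $u$ along the incident edges, pointing away from the vertex, sum to zero. Let $\mathcal A$ be the set of continuous $\phi:\overline{\mathcal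 G}\to\mathbb R$ that are $C^\infty$ on the open edges and satisfy $\phi'=0$ outside a finite set of edges and in a neighborhood of each vertex; put $L\phi=-\phi''+q\phi$. For a continuous $F:\partial\overline{\mathcal G}\to\mathbb R$ and a clopen set $E\subset\partial\overline{\mathcal G}$ let $$\Lambda_q(F,E)=\int_{\mathcal G}u\,L\phi,$$ where $u$ is the continuous extension of $F$ to $\overline{\mathcal G}$ that is $q$-harmonic on $\mathcal G$, and $\phi\in\mathcal A$ is any function with $\phi=1$ on $E$ and $\phi=0$ on $\partial\overline{\mathcal G}\setminus E$. Let $D\subset C(\partial\overline{\mathcal G})$ be the set of continuous real functions on $\partial\overline{\mathcal G}$ with finite range. Then $D$ is the linear span of the indicator functions of clopen subsets of $\partial\overline{\mathcal G}$. For all $F\in D$ and all clopen $E$ the number $\Lambda_q(F,E)$ is well defined: $u$ exists and is unique, functions $\phi$ exist, the integral converges absolutely, and its value does not depend on $\phi$. There is a unique linear map $\Lambda_q$ from $D$ to the finite signed Borel measures on $\partial\overline{\mathcal G}$ with $(\Lambda_qF)(E)=\Lambda_q(F,E)$ for all $F\in D$ and all clopen $E$, and each $\Lambda_qF$ is a Radon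 measure. This Dirichlet to Neumann map $\Lambda_q:C(\partial\overline{\mathcal G})\to M(\partial\overline{\mathcal G})$ with domain $D$ is 1. densely defined: $D$ is dense in $C(\partial\overline{\mathcal G})$ for the uniform norm; 2. symmetric: $\int G\,d(\Lambda_qF)=\int F\,d(\Lambda_qG)$ for all $F,G\in D$; 3. nonnegative: $\int F\,d(\Lambda_qF)\ge 0$ for all $F\in D$. -/

import Mathlib

open MeasureTheory Set Filter Topology
open scoped ENNReal

noncomputable section

/-- Metric data on a simple graph `G`: each edge `e` is identified with the real interval
`[0, len e]` of finite positive length, `0` being the endpoint `src e` and `len e` the endpoint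
`tgt e`. -/
structure MetricGraph {V : Type*} (G : SimpleGraph V) where
  src : G.edgeSet → V
  tgt : G.edgeSet → V
  mk_src_tgt : ∀ e : G.edgeSet, s(src e, tgt e) = (e : Sym2 V)
  len : G.edgeSet → ℝ
  len_pos : ∀ e, 0 < len e

namespace MetricGraph

variable {V : Type*} {G : SimpleGraph V}

/-- The points of the metric graph: the vertices, and the interior points of the edges. -/
inductive Point (Γ : MetricGraph G) where
  | vertex (v : V) : Point Γ
  | inner (e : G.edgeSet) (t : ℝ) (ht : t ∈ Ioo 0 (Γ.len e)) : Point Γ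

variable (Γ : MetricGraph G)

open Classical in
/-- The point of the closed edge `e` with coordinate `t ∈ [0, len e]`.
(Coordinates outside the interval are clamped.) -/
def pt (e : G.edgeSet) (t : ℝ) : Γ.Point :=
  if h : t ∈ Ioo 0 (Γ.len e) then .inner e t h
  else if t ≤ 0 then .vertex (Γ.src e) else .vertex (Γ.tgt e)

/-- `Γ.PathLength p q r`: there is a path from `p` to `q`, made of finitely many intervals each
contained in a closed edge, whose total length is `r`. -/
inductive PathLength (p : Γ.Point) : Γ.Point → ℝ≥0∞ → Prop
  | refl : PathLength p p 0
  | step (e : G.edgeSet) (s t : ℝ) (hs : s ∈ Icc 0 (Γ.len e)) (ht : t ∈ Icc 0 (Γ.len e))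
      (r : ℝ≥0∞) (h : PathLength p (Γ.pt e s) r) : PathLength p (Γ.pt e t) (r + edist s t)

variable {Γ} in
theorem PathLength.trans {p q x : Γ.Point} {r r' : ℝ≥0∞} (h : Γ.PathLength p q r)
    (h' : Γ.PathLength q x r') : Γ.PathLength p x (r + r') := by
  induction h' with
  | refl => simpa using h
  | step e s t hs ht r' _ ih =>
    rw [← add_assoc]
    exact PathLength.step e s t hs ht _ ih

variable {Γ} in
theorem PathLength.symm {p q : Γ.Point} {r : ℝ≥0∞} (h : Γ.PathLength p q r) :
    Γ.PathLength q p r := by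
  induction h with
  | refl => exact PathLength.refl
  | step e s t hs ht r _ ih =>
    have h1 : Γ.PathLength (Γ.pt e t) (Γ.pt e s) (0 + edist t s) :=
      PathLength.step e t s ht hs 0 PathLength.refl
    have h2 := h1.trans ih
    rwa [zero_add, add_comm, edist_comm] at h2

/-- The geodesic distance: the infimum of the lengths of the paths joining two points. -/
instance : PseudoEMetricSpace Γ.Point where
  edist p q := sInf {r | Γ.PathLength p q r}
  edist_self p := le_antisymm (sInf_le PathLength.refl) bot_le
  edist_comm p q := by
    congr 1
    ext r
    exact ⟨PathLength.symm, PathLength.symm⟩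
  edist_triangle p q x := by
    rw [ENNReal.sInf_add]
    refine le_iInf₂ fun r hr => ?_
    rw [add_comm, ENNReal.sInf_add]
    refine le_iInf₂ fun r' hr' => ?_
    rw [add_comm]
    exact sInf_le (PathLength.trans hr hr')

theorem edist_def (p q : Γ.Point) : edist p q = sInf {r | Γ.PathLength p q r} := rfl

theorem pt_clamp (e : G.edgeSet) (t : ℝ) :
    Γ.pt e t = Γ.pt e (projIcc 0 (Γ.len e) (Γ.len_pos e).le t) := by
  have hl := Γ.len_pos e
  rcases le_or_gt t 0 with h | h
  · rw [projIcc_of_le_left _ h]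
    simp [pt, h, not_lt.mpr h]
  rcases le_or_gt (Γ.len e) t with h' | h'
  · rw [projIcc_of_right_le _ h']
    simp [pt, not_lt.mpr h', not_le.mpr h, not_le.mpr hl]
  · rw [projIcc_of_mem _ ⟨h.le, h'.le⟩]

theorem lipschitzWith_pt (e : G.edgeSet) : LipschitzWith 1 (Γ.pt e) := by
  intro s t
  rw [pt_clamp Γ e s, pt_clamp Γ e t, edist_def]
  have key : edist ((projIcc 0 (Γ.len e) (Γ.len_pos e).le s : Icc 0 (Γ.len e)) : ℝ)
      (projIcc 0 (Γ.len e) (Γ.len_pos e).le t : Icc 0 (Γ.len e)) ≤ edist s t := by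
    have := (LipschitzWith.projIcc (Γ.len_pos e).le) s t
    rw [ENNReal.coe_one, one_mul] at this
    exact this
  refine le_trans (sInf_le ?_) (by simpa using key)
  have := PathLength.step (Γ := Γ) e _ _ (projIcc 0 (Γ.len e) (Γ.len_pos e).le s).2
    (projIcc 0 (Γ.len e) (Γ.len_pos e).le t).2 0 PathLength.refl
  rwa [zero_add] at this

instance : MeasurableSpace Γ.Point := borel _
instance : BorelSpace Γ.Point := ⟨rfl⟩

theorem measurable_pt (e : G.edgeSet) : Measurable (Γ.pt e) :=
  (Γ.lipschitzWith_pt e).continuous.measurable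

/-- Lebesgue measure on the edges, extended to the metric graph. -/
def vol : Measure Γ.Point :=
  Measure.sum fun e => (volume.restrict (Ioo 0 (Γ.len e))).map (Γ.pt e)

/-- The metric completion of the metric graph. -/
abbrev Compl : Type _ := UniformSpace.Completion Γ.Point

/-- The completion is weakly connected: any two distinct points are separated by a finite set of
points of the graph. -/
def WeaklyConnected : Prop :=
  ∀ x y : Γ.Compl, x ≠ y → ∃ W : Set Γ.Point, W.Finite ∧ ∃ A B : Set Γ.Compl,
    IsOpen A ∧ IsOpen B ∧ Disjoint A B ∧ ((fun p : Γ.Point => (p : Γ.Compl)) '' W)ᶜ = A ∪ B ∧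
      x ∈ A ∧ y ∈ B

/-- The boundary of the completion: the vertices of degree one, and the points of the completion
that are not in the graph. -/
def bdry [G.LocallyFinite] : Set Γ.Compl :=
  {x | ∃ v, G.degree v = 1 ∧ x = ((Point.vertex v : Γ.Point) : Γ.Compl)} ∪
    (range fun p : Γ.Point => (p : Γ.Compl))ᶜ

instance : MeasurableSpace Γ.Compl := borel _
instance : BorelSpace Γ.Compl := ⟨rfl⟩

/-- The algebra of eventually flat functions: continuous functions on the completion, smooth on
the open edges, with derivative zero outside a finite set of edges and near each vertex (that is,
near both ends of each edge). -/
def EventuallyFlat (φ : C(Γ.Compl, ℝ)) : Prop :=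
  (∀ e, ContDiffOn ℝ (⊤ : ℕ∞) (fun t => φ (Γ.pt e t)) (Ioo 0 (Γ.len e))) ∧
  (∃ S : Finset G.edgeSet, ∀ e ∉ S, ∀ t ∈ Ioo 0 (Γ.len e), deriv (fun s => φ (Γ.pt e s)) t = 0) ∧
  ∀ e, (∀ᶠ t in 𝓝[>] (0 : ℝ), deriv (fun s => φ (Γ.pt e s)) t = 0) ∧
    ∀ᶠ t in 𝓝[<] (Γ.len e), deriv (fun s => φ (Γ.pt e s)) t = 0

/-- `u` is `q`-harmonic: on each closed edge `u` has an absolutely continuous derivative `u'` with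
`u'' = q u` almost everywhere, and at each vertex of degree at least two the sum of the
derivatives of `u` along the incident edges, pointing away from the vertex, is zero. (Continuity
at the vertices is part of the differentiability on the closed edges.) -/
def QHarmonic [G.LocallyFinite] (q u : Γ.Point → ℝ) : Prop :=
  ∃ u' : G.edgeSet → ℝ → ℝ,
    (∀ e, ∀ t ∈ Icc 0 (Γ.len e),
      HasDerivWithinAt (fun s => u (Γ.pt e s)) (u' e t) (Icc 0 (Γ.len e)) t) ∧
    (∀ e, AbsolutelyContinuousOnInterval (u' e) 0 (Γ.len e)) ∧
    (∀ e, ∀ᵐ t ∂volume.restrict (Ioo 0 (Γ.len e)),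
      HasDerivAt (u' e) (q (Γ.pt e t) * u (Γ.pt e t)) t) ∧
    ∀ v, 2 ≤ G.degree v →
      (∑ᶠ e ∈ {e | Γ.src e = v}, u' e 0) + (∑ᶠ e ∈ {e | Γ.tgt e = v}, -u' e (Γ.len e)) = 0

/-- The second derivative along the edges (with the value zero at the vertices, a null set). -/
def secondDeriv (f : Γ.Point → ℝ) : Γ.Point → ℝ
  | .vertex _ => 0
  | .inner e t _ => iteratedDeriv 2 (fun s => f (Γ.pt e s)) t

/-- The differential expression `L f = - f'' + q f`. -/
def L (q f : Γ.Point → ℝ) (p : Γ.Point) : ℝ := -Γ.secondDeriv f p + q p * f p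

section

variable [G.LocallyFinite]

/-- `u` is a continuous extension of `U` to the completion which is `q`-harmonic on the graph. -/
def HarmonicExtension (q : Γ.Point → ℝ) (U : C(Γ.bdry, ℝ)) (u : C(Γ.Compl, ℝ)) : Prop :=
  (∀ x : Γ.bdry, u x = U x) ∧ Γ.QHarmonic q fun p => u p

/-- `φ` is an eventually flat function equal to `1` on `Ω` and to `0` on the rest of the
boundary. -/
def TestFunction (Ω : Set Γ.bdry) (φ : C(Γ.Compl, ℝ)) : Prop :=
  Γ.EventuallyFlat φ ∧ (∀ x ∈ Ω, φ (x : Γ.Compl) = 1) ∧ ∀ x ∉ Ω, φ (x : Γ.Compl) = 0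

/-- `Λ_q(U, Ω)` is well defined, with value `c`: the `q`-harmonic extension `u` of `U` exists and
is unique, test functions `φ` for `Ω` exist, and `∫ u L φ` converges absolutely with value `c`
for every such `φ`. -/
def DNValue (q : Γ.Point → ℝ) (U : C(Γ.bdry, ℝ)) (Ω : Set Γ.bdry) (c : ℝ) : Prop :=
  (∃! u, Γ.HarmonicExtension q U u) ∧ (∃ φ, Γ.TestFunction Ω φ) ∧
    ∀ u φ, Γ.HarmonicExtension q U u → Γ.TestFunction Ω φ →
      Integrable (fun p : Γ.Point => u p * Γ.L q (fun p => φ p) p) Γ.vol ∧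
        ∫ p : Γ.Point, u p * Γ.L q (fun p => φ p) p ∂Γ.vol = c

/-- `Λ` is the Dirichlet to Neumann map `Λ_q`, with domain the continuous boundary functions with
finite range, and with values signed Borel measures such that `(Λ_q F)(E) = Λ_q(F, E)` for every
clopen set `E`. -/
def IsDirichletNeumannMap (q : Γ.Point → ℝ) (Λ : C(Γ.bdry, ℝ) →ₗ.[ℝ] SignedMeasure Γ.bdry) :
    Prop :=
  (∀ F : C(Γ.bdry, ℝ), F ∈ Λ.domain ↔ (range F).Finite) ∧
    ∀ (F : Λ.domain) (E : Set Γ.bdry), IsClopen E → Γ.DNValue q F E (Λ F E)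

end

end MetricGraph

end

/-!
The algebra `𝒜` of eventually flat functions carries the energy form
`⟨φ, ψ⟩ = ∫ φ L ψ = ∫ φ' ψ' + ∫ q φ ψ`, which is symmetric and nonnegative (`pairing_eq_energy`). The
Dirichlet to Neumann map is this form reduced to boundary values: the form `b` which gives the inner
product, in the completion of `𝒜`, of the components of `φ` and `ψ` orthogonal to the subspace `𝒜₀` of
functions vanishing on the boundary. Once `Λ_q(F, E)` is identified with `b φ ψ` for `φ` with boundary
values `F` and `ψ` with boundary values `1_E`, symmetry and nonnegativity are those of `b`.

*Test functions.* Weak connectedness says that finitely many points, cut out of the completion, separate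
`x` from `y`. Multiplying the locally constant function which tells the two sides apart by cutoff
functions vanishing near the cut points gives an element of `𝒜` with finitely many boundary values,
which separates `x` from `y`. So `𝒜` is dense by Stone–Weierstrass, the boundary is totally
disconnected, and composing elements of `𝒜` with a smooth step gives the test functions of the clopen
sets (`exists_testFunction`).

*Harmonic extension.* Along a path of length `r` from `x` to `y` the Cauchy–Schwarz inequality bounds
`|ψ x - ψ y|²` by `r` times the energy. The completion is compact, so the energy dominates the uniform
norm on `𝒜₀` (`exists_norm_sq_le_pairing`). Hence approximations to the orthogonal projection of `φ` to
the closure of `𝒜₀` converge uniformly; their limit, subtracted from `φ`, is a continuous function `u`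
with the boundary values of `φ` and with `∫ u L ψ = 0` for all `ψ` in `𝒜₀`. The lemma of du Bois-Reymond on
the edges, and testing against bump functions at the vertices, show that `u` is `q`-harmonic
(`qHarmonic_of_pairing_eq_zero`). It is unique by the maximum principle (`QHarmonic.nonpos`), and
`∫ u L ψ = b φ ψ` for all `ψ` in `𝒜`.

*Measures.* The absolute value does not increase the energy, and turns `1_E - 1_E'` into `1_E + 1_E'` when
`E` and `E'` are disjoint; so `b` is nonpositive on such a pair of indicator functions
(`nonpos_of_disjoint`). It is nonnegative on the pair `1_E`, `1`, with value `∫ q u` for the nonnegative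
`q`-harmonic function `u` with boundary values `1_E` (`nonneg_one`). Therefore `E ↦ b 1_Ω 1_E` is
nonnegative on the clopen subsets of `Ω` and nonpositive on those of its complement. A nonnegative
additive function on the clopen sets of a compact totally disconnected space extends to a measure, by
compactness (`exists_measure_of_isClopen`), and the clopen sets generate the Borel sets, since the
completion is metrizable.
-/

noncomputable section

namespace MetricGraph

variable {V : Type*} {G : SimpleGraph V} (Γ : MetricGraph G)

/-! ### Coordinates on the edges -/

theorem pt_of_mem {e : G.edgeSet} {t : ℝ} (h : t ∈ Ioo 0 (Γ.len e)) :
    Γ.pt e t = .inner e t h := by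
  simp only [pt, h, dite_true]

theorem pt_of_nonpos (e : G.edgeSet) {t : ℝ} (h : t ≤ 0) : Γ.pt e t = .vertex (Γ.src e) := by
  simp [pt, h, not_lt.mpr h]

theorem pt_of_len_le (e : G.edgeSet) {t : ℝ} (h : Γ.len e ≤ t) :
    Γ.pt e t = .vertex (Γ.tgt e) := by
  have := (Γ.len_pos e).trans_le h
  simp [pt, not_lt.mpr h, this]

theorem continuous_pt (e : G.edgeSet) : Continuous (Γ.pt e) := (Γ.lipschitzWith_pt e).continuous

/-- A continuous function on the completion, read in the coordinate of the edge `e`. It is constant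
to the left of `0` and to the right of `len e`. -/
def onEdge (u : C(Γ.Compl, ℝ)) (e : G.edgeSet) (t : ℝ) : ℝ := u (Γ.pt e t)

theorem continuous_onEdge (u : C(Γ.Compl, ℝ)) (e : G.edgeSet) : Continuous (Γ.onEdge u e) :=
  u.continuous.comp ((UniformSpace.Completion.continuous_coe _).comp (Γ.continuous_pt e))

theorem onEdge_of_nonpos (u : C(Γ.Compl, ℝ)) (e : G.edgeSet) {t : ℝ} (h : t ≤ 0) :
    Γ.onEdge u e t = Γ.onEdge u e 0 := by
  simp only [onEdge, Γ.pt_of_nonpos e h, Γ.pt_of_nonpos e le_rfl]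

theorem onEdge_of_len_le (u : C(Γ.Compl, ℝ)) (e : G.edgeSet) {t : ℝ} (h : Γ.len e ≤ t) :
    Γ.onEdge u e t = Γ.onEdge u e (Γ.len e) := by
  simp only [onEdge, Γ.pt_of_len_le e h, Γ.pt_of_len_le e le_rfl]

/-- A function which is `K`-Lipschitz in the coordinate of every edge is `K`-Lipschitz for the
geodesic distance. -/
theorem lipschitzWith_of_edges {f : Γ.Point → ℝ} {K : NNReal} (hK : K ≠ 0)
    (h : ∀ e, LipschitzOnWith K (fun t => f (Γ.pt e t)) (Icc 0 (Γ.len e))) :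
    LipschitzWith K f := by
  intro p q
  rw [edist_def, sInf_eq_iInf, ENNReal.mul_iInf_of_ne (by simpa) (by simp)]
  refine le_iInf fun r => ?_
  rw [ENNReal.mul_iInf_of_ne (by simpa) (by simp)]
  refine le_iInf fun hr => ?_
  induction hr with
  | refl => simp
  | step e s t hs ht r _ ih =>
    rw [mul_add]
    exact (edist_triangle _ _ _).trans (add_le_add ih (h e hs ht))

/-! ### Eventually flat functions -/

theorem EventuallyFlat.exists_forall_lt {φ : C(Γ.Compl, ℝ)} (hφ : Γ.EventuallyFlat φ)
    (e : G.edgeSet) : ∃ ε > 0, ∀ t < ε, Γ.onEdge φ e t = Γ.onEdge φ e 0 := by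
  have hl := Γ.len_pos e
  obtain ⟨ε, hε, h⟩ := (mem_nhdsGT_iff_exists_Ioo_subset' hl).1 (hφ.2.2 e).1
  refine ⟨min ε (Γ.len e), lt_min hε hl, fun t ht => ?_⟩
  rcases le_or_gt t 0 with h0 | h0
  · exact Γ.onEdge_of_nonpos φ e h0
  have htl := ht.trans_le (min_le_right _ _)
  obtain ⟨c, hc, hc'⟩ := exists_deriv_eq_slope (Γ.onEdge φ e) h0
    (Γ.continuous_onEdge φ e).continuousOn
    (((hφ.1 e).differentiableOn (by simp)).mono (Ioo_subset_Ioo_right htl.le))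
  have := h ⟨hc.1, hc.2.trans (ht.trans_le (min_le_left _ _))⟩
  change deriv (Γ.onEdge φ e) c = 0 at this
  rw [this, eq_comm, div_eq_zero_iff] at hc'
  rcases hc' with h | h <;> linarith

theorem EventuallyFlat.exists_forall_gt {φ : C(Γ.Compl, ℝ)} (hφ : Γ.EventuallyFlat φ)
    (e : G.edgeSet) :
    ∃ ε < Γ.len e, ∀ t > ε, Γ.onEdge φ e t = Γ.onEdge φ e (Γ.len e) := by
  have hl := Γ.len_pos e
  obtain ⟨ε, hε, h⟩ := (mem_nhdsLT_iff_exists_Ioo_subset' hl).1 (hφ.2.2 e).2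
  refine ⟨max ε 0, max_lt hε hl, fun t ht => ?_⟩
  rcases le_or_gt (Γ.len e) t with h0 | h0
  · exact Γ.onEdge_of_len_le φ e h0
  have htl := (le_max_right _ _).trans_lt ht
  obtain ⟨c, hc, hc'⟩ := exists_deriv_eq_slope (Γ.onEdge φ e) h0
    (Γ.continuous_onEdge φ e).continuousOn
    (((hφ.1 e).differentiableOn (by simp)).mono (Ioo_subset_Ioo_left htl.le))
  have := h ⟨((le_max_left _ _).trans_lt ht).trans hc.1, hc.2⟩
  change deriv (Γ.onEdge φ e) c = 0 at this
  rw [this, eq_comm, div_eq_zero_iff] at hc'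
  rcases hc' with h | h <;> linarith

/-- Because coordinates are clamped, an eventually flat function is smooth in the coordinate of
each edge on the whole real line. -/
theorem eventuallyFlat_iff {φ : C(Γ.Compl, ℝ)} : Γ.EventuallyFlat φ ↔
    (∀ e, ContDiff ℝ (⊤ : ℕ∞) (Γ.onEdge φ e)) ∧
    (∃ S : Finset G.edgeSet, ∀ e ∉ S, ∀ t, Γ.onEdge φ e t = Γ.onEdge φ e 0) ∧
    ∀ e, (∀ᶠ t in 𝓝 0, Γ.onEdge φ e t = Γ.onEdge φ e 0) ∧
      ∀ᶠ t in 𝓝 (Γ.len e), Γ.onEdge φ e t = Γ.onEdge φ e (Γ.len e) := by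
  constructor
  · intro hφ
    refine ⟨fun e => ?_, ?_, fun e => ⟨?_, ?_⟩⟩
    · rw [contDiff_iff_contDiffAt]
      intro t
      obtain ⟨ε, hε, h⟩ := hφ.exists_forall_lt Γ e
      obtain ⟨ε', hε', h'⟩ := hφ.exists_forall_gt Γ e
      rcases le_or_gt t 0 with h0 | h0
      · refine (contDiffAt_const (c := Γ.onEdge φ e 0)).congr_of_eventuallyEq ?_
        filter_upwards [Iio_mem_nhds (h0.trans_lt hε)] with s hs using h s hs
      rcases le_or_gt (Γ.len e) t with h1 | h1
      · refine (contDiffAt_const (c := Γ.onEdge φ e (Γ.len e))).congr_of_eventuallyEq ?_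
        filter_upwards [Ioi_mem_nhds (hε'.trans_le h1)] with s hs using h' s hs
      · exact (hφ.1 e).contDiffAt (Ioo_mem_nhds h0 h1)
    · obtain ⟨S, hS⟩ := hφ.2.1
      have key : ∀ e ∉ S, ∀ t, t ≤ Γ.len e → Γ.onEdge φ e t = Γ.onEdge φ e 0 := by
        intro e he t h1
        rcases le_or_gt t 0 with h0 | h0
        · exact Γ.onEdge_of_nonpos φ e h0
        obtain ⟨c, hc, hc'⟩ := exists_deriv_eq_slope (Γ.onEdge φ e) h0
          (Γ.continuous_onEdge φ e).continuousOn
          (((hφ.1 e).differentiableOn (by simp)).mono (Ioo_subset_Ioo_right h1))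
        have := hS e he c ⟨hc.1, hc.2.trans_le h1⟩
        change deriv (Γ.onEdge φ e) c = 0 at this
        rw [this, eq_comm, div_eq_zero_iff] at hc'
        rcases hc' with h | h <;> linarith
      refine ⟨S, fun e he t => ?_⟩
      rcases le_or_gt t (Γ.len e) with h1 | h1
      · exact key e he t h1
      · rw [Γ.onEdge_of_len_le φ e h1.le, key e he _ le_rfl]
    · obtain ⟨ε, hε, h⟩ := hφ.exists_forall_lt Γ e
      filter_upwards [Iio_mem_nhds hε] with s hs using h s hs
    · obtain ⟨ε, hε, h⟩ := hφ.exists_forall_gt Γ e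
      filter_upwards [Ioi_mem_nhds hε] with s hs using h s hs
  · rintro ⟨h1, ⟨S, hS⟩, h2⟩
    refine ⟨fun e => (h1 e).contDiffOn, ⟨S, fun e he t _ => ?_⟩, fun e => ⟨?_, ?_⟩⟩
    · change deriv (Γ.onEdge φ e) t = 0
      rw [funext (hS e he), deriv_const]
    · have := (eventually_eventually_nhds.2 (h2 e).1)
      filter_upwards [this.filter_mono nhdsWithin_le_nhds] with t ht
      exact (EventuallyEq.deriv_eq ht).trans (deriv_const _ _)
    · have := (eventually_eventually_nhds.2 (h2 e).2)
      filter_upwards [this.filter_mono nhdsWithin_le_nhds] with t ht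
      exact (EventuallyEq.deriv_eq ht).trans (deriv_const _ _)

/-- The algebra of eventually flat functions. -/
def flatAlgebra : Subalgebra ℝ C(Γ.Compl, ℝ) where
  carrier := {φ | Γ.EventuallyFlat φ}
  mul_mem' {φ ψ} hφ hψ := by
    obtain ⟨h1, ⟨S, hS⟩, h2⟩ := Γ.eventuallyFlat_iff.1 hφ
    obtain ⟨k1, ⟨T, hT⟩, k2⟩ := Γ.eventuallyFlat_iff.1 hψ
    classical
    refine Γ.eventuallyFlat_iff.2 ⟨fun e => (h1 e).mul (k1 e), ⟨S ∪ T, fun e he t => ?_⟩,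
      fun e => ⟨?_, ?_⟩⟩
    · rw [Finset.notMem_union] at he
      exact congrArg₂ (· * ·) (hS e he.1 t) (hT e he.2 t)
    · filter_upwards [(h2 e).1, (k2 e).1] with t ht ht' using congrArg₂ (· * ·) ht ht'
    · filter_upwards [(h2 e).2, (k2 e).2] with t ht ht' using congrArg₂ (· * ·) ht ht'
  add_mem' {φ ψ} hφ hψ := by
    obtain ⟨h1, ⟨S, hS⟩, h2⟩ := Γ.eventuallyFlat_iff.1 hφ
    obtain ⟨k1, ⟨T, hT⟩, k2⟩ := Γ.eventuallyFlat_iff.1 hψ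
    classical
    refine Γ.eventuallyFlat_iff.2 ⟨fun e => (h1 e).add (k1 e), ⟨S ∪ T, fun e he t => ?_⟩,
      fun e => ⟨?_, ?_⟩⟩
    · rw [Finset.notMem_union] at he
      exact congrArg₂ (· + ·) (hS e he.1 t) (hT e he.2 t)
    · filter_upwards [(h2 e).1, (k2 e).1] with t ht ht' using congrArg₂ (· + ·) ht ht'
    · filter_upwards [(h2 e).2, (k2 e).2] with t ht ht' using congrArg₂ (· + ·) ht ht'
  algebraMap_mem' r := Γ.eventuallyFlat_iff.2
    ⟨fun _ => contDiff_const (c := r), ⟨∅, fun _ _ _ => rfl⟩,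
      fun _ => ⟨Eventually.of_forall fun _ => rfl, Eventually.of_forall fun _ => rfl⟩⟩

theorem EventuallyFlat.comp {φ : C(Γ.Compl, ℝ)} (hφ : Γ.EventuallyFlat φ) (η : C(ℝ, ℝ))
    (hη : ContDiff ℝ (⊤ : ℕ∞) η) : Γ.EventuallyFlat (η.comp φ) := by
  obtain ⟨h1, ⟨S, hS⟩, h2⟩ := Γ.eventuallyFlat_iff.1 hφ
  refine Γ.eventuallyFlat_iff.2 ⟨fun e => hη.comp (h1 e), ⟨S, fun e he t => ?_⟩,
      fun e => ⟨?_, ?_⟩⟩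
  · exact congrArg η (hS e he t)
  · filter_upwards [(h2 e).1] with t ht using congrArg η ht
  · filter_upwards [(h2 e).2] with t ht using congrArg η ht

/-- The function on the metric graph with the value `a v` at the vertex `v` and with the values
`b e t` in the interior of the edge `e`. -/
def edgewise (a : V → ℝ) (b : G.edgeSet → ℝ → ℝ) : Γ.Point → ℝ
  | .vertex v => a v
  | .inner e t _ => b e t

theorem edgewise_pt {a : V → ℝ} {b : G.edgeSet → ℝ → ℝ} {e : G.edgeSet}
    (h0 : b e 0 = a (Γ.src e)) (h1 : b e (Γ.len e) = a (Γ.tgt e)) {t : ℝ}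
    (ht : t ∈ Icc 0 (Γ.len e)) : Γ.edgewise a b (Γ.pt e t) = b e t := by
  rcases eq_or_lt_of_le ht.1 with h | h
  · rw [← h, Γ.pt_of_nonpos e le_rfl, h0]; rfl
  rcases eq_or_lt_of_le ht.2 with h' | h'
  · rw [h', Γ.pt_of_len_le e le_rfl, h1]; rfl
  · rw [Γ.pt_of_mem ⟨h, h'⟩]; rfl

/-- Prescribed vertex values and smooth edge functions which are constant near the ends of the edges
and on all but finitely many edges define an eventually flat function on the completion. -/
theorem exists_eventuallyFlat (a : V → ℝ) (b : G.edgeSet → ℝ → ℝ) (S : Finset G.edgeSet)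
    (hb : ∀ e, ContDiff ℝ (⊤ : ℕ∞) (b e))
    (h0 : ∀ e, ∀ᶠ t in 𝓝 0, b e t = a (Γ.src e))
    (h1 : ∀ e, ∀ᶠ t in 𝓝 (Γ.len e), b e t = a (Γ.tgt e))
    (hS : ∀ e ∉ S, ∀ t, b e t = a (Γ.src e)) :
    ∃ φ : C(Γ.Compl, ℝ), Γ.EventuallyFlat φ ∧ (∀ v, φ (Point.vertex v : Γ.Point) = a v) ∧
      ∀ e, ∀ t ∈ Icc 0 (Γ.len e), Γ.onEdge φ e t = b e t := by
  have hpt : ∀ e, ∀ t ∈ Icc 0 (Γ.len e), Γ.edgewise a b (Γ.pt e t) = b e t := fun e t ht =>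
    Γ.edgewise_pt (h0 e).self_of_nhds (h1 e).self_of_nhds ht
  have hlip : ∀ e, ∃ K : NNReal, LipschitzOnWith K (b e) (Icc 0 (Γ.len e)) := fun e =>
    ((hb e).contDiffOn.of_le (by simp)).exists_lipschitzOnWith (n := 1) (by simp)
      (convex_Icc _ _) isCompact_Icc
  choose K hK using hlip
  have hf : LipschitzWith (S.sup K + 1) (Γ.edgewise a b) := by
    refine Γ.lipschitzWith_of_edges (by positivity) fun e => ?_
    have : LipschitzOnWith (S.sup K + 1) (b e) (Icc 0 (Γ.len e)) := by
      by_cases he : e ∈ S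
      · exact (hK e).weaken ((Finset.le_sup he).trans le_self_add)
      · intro s _ t _
        rw [hS e he, hS e he, edist_self]
        exact zero_le
    intro s hs t ht
    simp only [hpt e s hs, hpt e t ht]
    exact this hs ht
  let φ : C(Γ.Compl, ℝ) := ⟨UniformSpace.Completion.extension (Γ.edgewise a b),
    UniformSpace.Completion.continuous_extension⟩
  have hφ : ∀ p : Γ.Point, φ p = Γ.edgewise a b p := fun p =>
    UniformSpace.Completion.extension_coe hf.uniformContinuous p
  have hφ' : ∀ e, ∀ t ∈ Icc 0 (Γ.len e), Γ.onEdge φ e t = b e t := fun e t ht =>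
    (hφ _).trans (hpt e t ht)
  have hd : ∀ e, ∀ t ∈ Ioo 0 (Γ.len e), Γ.onEdge φ e =ᶠ[𝓝 t] b e := fun e t ht => by
    filter_upwards [Ioo_mem_nhds ht.1 ht.2] with s hs using hφ' e s (Ioo_subset_Icc_self hs)
  refine ⟨φ, ⟨fun e => ?_, ⟨S, fun e he t ht => ?_⟩, fun e => ⟨?_, ?_⟩⟩, fun v => hφ _, hφ'⟩
  · exact (hb e).contDiffOn.congr fun t ht => hφ' e t (Ioo_subset_Icc_self ht)
  · refine (hd e t ht).deriv_eq.trans ?_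
    rw [funext (hS e he), deriv_const]
  · filter_upwards [(eventually_eventually_nhds.2 (h0 e)).filter_mono nhdsWithin_le_nhds,
      Ioo_mem_nhdsGT (Γ.len_pos e)] with t ht ht'
    exact (hd e t ht').deriv_eq.trans ((EventuallyEq.deriv_eq ht).trans (deriv_const _ _))
  · filter_upwards [(eventually_eventually_nhds.2 (h1 e)).filter_mono nhdsWithin_le_nhds,
      Ioo_mem_nhdsLT (Γ.len_pos e)] with t ht ht'
    exact (hd e t ht').deriv_eq.trans ((EventuallyEq.deriv_eq ht).trans (deriv_const _ _))

/-- A continuous function which is constant off a compact part of the graph takes the same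
constant value at the points of the completion which are not in the graph. -/
theorem eq_const_of_notMem_range {φ : C(Γ.Compl, ℝ)} {K : Set Γ.Point} (hK : IsCompact K) {c : ℝ}
    (h : ∀ p ∉ K, φ (p : Γ.Compl) = c) {x : Γ.Compl} (hx : x ∉ range fun p : Γ.Point => (p : Γ.Compl)) :
    φ x = c := by
  by_contra hne
  have hcl : IsClosed ((fun p : Γ.Point => (p : Γ.Compl)) '' K) :=
    (hK.image (UniformSpace.Completion.continuous_coe _)).isClosed
  have hopen : IsOpen ({x | φ x ≠ c} ∩ ((fun p : Γ.Point => (p : Γ.Compl)) '' K)ᶜ) :=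
    (isOpen_ne_fun φ.continuous continuous_const).inter hcl.isOpen_compl
  obtain ⟨p, hp⟩ := UniformSpace.Completion.denseRange_coe.exists_mem_open hopen
    ⟨x, hne, fun ⟨p, _, hp⟩ => hx ⟨p, hp⟩⟩
  exact hp.1 (h p fun hpK => hp.2 ⟨p, hpK, rfl⟩)

/-- The union of finitely many closed edges and finitely many vertices is compact. -/
theorem isCompact_edges (S : Finset G.edgeSet) (v : V) :
    IsCompact ((⋃ e ∈ S, Γ.pt e '' Icc 0 (Γ.len e)) ∪ {Point.vertex v}) :=
  (S.isCompact_biUnion fun e _ => isCompact_Icc.image (Γ.continuous_pt e)).union isCompact_singleton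

theorem eq_pt_or_vertex (p : Γ.Point) :
    (∃ e, ∃ t ∈ Ioo 0 (Γ.len e), p = Γ.pt e t) ∨ ∃ v, p = .vertex v := by
  cases p with
  | vertex v => exact .inr ⟨v, rfl⟩
  | inner e t ht => exact .inl ⟨e, t, ht, (Γ.pt_of_mem ht).symm⟩

/-! ### Cutoff functions and separation of points -/

theorem src_ne_tgt (e : G.edgeSet) : Γ.src e ≠ Γ.tgt e := by
  have h := e.2
  rw [← Γ.mk_src_tgt e, SimpleGraph.mem_edgeSet] at h
  exact h.ne

theorem finite_incident [G.LocallyFinite] (v : V) : {e | Γ.src e = v ∨ Γ.tgt e = v}.Finite := by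
  have h : ((fun w => s(v, w)) '' G.neighborSet v).Finite := (toFinite _).image _
  refine (h.preimage (f := Subtype.val) Subtype.val_injective.injOn).subset fun e he => ?_
  have hadj := e.2
  rw [← Γ.mk_src_tgt e, SimpleGraph.mem_edgeSet] at hadj
  rcases he with rfl | rfl
  · exact ⟨_, hadj, Γ.mk_src_tgt e⟩
  · exact ⟨_, hadj.symm, by simp only [Sym2.eq_swap (a := Γ.tgt e), Γ.mk_src_tgt e]⟩

/-- A smooth step from the value `0` on `(-∞, 1/3]` to the value `1` on `[2/3, ∞)`. -/
def smoothStep (x : ℝ) : ℝ := Real.smoothTransition (3 * x - 1)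

theorem contDiff_smoothStep : ContDiff ℝ (⊤ : ℕ∞) smoothStep :=
  Real.smoothTransition.contDiff.comp (by fun_prop)

theorem smoothStep_of_le {x : ℝ} (h : x ≤ 1 / 3) : smoothStep x = 0 :=
  Real.smoothTransition.zero_of_nonpos (by linarith)

theorem smoothStep_of_ge {x : ℝ} (h : 2 / 3 ≤ x) : smoothStep x = 1 :=
  Real.smoothTransition.one_of_one_le (by linarith)

theorem eventually_smoothStep_zero {f : ℝ → ℝ} {t : ℝ} (hf : Continuous f) (h : f t < 1 / 3) :
    ∀ᶠ s in 𝓝 t, smoothStep (f s) = 0 :=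
  (hf.continuousAt.eventually (gt_mem_nhds h)).mono fun _ hs => smoothStep_of_le (le_of_lt hs)

theorem eventually_smoothStep_one {f : ℝ → ℝ} {t : ℝ} (hf : Continuous f) (h : 2 / 3 < f t) :
    ∀ᶠ s in 𝓝 t, smoothStep (f s) = 1 :=
  (hf.continuousAt.eventually (lt_mem_nhds h)).mono fun _ hs => smoothStep_of_ge (le_of_lt hs)

/-- `g` is a cutoff function at the point `w` of the graph: it vanishes near `w`, and is equal to
`1` at the other vertices and at the points of the completion which are not in the graph. -/
structure IsCutoff (w : Γ.Point) (g : C(Γ.Compl, ℝ)) : Prop where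
  eventuallyFlat : Γ.EventuallyFlat g
  apply_self : g w = 0
  eventually_eq_zero : ∀ e t, Γ.pt e t = w → ∀ᶠ s in 𝓝 t, Γ.onEdge g e s = 0
  apply_vertex : ∀ v, w ≠ .vertex v → g (Point.vertex v : Γ.Point) = 1
  apply_of_notMem_range : ∀ x ∉ range fun p : Γ.Point => (p : Γ.Compl), g x = 1

open Classical in
/-- At a vertex, a cutoff function may be chosen with its transition on an initial part of each
incident edge, of relative length `r`. -/
theorem exists_isCutoff_vertex_aux [G.LocallyFinite] (w : V) {r : ℝ} (hr : 0 < r) (hr1 : r ≤ 1) :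
    ∃ g, Γ.IsCutoff (.vertex w) g ∧ ∀ e, ∀ t ∈ Icc 0 (Γ.len e),
      Γ.onEdge g e t = if Γ.src e = w then smoothStep (t / (r * Γ.len e)) else
        if Γ.tgt e = w then smoothStep ((Γ.len e - t) / (r * Γ.len e)) else 1 := by
  have hrl : ∀ e, 0 < r * Γ.len e := fun e => mul_pos hr (Γ.len_pos e)
  have hrl1 : ∀ e, 1 ≤ Γ.len e / (r * Γ.len e) := fun e => by
    rw [one_le_div (hrl e)]
    exact mul_le_of_le_one_left (Γ.len_pos e).le hr1
  refine (Γ.exists_eventuallyFlat (fun v => if v = w then 0 else 1)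
    (fun e t => if Γ.src e = w then smoothStep (t / (r * Γ.len e)) else
        if Γ.tgt e = w then smoothStep ((Γ.len e - t) / (r * Γ.len e)) else 1)
    (Γ.finite_incident w).toFinset (fun e => ?_) (fun e => ?_) (fun e => ?_)
    (fun e he => ?_)).elim fun g ⟨hg, hgv, hge⟩ => ?_
  · split_ifs
    · exact contDiff_smoothStep.comp (by fun_prop)
    · exact contDiff_smoothStep.comp (by fun_prop)
    · exact contDiff_const
  · split_ifs with h1 h2
    · exact eventually_smoothStep_zero (by fun_prop) (by simp)
    · refine eventually_smoothStep_one (by fun_prop) ?_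
      have := hrl1 e
      simp only [sub_zero]; linarith
    · simp
  · have hne := Γ.src_ne_tgt e
    split_ifs with h1 h2 h2
    · exact absurd (h1.trans h2.symm) hne
    · refine eventually_smoothStep_one (by fun_prop) ?_
      have := hrl1 e
      linarith
    · exact eventually_smoothStep_zero (by fun_prop) (by simp)
    · simp
  · simp only [Finite.mem_toFinset, mem_ofPred_eq, not_or] at he
    simp [he.1, he.2]
  refine ⟨g, ⟨hg, by simp [hgv], ?_, ?_, ?_⟩, hge⟩
  · intro e t hpt
    rcases le_or_gt t 0 with h0 | h0
    · obtain ⟨ε, hε, h⟩ := hg.exists_forall_lt Γ e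
      filter_upwards [Iio_mem_nhds (h0.trans_lt hε)] with s hs
      rw [Γ.pt_of_nonpos e h0] at hpt
      rw [h s hs, onEdge, Γ.pt_of_nonpos e le_rfl, hpt, hgv, if_pos rfl]
    rcases le_or_gt (Γ.len e) t with h1 | h1
    · obtain ⟨ε, hε, h⟩ := hg.exists_forall_gt Γ e
      filter_upwards [Ioi_mem_nhds (hε.trans_le h1)] with s hs
      rw [Γ.pt_of_len_le e h1] at hpt
      rw [h s hs, onEdge, Γ.pt_of_len_le e le_rfl, hpt, hgv, if_pos rfl]
    · rw [Γ.pt_of_mem ⟨h0, h1⟩] at hpt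
      cases hpt
  · intro v hv
    rw [hgv, if_neg fun h => hv (by rw [h])]
  · intro x hx
    refine Γ.eq_const_of_notMem_range
      (Γ.isCompact_edges (Γ.finite_incident w).toFinset w) (fun p hp => ?_) hx
    rcases Γ.eq_pt_or_vertex p with ⟨e, t, ht, rfl⟩ | ⟨v, rfl⟩
    · have he : ¬(Γ.src e = w ∨ Γ.tgt e = w) := fun he => hp <| .inl <| mem_biUnion
        (x := e) (by simpa using he) ⟨t, Ioo_subset_Icc_self ht, rfl⟩
      rw [not_or] at he
      refine (hge e t (Ioo_subset_Icc_self ht)).trans ?_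
      simp [he.1, he.2]
    · rw [hgv, if_neg]
      rintro rfl
      exact hp (.inr rfl)

open Classical in
/-- At an interior point of an edge, a cutoff function may be chosen with its transition at distance
at most `δ` from this point. -/
theorem exists_isCutoff_inner_aux {e₀ : G.edgeSet} {t₀ : ℝ} (ht₀ : t₀ ∈ Ioo 0 (Γ.len e₀)) {δ : ℝ}
    (hδ : 0 < δ) (hδ0 : δ ≤ t₀) (hδ1 : δ ≤ Γ.len e₀ - t₀) :
    ∃ g, Γ.IsCutoff (.inner e₀ t₀ ht₀) g ∧ ∀ e, ∀ t ∈ Icc 0 (Γ.len e),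
      Γ.onEdge g e t = if e = e₀ then smoothStep (((t - t₀) / δ) ^ 2) else 1 := by
  have h01 : ∀ x, δ ≤ |x| → 1 ≤ (x / δ) ^ 2 := fun x hx => by
    rw [one_le_sq_iff_one_le_abs, abs_div, abs_of_pos hδ, one_le_div hδ]
    exact hx
  refine (Γ.exists_eventuallyFlat (fun _ => 1)
    (fun e t => if e = e₀ then smoothStep (((t - t₀) / δ) ^ 2) else 1)
    {e₀} (fun e => ?_) (fun e => ?_) (fun e => ?_)
    (fun e he => ?_)).elim fun g ⟨hg, hgv, hge⟩ => ?_
  · split_ifs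
    · exact contDiff_smoothStep.comp (by fun_prop)
    · exact contDiff_const
  · split_ifs with h1
    · refine eventually_smoothStep_one (by fun_prop) ?_
      have := h01 (0 - t₀) (by rw [abs_of_neg] <;> linarith)
      linarith
    · simp
  · split_ifs with h1
    · subst h1
      refine eventually_smoothStep_one (by fun_prop) ?_
      have := h01 (Γ.len e - t₀) (by rw [abs_of_pos] <;> linarith)
      linarith
    · simp
  · simp only [Finset.mem_singleton] at he
    simp [he]
  refine ⟨g, ⟨hg, ?_, ?_, fun v _ => hgv v, ?_⟩, hge⟩
  · rw [← Γ.pt_of_mem]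
    refine (hge e₀ t₀ (Ioo_subset_Icc_self ht₀)).trans ?_
    rw [if_pos rfl, smoothStep_of_le (by simp)]
  · intro e t hpt
    have ht : t ∈ Ioo 0 (Γ.len e) := by
      by_contra hn
      rw [pt, dif_neg hn] at hpt
      split_ifs at hpt
    rw [Γ.pt_of_mem ht] at hpt
    injection hpt with h1 h2
    subst h1 h2
    have := eventually_smoothStep_zero (f := fun s => ((s - t) / δ) ^ 2) (t := t)
      (by fun_prop) (by simp)
    filter_upwards [this, Ioo_mem_nhds ht.1 ht.2] with s hs hs'
    rw [hge e s (Ioo_subset_Icc_self hs'), if_pos rfl, hs]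
  · intro x hx
    refine Γ.eq_const_of_notMem_range (Γ.isCompact_edges {e₀} (Γ.src e₀)) (fun p hp => ?_) hx
    rcases Γ.eq_pt_or_vertex p with ⟨e, t, ht, rfl⟩ | ⟨v, rfl⟩
    · have he : e ≠ e₀ := by
        rintro rfl
        exact hp <| .inl <| mem_biUnion (x := e) (by simp) ⟨t, Ioo_subset_Icc_self ht, rfl⟩
      exact (hge e t (Ioo_subset_Icc_self ht)).trans (if_neg he)
    · exact hgv v

theorem exists_isCutoff [G.LocallyFinite] (w p : Γ.Point) :
    ∃ g, Γ.IsCutoff w g ∧ (p ≠ w → g p = 1) := by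
  classical
  cases w with
  | vertex w =>
    rcases Γ.eq_pt_or_vertex p with ⟨e, t, ht, rfl⟩ | ⟨v, rfl⟩
    · have hl := Γ.len_pos e
      have ht' : 0 < Γ.len e - t := sub_pos.2 ht.2
      obtain ⟨g, hg, hge⟩ := Γ.exists_isCutoff_vertex_aux w
        (r := min (t / Γ.len e) ((Γ.len e - t) / Γ.len e))
        (lt_min (div_pos ht.1 hl) (div_pos ht' hl))
        ((min_le_left _ _).trans ((div_le_one hl).2 ht.2.le))
      refine ⟨g, hg, fun _ => (hge e t (Ioo_subset_Icc_self ht)).trans ?_⟩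
      have hr : 0 < min (t / Γ.len e) ((Γ.len e - t) / Γ.len e) * Γ.len e :=
        mul_pos (lt_min (div_pos ht.1 hl) (div_pos ht' hl)) hl
      have h1 : 1 ≤ t / (min (t / Γ.len e) ((Γ.len e - t) / Γ.len e) * Γ.len e) := by
        rw [one_le_div hr, ← le_div_iff₀ hl]
        exact min_le_left _ _
      have h2 : 1 ≤ (Γ.len e - t) / (min (t / Γ.len e) ((Γ.len e - t) / Γ.len e) * Γ.len e) := by
        rw [one_le_div hr, ← le_div_iff₀ hl]
        exact min_le_right _ _
      split_ifs
      · exact smoothStep_of_ge (by linarith)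
      · exact smoothStep_of_ge (by linarith)
      · rfl
    · obtain ⟨g, hg, -⟩ := Γ.exists_isCutoff_vertex_aux w one_pos le_rfl
      exact ⟨g, hg, fun h => hg.apply_vertex v h.symm⟩
  | inner e₀ t₀ ht₀ =>
    have hδ : 0 < min t₀ (Γ.len e₀ - t₀) := lt_min ht₀.1 (sub_pos.2 ht₀.2)
    rcases Γ.eq_pt_or_vertex p with ⟨e, t, ht, rfl⟩ | ⟨v, rfl⟩
    · by_cases htt : t = t₀
      · obtain ⟨g, hg, hge⟩ := Γ.exists_isCutoff_inner_aux ht₀ hδ (min_le_left _ _)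
          (min_le_right _ _)
        refine ⟨g, hg, fun hne => (hge e t (Ioo_subset_Icc_self ht)).trans (if_neg ?_)⟩
        rintro rfl
        subst htt
        exact hne (Γ.pt_of_mem ht)
      · have hd : 0 < |t - t₀| := abs_pos.2 (sub_ne_zero.2 htt)
        obtain ⟨g, hg, hge⟩ := Γ.exists_isCutoff_inner_aux ht₀ (lt_min hδ hd)
          ((min_le_left _ _).trans (min_le_left _ _)) ((min_le_left _ _).trans (min_le_right _ _))
        refine ⟨g, hg, fun hne => (hge e t (Ioo_subset_Icc_self ht)).trans ?_⟩
        split_ifs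
        · refine smoothStep_of_ge (le_trans (by norm_num) (?_ : (1 : ℝ) ≤ _))
          rw [one_le_sq_iff_one_le_abs, abs_div, abs_of_pos (lt_min hδ hd), one_le_div (lt_min hδ hd)]
          exact min_le_right _ _
        · rfl
    · obtain ⟨g, hg, -⟩ := Γ.exists_isCutoff_inner_aux ht₀ hδ (min_le_left _ _)
          (min_le_right _ _)
      exact ⟨g, hg, fun h => hg.apply_vertex v h.symm⟩

theorem coe_injective [G.LocallyFinite] :
    Function.Injective fun p : Γ.Point => (p : Γ.Compl) := by
  intro p w h
  by_contra hne
  obtain ⟨g, hg, hg1⟩ := Γ.exists_isCutoff w p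
  have := hg1 hne
  rw [show (p : Γ.Compl) = w from h, hg.apply_self] at this
  exact zero_ne_one this

theorem exists_isCutoff_compl [G.LocallyFinite] (w : Γ.Point) (x : Γ.Compl) :
    ∃ g, Γ.IsCutoff w g ∧ (x ≠ w → g x = 1) := by
  by_cases hx : x ∈ range fun p : Γ.Point => (p : Γ.Compl)
  · obtain ⟨p, rfl⟩ := hx
    obtain ⟨g, hg, h⟩ := Γ.exists_isCutoff w p
    exact ⟨g, hg, fun hne => h fun h' => hne (by rw [h'])⟩
  · obtain ⟨g, hg, -⟩ := Γ.exists_isCutoff w w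
    exact ⟨g, hg, fun _ => hg.apply_of_notMem_range x hx⟩

/-- This combination of two cutoff functions is equal to `1` wherever one of them is. -/
theorem IsCutoff.combine {w : Γ.Point} {g h : C(Γ.Compl, ℝ)} (hg : Γ.IsCutoff w g)
    (hh : Γ.IsCutoff w h) : Γ.IsCutoff w (1 - (1 - g) * (1 - h)) where
  eventuallyFlat := Γ.flatAlgebra.sub_mem Γ.flatAlgebra.one_mem <| Γ.flatAlgebra.mul_mem
    (Γ.flatAlgebra.sub_mem Γ.flatAlgebra.one_mem hg.eventuallyFlat)
    (Γ.flatAlgebra.sub_mem Γ.flatAlgebra.one_mem hh.eventuallyFlat)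
  apply_self := by simp [hg.apply_self, hh.apply_self]
  eventually_eq_zero e t ht := by
    filter_upwards [hg.eventually_eq_zero e t ht, hh.eventually_eq_zero e t ht] with s h1 h2
    rw [onEdge] at h1 h2 ⊢
    simp [h1, h2]
  apply_vertex v hv := by simp [hg.apply_vertex v hv]
  apply_of_notMem_range x hx := by simp [hg.apply_of_notMem_range x hx]

theorem exists_isCutoff_compl₂ [G.LocallyFinite] (w : Γ.Point) (x y : Γ.Compl) :
    ∃ g, Γ.IsCutoff w g ∧ (x ≠ w → g x = 1) ∧ (y ≠ w → g y = 1) := by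
  obtain ⟨g, hg, hgx⟩ := Γ.exists_isCutoff_compl w x
  obtain ⟨h, hh, hhy⟩ := Γ.exists_isCutoff_compl w y
  exact ⟨_, hg.combine Γ hh, fun hx => by simp [hgx hx], fun hy => by simp [hhy hy]⟩

/-- A point of the graph which is not a vertex of degree one has a neighborhood disjoint from the
boundary: the set where a cutoff function at this point is less than `1`. -/
theorem isClosed_bdry [G.LocallyFinite] : IsClosed Γ.bdry := by
  rw [← isOpen_compl_iff, isOpen_iff_mem_nhds]
  intro x hx
  simp only [bdry, mem_compl_iff, mem_union, not_or, not_not] at hx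
  obtain ⟨hx1, w, rfl⟩ := hx
  obtain ⟨g, hg, -⟩ := Γ.exists_isCutoff w w
  have hU : {z | g z < 1} ∈ 𝓝 (w : Γ.Compl) :=
    g.continuous.continuousAt.eventually (gt_mem_nhds (by rw [hg.apply_self]; exact one_pos))
  refine mem_of_superset hU fun z hz hzb => ?_
  rcases hzb with ⟨v, hv, rfl⟩ | hzb
  · exact (ne_of_lt hz) (hg.apply_vertex v fun h => hx1 ⟨v, hv, by rw [h]⟩)
  · exact (ne_of_lt hz) (hg.apply_of_notMem_range z hzb)

/-- If the completion is weakly connected, the eventually flat functions with values in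
`{-1, 0, 1}` on the boundary separate the points of the completion: multiply the sign given by a
separation of the complement of a finite set `W` by a product of cutoff functions at the points
of `W`. -/
theorem exists_separating [G.LocallyFinite] (hweak : Γ.WeaklyConnected) {x y : Γ.Compl}
    (hxy : x ≠ y) : ∃ φ, Γ.EventuallyFlat φ ∧ φ x ≠ φ y ∧
      ∀ z ∈ Γ.bdry, φ z = -1 ∨ φ z = 0 ∨ φ z = 1 := by
  classical
  obtain ⟨W, hW, A, B, hA, hB, hAB, hWAB, hxA, hyB⟩ := hweak x y hxy
  choose g' hg' hgx hgy using fun w => Γ.exists_isCutoff_compl₂ w x y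
  have hWc : ∀ z, z ∈ A ∪ B ↔ ∀ w ∈ W, z ≠ (w : Γ.Compl) := by
    intro z
    rw [← hWAB]
    simp only [mem_compl_iff, mem_image, not_exists, not_and]
    exact forall₂_congr fun w _ => ⟨fun h h' => h h'.symm, fun h h' => h h'.symm⟩
  let g : C(Γ.Compl, ℝ) := ∏ w ∈ hW.toFinset, g' w
  have hgapp : ∀ z, g z = ∏ w ∈ hW.toFinset, g' w z := fun z => by
    simp [g, ContinuousMap.prod_apply]
  have hgflat : Γ.EventuallyFlat g := Γ.flatAlgebra.prod_mem fun w _ => (hg' w).eventuallyFlat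
  have hg1 : ∀ z, (∀ w ∈ W, g' w z = 1) → g z = 1 := fun z h => by
    rw [hgapp]
    exact Finset.prod_eq_one fun w hw => h w (hW.mem_toFinset.1 hw)
  have hg0 : ∀ z, ∀ w ∈ W, g' w z = 0 → g z = 0 := fun z w hw h => by
    rw [hgapp]
    exact Finset.prod_eq_zero (hW.mem_toFinset.2 hw) h
  have hgx1 : g x = 1 := hg1 x fun w hw => hgx w ((hWc x).1 (.inl hxA) w hw)
  have hgy1 : g y = 1 := hg1 y fun w hw => hgy w ((hWc y).1 (.inr hyB) w hw)
  have hcont : Continuous fun z => if z ∈ A then g z else -g z := by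
    refine Continuous.if (fun z hz => ?_) g.continuous g.continuous.neg
    rw [ofPred_mem_eq, hA.frontier_eq] at hz
    have hzB : z ∉ B := fun hzB => by
      obtain ⟨a, haB, haA⟩ := mem_closure_iff.1 hz.1 B hB hzB
      exact hAB.notMem_of_mem_left haA haB
    have : ¬∀ w ∈ W, z ≠ (w : Γ.Compl) := fun h => ((hWc z).2 h).elim hz.2 hzB
    push Not at this
    obtain ⟨w, hw, rfl⟩ := this
    rw [hg0 _ w hw (hg' w).apply_self, neg_zero]
  let φ : C(Γ.Compl, ℝ) := ⟨fun z => if z ∈ A then g z else -g z, hcont⟩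
  have hφA : ∀ z ∈ A, φ z = g z := fun z hz => if_pos hz
  have hφB : ∀ z ∉ A, φ z = -g z := fun z hz => if_neg hz
  -- Near each point of each edge, `φ` agrees with `g` or with `-g`.
  have hloc : ∀ e t, Γ.onEdge φ e =ᶠ[𝓝 t] Γ.onEdge g e ∨ Γ.onEdge φ e =ᶠ[𝓝 t] -Γ.onEdge g e := by
    intro e t
    have hc : Continuous fun s => (Γ.pt e s : Γ.Compl) :=
      (UniformSpace.Completion.continuous_coe _).comp (Γ.continuous_pt e)
    by_cases hw : ∀ w ∈ W, (Γ.pt e t : Γ.Compl) ≠ w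
    · rcases (hWc _).2 hw with h | h
      · left
        filter_upwards [hc.continuousAt.eventually (hA.mem_nhds h)] with s hs using hφA _ hs
      · right
        filter_upwards [hc.continuousAt.eventually (hB.mem_nhds h)] with s hs
        exact hφB _ (hAB.notMem_of_mem_right hs)
    · push Not at hw
      obtain ⟨w, hw, hwt⟩ := hw
      left
      filter_upwards [(hg' w).eventually_eq_zero e t (Γ.coe_injective hwt)] with s hs
      have h0 : g (Γ.pt e s) = 0 := hg0 _ w hw hs
      change φ (Γ.pt e s) = g (Γ.pt e s)
      by_cases h : (Γ.pt e s : Γ.Compl) ∈ A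
      · exact hφA _ h
      · rw [hφB _ h, h0, neg_zero]
  have hderiv : ∀ e t, deriv (Γ.onEdge g e) t = 0 → deriv (Γ.onEdge φ e) t = 0 := by
    intro e t h
    rcases hloc e t with h' | h'
    · rw [h'.deriv_eq, h]
    · rw [h'.deriv_eq, deriv.neg, h, neg_zero]
  have hgs := (Γ.eventuallyFlat_iff.1 hgflat).1
  refine ⟨φ, ⟨fun e => ?_, ?_, fun e => ⟨?_, ?_⟩⟩, ?_, fun z hz => ?_⟩
  · refine fun t _ => ContDiffAt.contDiffWithinAt ?_
    rcases hloc e t with h | h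
    · exact (hgs e).contDiffAt.congr_of_eventuallyEq h
    · exact (hgs e).neg.contDiffAt.congr_of_eventuallyEq h
  · obtain ⟨S, hS⟩ := hgflat.2.1
    exact ⟨S, fun e he t ht => hderiv e t (hS e he t ht)⟩
  · exact (hgflat.2.2 e).1.mono fun t => hderiv e t
  · exact (hgflat.2.2 e).2.mono fun t => hderiv e t
  · rw [hφA x hxA, hφB y (hAB.notMem_of_mem_right hyB), hgx1, hgy1]
    norm_num
  · have h01 : g z = 0 ∨ g z = 1 := by
      rcases hz with ⟨v, -, rfl⟩ | hz
      · by_cases hv : ∃ w ∈ W, w = .vertex v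
        · obtain ⟨w, hw, rfl⟩ := hv
          exact .inl (hg0 _ _ hw (hg' _).apply_self)
        · push Not at hv
          exact .inr (hg1 _ fun w hw => (hg' w).apply_vertex v (hv w hw))
      · exact .inr (hg1 _ fun w _ => (hg' w).apply_of_notMem_range z hz)
    by_cases h : z ∈ A
    · rw [hφA z h]; tauto
    · rw [hφB z h]
      rcases h01 with h | h <;> rw [h] <;> norm_num

/-! ### Test functions and the topology of the boundary -/

theorem exists_flat_near [G.LocallyFinite] [CompactSpace Γ.Compl] (hweak : Γ.WeaklyConnected)
    (f : C(Γ.Compl, ℝ)) {ε : ℝ} (hε : 0 < ε) : ∃ φ, Γ.EventuallyFlat φ ∧ ‖φ - f‖ < ε := by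
  have hsep : Γ.flatAlgebra.SeparatesPoints := fun x y hxy => by
    obtain ⟨φ, hφ, hne, -⟩ := Γ.exists_separating hweak hxy
    exact ⟨φ, ⟨φ, hφ, rfl⟩, hne⟩
  obtain ⟨⟨φ, hφ⟩, h⟩ :=
    ContinuousMap.exists_mem_subalgebra_near_continuousMap_of_separatesPoints _ hsep f ε hε
  exact ⟨φ, hφ, h⟩

/-- Test functions exist: approximate an Urysohn function by an eventually flat function, and
compose with a smooth step. -/
theorem exists_testFunction [G.LocallyFinite] [CompactSpace Γ.Compl] (hweak : Γ.WeaklyConnected)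
    {E : Set Γ.bdry} (hE : IsClopen E) : ∃ φ, Γ.TestFunction E φ := by
  have hemb := Γ.isClosed_bdry.isClosedEmbedding_subtypeVal
  obtain ⟨f, hf0, hf1, -⟩ := exists_continuous_zero_one_of_isClosed
    (hemb.isClosedMap _ hE.compl.isClosed) (hemb.isClosedMap _ hE.isClosed)
    ((disjoint_image_iff Subtype.val_injective).2 disjoint_compl_left)
  obtain ⟨φ, hφ, hφf⟩ := Γ.exists_flat_near hweak f (ε := 1 / 3) (by norm_num)
  have hnear : ∀ z, |φ z - f z| ≤ 1 / 3 := fun z =>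
    ((φ - f).norm_coe_le_norm z).trans hφf.le
  refine ⟨_, hφ.comp Γ ⟨smoothStep, contDiff_smoothStep.continuous⟩ contDiff_smoothStep,
    fun x hx => ?_, fun x hx => ?_⟩
  · have h := hnear x
    rw [hf1 (mem_image_of_mem _ hx), abs_le] at h
    simp only [Pi.one_apply] at h
    exact smoothStep_of_ge (by linarith)
  · have h := hnear x
    rw [hf0 (mem_image_of_mem _ hx), abs_le] at h
    simp only [Pi.zero_apply] at h
    exact smoothStep_of_le (by linarith)

/-- The separating functions of `exists_separating` have finitely many values on the boundary, so
that their level sets there are clopen. -/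
theorem totallyDisconnectedSpace_bdry [G.LocallyFinite] (hweak : Γ.WeaklyConnected) :
    TotallyDisconnectedSpace Γ.bdry := by
  suffices TotallySeparatedSpace Γ.bdry from inferInstance
  refine totallySeparatedSpace_iff_exists_isClopen.2 fun x y hxy => ?_
  obtain ⟨φ, -, hne, hφ⟩ := Γ.exists_separating hweak (Subtype.coe_injective.ne hxy)
  have hc : Continuous fun z : Γ.bdry => φ z := φ.continuous.comp continuous_subtype_val
  refine ⟨{z | φ z = φ x}, ⟨isClosed_eq hc continuous_const, ?_⟩, rfl, fun h => hne h.symm⟩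
  have : {z : Γ.bdry | φ z = φ x} = {z : Γ.bdry | |φ z - φ x| < 1} := by
    ext z
    simp only [mem_ofPred_eq]
    refine ⟨fun h => by simp [h], fun h => ?_⟩
    rw [abs_lt] at h
    rcases hφ z z.2 with h1 | h1 | h1 <;> rcases hφ x x.2 with h2 | h2 | h2 <;>
      rw [h1, h2] at h ⊢ <;> norm_num at h
  rw [this]
  exact isOpen_lt (by fun_prop) continuous_const

theorem edist_ne_top (hconn : G.Connected) (p q : Γ.Point) : edist p q ≠ ⊤ := by
  have hstep : ∀ e s t, edist (Γ.pt e s) (Γ.pt e t) < ⊤ := fun e s t => by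
    refine ((Γ.lipschitzWith_pt e) s t).trans_lt ?_
    simp [edist_lt_top]
  have hadj : ∀ v w, G.Adj v w → edist (Point.vertex v : Γ.Point) (.vertex w) < ⊤ := by
    intro v w h
    have hs := Γ.mk_src_tgt ⟨s(v, w), h⟩
    have := hstep ⟨s(v, w), h⟩ 0 (Γ.len ⟨s(v, w), h⟩)
    rw [Γ.pt_of_nonpos _ le_rfl, Γ.pt_of_len_le _ le_rfl] at this
    rcases Sym2.eq_iff.1 hs with ⟨h1, h2⟩ | ⟨h1, h2⟩
    · rwa [h1, h2] at this
    · rwa [h1, h2, edist_comm] at this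
  have hvert : ∀ v w, edist (Point.vertex v : Γ.Point) (.vertex w) < ⊤ := by
    intro v w
    obtain ⟨π⟩ := hconn.preconnected v w
    induction π with
    | nil => simp
    | cons h _ ih => exact (edist_triangle _ _ _).trans_lt (ENNReal.add_lt_top.2 ⟨hadj _ _ h, ih⟩)
  have hpv : ∀ p : Γ.Point, ∃ v, edist p (.vertex v) < ⊤ := by
    intro p
    rcases Γ.eq_pt_or_vertex p with ⟨e, t, -, rfl⟩ | ⟨v, rfl⟩
    · refine ⟨Γ.src e, ?_⟩
      rw [← Γ.pt_of_nonpos e le_rfl]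
      exact hstep _ _ _
    · exact ⟨v, by simp⟩
  obtain ⟨v, hv⟩ := hpv p
  obtain ⟨w, hw⟩ := hpv q
  rw [edist_comm] at hw
  exact ((edist_triangle4 _ _ _ _).trans_lt
    (ENNReal.add_lt_top.2 ⟨ENNReal.add_lt_top.2 ⟨hv, hvert v w⟩, hw⟩)).ne

theorem metrizableSpace_compl (hconn : G.Connected) :
    TopologicalSpace.MetrizableSpace Γ.Compl := by
  let _ : PseudoMetricSpace Γ.Point :=
    PseudoEMetricSpace.toPseudoMetricSpace fun p q => Γ.edist_ne_top hconn p q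
  change TopologicalSpace.MetrizableSpace (UniformSpace.Completion Γ.Point)
  infer_instance

/-! ### Integration along the edges -/

/-- Because of this, integrals over an edge can be computed in its coordinate without any
measurability assumption on the integrand. -/
theorem measurableEmbedding_pt [G.LocallyFinite] (e : G.edgeSet) :
    MeasurableEmbedding fun t : Ioo 0 (Γ.len e) => Γ.pt e t := by
  have : T2Space Γ.Point :=
    T2Space.of_injective_continuous Γ.coe_injective (UniformSpace.Completion.continuous_coe _)
  have : PolishSpace (Ioo 0 (Γ.len e)) := isOpen_Ioo.polishSpace
  refine ((Γ.continuous_pt e).comp continuous_subtype_val).measurableEmbedding ?_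
  rintro ⟨s, hs⟩ ⟨t, ht⟩ h
  simp only [Function.comp_apply, Γ.pt_of_mem hs, Γ.pt_of_mem ht, Point.inner.injEq, true_and] at h
  exact Subtype.ext h

/-- The measure which the edge `e` contributes to `Γ.vol`. -/
def edgeVol (e : G.edgeSet) : Measure Γ.Point := (volume.restrict (Ioo 0 (Γ.len e))).map (Γ.pt e)

theorem edgeVol_eq_map (e : G.edgeSet) : Γ.edgeVol e =
    (volume.comap Subtype.val).map fun t : Ioo 0 (Γ.len e) => Γ.pt e t := by
  rw [edgeVol, ← map_comap_subtype_coe measurableSet_Ioo,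
    Measure.map_map (Γ.measurable_pt e) measurable_subtype_coe]
  rfl

theorem integral_edgeVol [G.LocallyFinite] (e : G.edgeSet) (f : Γ.Point → ℝ) :
    ∫ p, f p ∂Γ.edgeVol e = ∫ t in Ioo 0 (Γ.len e), f (Γ.pt e t) := by
  rw [edgeVol_eq_map, (Γ.measurableEmbedding_pt e).integral_map,
    integral_subtype_comap measurableSet_Ioo fun t => f (Γ.pt e t)]

theorem integrable_edgeVol_iff [G.LocallyFinite] {e : G.edgeSet} {f : Γ.Point → ℝ} :
    Integrable f (Γ.edgeVol e) ↔ IntegrableOn (fun t => f (Γ.pt e t)) (Ioo 0 (Γ.len e)) := by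
  rw [edgeVol_eq_map, (Γ.measurableEmbedding_pt e).integrable_map_iff, IntegrableOn,
    ← map_comap_subtype_coe measurableSet_Ioo,
    (MeasurableEmbedding.subtype_coe measurableSet_Ioo).integrable_map_iff]
  rfl

theorem integrableOn_of_integrable_vol [G.LocallyFinite] {f : Γ.Point → ℝ}
    (hf : Integrable f Γ.vol) (e : G.edgeSet) :
    IntegrableOn (fun t => f (Γ.pt e t)) (Ioo 0 (Γ.len e)) :=
  Γ.integrable_edgeVol_iff.1 (hf.mono_measure (Measure.le_sum _ e))

theorem integral_vol_eq_sum [G.LocallyFinite] {f : Γ.Point → ℝ} (S : Finset G.edgeSet)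
    (h0 : ∀ e ∉ S, ∀ t ∈ Ioo 0 (Γ.len e), f (Γ.pt e t) = 0) (hf : Integrable f Γ.vol) :
    ∫ p, f p ∂Γ.vol = ∑ e ∈ S, ∫ t in 0..Γ.len e, f (Γ.pt e t) := by
  have h := hasSum_integral_measure (μ := Γ.edgeVol) hf
  simp only [integral_edgeVol] at h
  refine h.unique ?_
  have h' : ∀ e, ∫ t in Ioo 0 (Γ.len e), f (Γ.pt e t) = ∫ t in 0..Γ.len e, f (Γ.pt e t) := fun e => by
    rw [intervalIntegral.integral_of_le (Γ.len_pos e).le, integral_Ioc_eq_integral_Ioo]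
  simp only [h']
  refine hasSum_sum_of_ne_finset_zero fun e he => ?_
  rw [← h', setIntegral_congr_fun measurableSet_Ioo (h0 e he), integral_zero]

theorem integrable_vol_of_edges [Countable V] [G.LocallyFinite] {f : Γ.Point → ℝ}
    (S : Finset G.edgeSet) (h0 : ∀ e ∉ S, ∀ t ∈ Ioo 0 (Γ.len e), f (Γ.pt e t) = 0)
    (hf : ∀ e, IntegrableOn (fun t => f (Γ.pt e t)) (Ioo 0 (Γ.len e))) : Integrable f Γ.vol := by
  refine integrable_sum_measure (μ := Γ.edgeVol) (fun e => Γ.integrable_edgeVol_iff.2 (hf e)) ?_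
  refine summable_of_ne_finset_zero (s := S) fun e he => ?_
  rw [integral_edgeVol, setIntegral_congr_fun (g := fun _ => 0) measurableSet_Ioo
    fun t ht => by simp [h0 e he t ht], integral_zero]

theorem integrable_mul_continuous [CompactSpace Γ.Compl] {f : Γ.Point → ℝ}
    (hf : Integrable f Γ.vol) (u : C(Γ.Compl, ℝ)) : Integrable (fun p => f p * u p) Γ.vol :=
  hf.mul_bdd (c := ‖u‖) (u.continuous.comp
    (UniformSpace.Completion.continuous_coe _)).measurable.aestronglyMeasurable
    (Eventually.of_forall fun p => u.norm_coe_le_norm p)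

/-! ### The pairing of continuous functions with eventually flat functions -/

theorem secondDeriv_pt (φ : C(Γ.Compl, ℝ)) {e : G.edgeSet} {t : ℝ} (ht : t ∈ Ioo 0 (Γ.len e)) :
    Γ.secondDeriv (fun p => φ p) (Γ.pt e t) = deriv (deriv (Γ.onEdge φ e)) t := by
  rw [Γ.pt_of_mem ht, secondDeriv, iteratedDeriv_succ, iteratedDeriv_one]
  rfl

/-- The finite set `S` contains all edges on which `φ` is not constant. -/
def FlatOff (S : Finset G.edgeSet) (φ : C(Γ.Compl, ℝ)) : Prop :=
  ∀ e ∉ S, ∀ t, Γ.onEdge φ e t = Γ.onEdge φ e 0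

theorem EventuallyFlat.exists_flatOff {φ : C(Γ.Compl, ℝ)} (hφ : Γ.EventuallyFlat φ) :
    ∃ S, Γ.FlatOff S φ := (Γ.eventuallyFlat_iff.1 hφ).2.1

theorem EventuallyFlat.contDiff {φ : C(Γ.Compl, ℝ)} (hφ : Γ.EventuallyFlat φ) (e : G.edgeSet) :
    ContDiff ℝ (⊤ : ℕ∞) (Γ.onEdge φ e) := (Γ.eventuallyFlat_iff.1 hφ).1 e

theorem EventuallyFlat.contDiff_deriv {φ : C(Γ.Compl, ℝ)} (hφ : Γ.EventuallyFlat φ)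
    (e : G.edgeSet) : ContDiff ℝ (⊤ : ℕ∞) (deriv (Γ.onEdge φ e)) :=
  (contDiff_infty_iff_deriv.1 (hφ.contDiff Γ e)).2

theorem EventuallyFlat.contDiff_deriv2 {φ : C(Γ.Compl, ℝ)} (hφ : Γ.EventuallyFlat φ)
    (e : G.edgeSet) : ContDiff ℝ (⊤ : ℕ∞) (deriv (deriv (Γ.onEdge φ e))) :=
  (contDiff_infty_iff_deriv.1 (hφ.contDiff_deriv Γ e)).2

theorem EventuallyFlat.deriv_zero {φ : C(Γ.Compl, ℝ)} (hφ : Γ.EventuallyFlat φ) (e : G.edgeSet) :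
    deriv (Γ.onEdge φ e) 0 = 0 :=
  (EventuallyEq.deriv_eq ((Γ.eventuallyFlat_iff.1 hφ).2.2 e).1).trans (deriv_const _ _)

theorem EventuallyFlat.deriv_len {φ : C(Γ.Compl, ℝ)} (hφ : Γ.EventuallyFlat φ) (e : G.edgeSet) :
    deriv (Γ.onEdge φ e) (Γ.len e) = 0 :=
  (EventuallyEq.deriv_eq ((Γ.eventuallyFlat_iff.1 hφ).2.2 e).2).trans (deriv_const _ _)

theorem FlatOff.deriv_eq_zero {S : Finset G.edgeSet} {φ : C(Γ.Compl, ℝ)} (h : Γ.FlatOff S φ)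
    {e : G.edgeSet} (he : e ∉ S) : deriv (Γ.onEdge φ e) = 0 := by
  rw [funext (h e he)]
  exact deriv_const' _

theorem FlatOff.deriv2_eq_zero {S : Finset G.edgeSet} {φ : C(Γ.Compl, ℝ)} (h : Γ.FlatOff S φ)
    {e : G.edgeSet} (he : e ∉ S) : deriv (deriv (Γ.onEdge φ e)) = 0 := by
  rw [h.deriv_eq_zero Γ he]
  exact deriv_const' 0

theorem FlatOff.mono {S T : Finset G.edgeSet} {φ : C(Γ.Compl, ℝ)} (h : Γ.FlatOff S φ)
    (hST : S ⊆ T) : Γ.FlatOff T φ := fun e he => h e fun h' => he (hST h')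

theorem integrable_secondDeriv [Countable V] [G.LocallyFinite] {ψ : C(Γ.Compl, ℝ)}
    (hψ : Γ.EventuallyFlat ψ) : Integrable (Γ.secondDeriv fun p => ψ p) Γ.vol := by
  obtain ⟨S, hS⟩ := hψ.exists_flatOff
  refine Γ.integrable_vol_of_edges S (fun e he t ht => ?_) fun e => ?_
  · rw [Γ.secondDeriv_pt ψ ht, hS.deriv2_eq_zero Γ he, Pi.zero_apply]
  · refine IntegrableOn.congr_fun ?_ (fun t ht => (Γ.secondDeriv_pt ψ ht).symm) measurableSet_Ioo
    exact ((hψ.contDiff_deriv2 Γ e).continuous.continuousOn.integrableOn_compact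
      isCompact_Icc).mono_set Ioo_subset_Icc_self

variable {q : Γ.Point → ℝ}

theorem integrable_L [Countable V] [G.LocallyFinite] [CompactSpace Γ.Compl]
    (hq : Integrable q Γ.vol) {ψ : C(Γ.Compl, ℝ)} (hψ : Γ.EventuallyFlat ψ) :
    Integrable (Γ.L q fun p => ψ p) Γ.vol :=
  (Γ.integrable_secondDeriv hψ).neg.add (Γ.integrable_mul_continuous hq ψ)

theorem integrable_mul_L [Countable V] [G.LocallyFinite] [CompactSpace Γ.Compl]
    (hq : Integrable q Γ.vol) (u : C(Γ.Compl, ℝ)) {ψ : C(Γ.Compl, ℝ)} (hψ : Γ.EventuallyFlat ψ) :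
    Integrable (fun p : Γ.Point => u p * Γ.L q (fun p => ψ p) p) Γ.vol := by
  simp only [mul_comm (u _)]
  exact Γ.integrable_mul_continuous (Γ.integrable_L hq hψ) u

/-- The pairing `∫ u L ψ`. -/
def pairing (q : Γ.Point → ℝ) (u ψ : C(Γ.Compl, ℝ)) : ℝ :=
  ∫ p : Γ.Point, u p * Γ.L q (fun p => ψ p) p ∂Γ.vol

theorem pairing_add_left [Countable V] [G.LocallyFinite] [CompactSpace Γ.Compl]
    (hq : Integrable q Γ.vol) (u v : C(Γ.Compl, ℝ)) {ψ : C(Γ.Compl, ℝ)}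
    (hψ : Γ.EventuallyFlat ψ) :
    Γ.pairing q (u + v) ψ = Γ.pairing q u ψ + Γ.pairing q v ψ := by
  rw [pairing, pairing, pairing, ← integral_add (Γ.integrable_mul_L hq u hψ)
    (Γ.integrable_mul_L hq v hψ)]
  simp only [ContinuousMap.add_apply, add_mul]

theorem pairing_smul_left (c : ℝ) (u ψ : C(Γ.Compl, ℝ)) :
    Γ.pairing q (c • u) ψ = c * Γ.pairing q u ψ := by
  rw [pairing, pairing, ← integral_const_mul]
  simp only [ContinuousMap.smul_apply, smul_eq_mul, mul_assoc]

theorem secondDeriv_add {φ ψ : C(Γ.Compl, ℝ)} (hφ : Γ.EventuallyFlat φ)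
    (hψ : Γ.EventuallyFlat ψ) (p : Γ.Point) : Γ.secondDeriv (fun p => (φ + ψ) p) p =
      Γ.secondDeriv (fun p => φ p) p + Γ.secondDeriv (fun p => ψ p) p := by
  rcases Γ.eq_pt_or_vertex p with ⟨e, t, ht, rfl⟩ | ⟨v, rfl⟩
  · rw [Γ.secondDeriv_pt _ ht, Γ.secondDeriv_pt _ ht, Γ.secondDeriv_pt _ ht]
    have h1 : deriv (Γ.onEdge (φ + ψ) e) =
        deriv (Γ.onEdge φ e) + deriv (Γ.onEdge ψ e) := by
      ext s
      exact deriv_add ((hφ.contDiff Γ e).differentiable (by simp) s)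
        ((hψ.contDiff Γ e).differentiable (by simp) s)
    rw [h1]
    exact deriv_add ((hφ.contDiff_deriv Γ e).differentiable (by simp) t)
        ((hψ.contDiff_deriv Γ e).differentiable (by simp) t)
  · simp [secondDeriv]

theorem secondDeriv_smul (c : ℝ) {φ : C(Γ.Compl, ℝ)} (hφ : Γ.EventuallyFlat φ) (p : Γ.Point) :
    Γ.secondDeriv (fun p => (c • φ) p) p = c * Γ.secondDeriv (fun p => φ p) p := by
  rcases Γ.eq_pt_or_vertex p with ⟨e, t, ht, rfl⟩ | ⟨v, rfl⟩
  · rw [Γ.secondDeriv_pt _ ht, Γ.secondDeriv_pt _ ht]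
    have h1 : deriv (Γ.onEdge (c • φ) e) = fun s => c * deriv (Γ.onEdge φ e) s := by
      ext s
      exact deriv_const_mul c ((hφ.contDiff Γ e).differentiable (by simp) s)
    rw [h1]
    exact deriv_const_mul c ((hφ.contDiff_deriv Γ e).differentiable (by simp) t)
  · simp [secondDeriv]

theorem pairing_add_right [Countable V] [G.LocallyFinite] [CompactSpace Γ.Compl]
    (hq : Integrable q Γ.vol) (u : C(Γ.Compl, ℝ)) {φ ψ : C(Γ.Compl, ℝ)}
    (hφ : Γ.EventuallyFlat φ) (hψ : Γ.EventuallyFlat ψ) :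
    Γ.pairing q u (φ + ψ) = Γ.pairing q u φ + Γ.pairing q u ψ := by
  rw [pairing, pairing, pairing, ← integral_add (Γ.integrable_mul_L hq u hφ)
    (Γ.integrable_mul_L hq u hψ)]
  refine integral_congr_ae (Eventually.of_forall fun p => ?_)
  simp only [L]
  rw [Γ.secondDeriv_add hφ hψ, ContinuousMap.add_apply]
  ring

theorem pairing_smul_right (c : ℝ) (u : C(Γ.Compl, ℝ)) {φ : C(Γ.Compl, ℝ)}
    (hφ : Γ.EventuallyFlat φ) : Γ.pairing q u (c • φ) = c * Γ.pairing q u φ := by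
  rw [pairing, pairing, ← integral_const_mul]
  refine integral_congr_ae (Eventually.of_forall fun p => ?_)
  simp only [L]
  rw [Γ.secondDeriv_smul c hφ, ContinuousMap.smul_apply, smul_eq_mul]
  ring

theorem continuous_pairing_left [Countable V] [G.LocallyFinite] [CompactSpace Γ.Compl]
    (hq : Integrable q Γ.vol) {ψ : C(Γ.Compl, ℝ)} (hψ : Γ.EventuallyFlat ψ) :
    Continuous fun u => Γ.pairing q u ψ := by
  let f : C(Γ.Compl, ℝ) →ₗ[ℝ] ℝ :=
    { toFun := fun u => Γ.pairing q u ψ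
      map_add' := fun u v => Γ.pairing_add_left hq u v hψ
      map_smul' := fun c u => Γ.pairing_smul_left c u ψ }
  refine AddMonoidHomClass.continuous_of_bound f (∫ p, ‖Γ.L q (fun p => ψ p) p‖ ∂Γ.vol) fun u => ?_
  refine (norm_integral_le_integral_norm _).trans ?_
  rw [mul_comm, ← integral_const_mul]
  refine integral_mono (Γ.integrable_mul_L hq u hψ).norm ((Γ.integrable_L hq hψ).norm.const_mul _)
    fun p => ?_
  simp only [norm_mul]
  exact mul_le_mul_of_nonneg_right (u.norm_coe_le_norm p) (norm_nonneg _)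

/-- The pairing, with the contributions of `u ψ''` written as integrals over finitely many
edges. -/
theorem pairing_eq_sum [Countable V] [G.LocallyFinite] [CompactSpace Γ.Compl]
    (hq : Integrable q Γ.vol) (u : C(Γ.Compl, ℝ)) {ψ : C(Γ.Compl, ℝ)} (hψ : Γ.EventuallyFlat ψ)
    {S : Finset G.edgeSet} (hS : Γ.FlatOff S ψ) : Γ.pairing q u ψ =
      ∑ e ∈ S, (∫ t in 0..Γ.len e, -(Γ.onEdge u e t * deriv (deriv (Γ.onEdge ψ e)) t)) +
        ∫ p : Γ.Point, q p * (u * ψ) p ∂Γ.vol := by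
  have h1 : Integrable (fun p : Γ.Point => -(Γ.secondDeriv (fun p => ψ p) p * u p)) Γ.vol :=
    (Γ.integrable_mul_continuous (Γ.integrable_secondDeriv hψ) u).neg
  have h2 := Γ.integrable_mul_continuous hq (u * ψ)
  have h3 : ∀ p : Γ.Point, u p * Γ.L q (fun p => ψ p) p =
      -(Γ.secondDeriv (fun p => ψ p) p * u p) + q p * (u * ψ) p := fun p => by
    simp only [L, ContinuousMap.mul_apply]
    ring
  rw [pairing, integral_congr_ae (Eventually.of_forall h3), integral_add h1 h2,
    Γ.integral_vol_eq_sum S (fun e he t ht => ?_) h1]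
  · congr 1
    refine Finset.sum_congr rfl fun e _ => ?_
    rw [intervalIntegral.integral_of_le (Γ.len_pos e).le,
      intervalIntegral.integral_of_le (Γ.len_pos e).le, integral_Ioc_eq_integral_Ioo,
      integral_Ioc_eq_integral_Ioo]
    refine setIntegral_congr_fun measurableSet_Ioo fun t ht => ?_
    simp only [Γ.secondDeriv_pt ψ ht, onEdge, mul_comm]
  · rw [Γ.secondDeriv_pt ψ ht, hS.deriv2_eq_zero Γ he, Pi.zero_apply, zero_mul, neg_zero]

/-- On eventually flat functions, the pairing is the energy form `∫ φ' ψ' + q φ ψ`: in the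
integration by parts there are no boundary terms, because `ψ'` vanishes at the ends of the
edges. -/
theorem pairing_eq_energy [Countable V] [G.LocallyFinite] [CompactSpace Γ.Compl]
    (hq : Integrable q Γ.vol) {φ ψ : C(Γ.Compl, ℝ)} (hφ : Γ.EventuallyFlat φ)
    (hψ : Γ.EventuallyFlat ψ) {S : Finset G.edgeSet} (hS : Γ.FlatOff S ψ) : Γ.pairing q φ ψ =
      ∑ e ∈ S, (∫ t in 0..Γ.len e, deriv (Γ.onEdge φ e) t * deriv (Γ.onEdge ψ e) t) +
        ∫ p : Γ.Point, q p * (φ * ψ) p ∂Γ.vol := by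
  rw [Γ.pairing_eq_sum hq φ hψ hS]
  congr 1
  refine Finset.sum_congr rfl fun e _ => ?_
  rw [intervalIntegral.integral_neg, intervalIntegral.integral_mul_deriv_eq_deriv_mul
    (u := Γ.onEdge φ e) (v := deriv (Γ.onEdge ψ e))
    (fun t _ => ((hφ.contDiff Γ e).differentiable (by simp) t).hasDerivAt)
    (fun t _ => ((hψ.contDiff_deriv Γ e).differentiable (by simp) t).hasDerivAt)
    ((hφ.contDiff_deriv Γ e).continuous.intervalIntegrable _ _)
    ((hψ.contDiff_deriv2 Γ e).continuous.intervalIntegrable _ _), hψ.deriv_zero, hψ.deriv_len]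
  ring

theorem pairing_comm [Countable V] [G.LocallyFinite] [CompactSpace Γ.Compl]
    (hq : Integrable q Γ.vol) {φ ψ : C(Γ.Compl, ℝ)} (hφ : Γ.EventuallyFlat φ)
    (hψ : Γ.EventuallyFlat ψ) : Γ.pairing q φ ψ = Γ.pairing q ψ φ := by
  classical
  obtain ⟨S, hS⟩ := hφ.exists_flatOff
  obtain ⟨T, hT⟩ := hψ.exists_flatOff
  rw [Γ.pairing_eq_energy hq hφ hψ (hT.mono Γ (Finset.subset_union_right (s₁ := S))),
    Γ.pairing_eq_energy hq hψ hφ (hS.mono Γ (Finset.subset_union_left (s₂ := T)))]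
  simp only [mul_comm φ ψ, mul_comm (deriv (Γ.onEdge φ _) _)]

theorem sum_deriv_sq_le_pairing [Countable V] [G.LocallyFinite] [CompactSpace Γ.Compl]
    (hq0 : ∀ p, 0 ≤ q p) (hq : Integrable q Γ.vol) {φ : C(Γ.Compl, ℝ)}
    (hφ : Γ.EventuallyFlat φ) {S : Finset G.edgeSet} (hS : Γ.FlatOff S φ) :
    ∑ e ∈ S, (∫ t in 0..Γ.len e, deriv (Γ.onEdge φ e) t ^ 2) ≤ Γ.pairing q φ φ := by
  rw [Γ.pairing_eq_energy hq hφ hφ hS]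
  simp only [sq]
  refine le_add_of_nonneg_right (integral_nonneg fun p => ?_)
  exact mul_nonneg (hq0 p) (mul_self_nonneg _)

theorem pairing_self_nonneg [Countable V] [G.LocallyFinite] [CompactSpace Γ.Compl]
    (hq0 : ∀ p, 0 ≤ q p) (hq : Integrable q Γ.vol) {φ : C(Γ.Compl, ℝ)}
    (hφ : Γ.EventuallyFlat φ) : 0 ≤ Γ.pairing q φ φ := by
  obtain ⟨S, hS⟩ := hφ.exists_flatOff
  refine le_trans (Finset.sum_nonneg fun e _ => ?_) (Γ.sum_deriv_sq_le_pairing hq0 hq hφ hS)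
  exact intervalIntegral.integral_nonneg (Γ.len_pos e).le fun t _ => sq_nonneg _

/-! ### The energy controls the oscillation -/

/-- The trace of a path: measurable subsets of the edges whose total length is at most the length of
the path, and which have the intermediate value property for the end points of the path. Parts of an
edge which the path covers repeatedly count only once. -/
theorem PathLength.exists_trace {p p' : Γ.Point} {r : ℝ≥0∞} (h : Γ.PathLength p p' r) :
    ∃ S : G.edgeSet → Set ℝ, (∀ e, MeasurableSet (S e)) ∧ (∀ e, S e ⊆ Icc 0 (Γ.len e)) ∧
      ∑' e, volume (S e) ≤ r ∧ ∀ ψ : C(Γ.Compl, ℝ),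
        uIcc (ψ p) (ψ p') ⊆ {ψ p} ∪ ⋃ e, Γ.onEdge ψ e '' S e := by
  classical
  induction h with
  | refl => exact ⟨fun _ => ∅, by simp, by simp, by simp, by simp⟩
  | step e s t hs ht r _ ih =>
    obtain ⟨S, hSm, hS, hSr, hSψ⟩ := ih
    refine ⟨fun e' => S e' ∪ if e' = e then uIcc s t else ∅, fun e' => (hSm e').union ?_,
      fun e' => union_subset (hS e') ?_, ?_, fun ψ => ?_⟩
    · split_ifs
      · exact measurableSet_uIcc
      · exact MeasurableSet.empty
    · split_ifs with h
      · subst h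
        exact uIcc_subset_Icc hs ht
      · exact empty_subset _
    · calc ∑' e', volume (S e' ∪ if e' = e then uIcc s t else ∅)
          ≤ ∑' e', (volume (S e') + if e' = e then edist s t else 0) := by
            refine ENNReal.tsum_le_tsum fun e' => (measure_union_le _ _).trans ?_
            gcongr
            split_ifs
            · rw [Real.volume_interval, edist_comm, edist_dist, Real.dist_eq]
            · simp
        _ = ∑' e', volume (S e') + edist s t := by
            rw [ENNReal.tsum_add, tsum_ite_eq]
        _ ≤ r + edist s t := by gcongr
    · refine uIcc_subset_uIcc_union_uIcc.trans (union_subset ((hSψ ψ).trans ?_) ?_)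
      · gcongr
        exact subset_union_left
      · refine subset_union_of_subset_right ?_ _
        have h1 := intermediate_value_uIcc (a := s) (b := t) (Γ.continuous_onEdge ψ e).continuousOn
        refine h1.trans (subset_iUnion_of_subset e (image_mono ?_))
        simp

/-- The image of `S` has measure at most `∫_S |ψ'|`, and `|ψ'| ≤ c / 2 + |ψ'|² / (2 c)`. -/
theorem volume_image_onEdge_le {ψ : C(Γ.Compl, ℝ)} (hψ : Γ.EventuallyFlat ψ) (e : G.edgeSet)
    {S : Set ℝ} (hS : MeasurableSet S) (hSl : S ⊆ Icc 0 (Γ.len e)) {c : ℝ} (hc : 0 < c) :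
    volume (Γ.onEdge ψ e '' S) ≤ ENNReal.ofReal (c / 2) * volume S +
      ENNReal.ofReal ((∫ t in 0..Γ.len e, deriv (Γ.onEdge ψ e) t ^ 2) / (2 * c)) := by
  have hd : ∀ x ∈ S, HasFDerivWithinAt (Γ.onEdge ψ e)
      (ContinuousLinearMap.toSpanSingleton ℝ (deriv (Γ.onEdge ψ e) x)) S x := fun x _ =>
    (((hψ.contDiff Γ e).differentiable (by simp) x).hasDerivAt.hasFDerivAt).hasFDerivWithinAt
  have hcont : Continuous fun t => deriv (Γ.onEdge ψ e) t ^ 2 / (2 * c) :=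
    ((hψ.contDiff_deriv Γ e).continuous.pow 2).div_const _
  have hlt : ∀ x : ℝ, ENNReal.ofReal |x| ≤ ENNReal.ofReal (c / 2) + ENNReal.ofReal (x ^ 2 / (2 * c)) := by
    intro x
    rw [← ENNReal.ofReal_add (by positivity) (by positivity)]
    refine ENNReal.ofReal_le_ofReal ?_
    rw [← sq_abs x, div_add_div _ _ (by positivity) (by positivity), le_div_iff₀ (by positivity)]
    nlinarith [sq_nonneg (|x| - c)]
  calc volume (Γ.onEdge ψ e '' S)
      ≤ ∫⁻ x in S, ENNReal.ofReal |deriv (Γ.onEdge ψ e) x| := by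
        have := addHaar_image_le_lintegral_abs_det_fderiv volume hS hd
        simpa only [ContinuousLinearMap.det_toSpanSingleton] using this
    _ ≤ ∫⁻ x in S, (ENNReal.ofReal (c / 2) +
          ENNReal.ofReal (deriv (Γ.onEdge ψ e) x ^ 2 / (2 * c))) := lintegral_mono fun x => hlt _
    _ = ENNReal.ofReal (c / 2) * volume S +
          ∫⁻ x in S, ENNReal.ofReal (deriv (Γ.onEdge ψ e) x ^ 2 / (2 * c)) := by
        rw [lintegral_add_left measurable_const, setLIntegral_const]
    _ ≤ ENNReal.ofReal (c / 2) * volume S +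
          ∫⁻ x in Icc 0 (Γ.len e), ENNReal.ofReal (deriv (Γ.onEdge ψ e) x ^ 2 / (2 * c)) := by
        gcongr
    _ = _ := by
        rw [← ofReal_integral_eq_lintegral_ofReal
          (hcont.continuousOn.integrableOn_compact isCompact_Icc)
          (Eventually.of_forall fun x => by positivity), integral_Icc_eq_integral_Ioc,
          ← intervalIntegral.integral_of_le (Γ.len_pos e).le, intervalIntegral.integral_div]

/-- The Cauchy–Schwarz inequality along a path: the interval between the values of `ψ` at the end
points is covered by the images under `ψ` of the trace of the path. -/
theorem PathLength.sq_sub_le [Countable V] [G.LocallyFinite] [CompactSpace Γ.Compl]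
    (hq0 : ∀ p, 0 ≤ q p) (hq : Integrable q Γ.vol) {p p' : Γ.Point} {r : ℝ≥0∞}
    (h : Γ.PathLength p p' r) {C : ℝ} (hC : 0 < C) (hrC : r ≤ ENNReal.ofReal C)
    {ψ : C(Γ.Compl, ℝ)} (hψ : Γ.EventuallyFlat ψ) :
    (ψ p - ψ p') ^ 2 ≤ C * Γ.pairing q ψ ψ := by
  obtain ⟨T, hT⟩ := hψ.exists_flatOff
  obtain ⟨S, hSm, hS, hSr, hSψ⟩ := h.exists_trace
  have hE0 : ∀ e, 0 ≤ ∫ t in 0..Γ.len e, deriv (Γ.onEdge ψ e) t ^ 2 := fun e =>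
    intervalIntegral.integral_nonneg (Γ.len_pos e).le fun t _ => sq_nonneg _
  have hP0 := Γ.pairing_self_nonneg hq0 hq hψ
  have key : ∀ c > 0, |ψ p' - ψ p| ≤ c / 2 * C + Γ.pairing q ψ ψ / (2 * c) := by
    intro c hc
    rw [← ENNReal.ofReal_le_ofReal_iff (by positivity), ← Real.volume_interval]
    calc volume (uIcc (ψ p) (ψ p'))
        ≤ volume {ψ p} + ∑' e, volume (Γ.onEdge ψ e '' S e) :=
          (measure_mono (hSψ ψ)).trans ((measure_union_le _ _).trans
            (add_le_add le_rfl (measure_iUnion_le _)))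
      _ = ∑ e ∈ T, volume (Γ.onEdge ψ e '' S e) := by
          rw [Real.volume_singleton, zero_add]
          refine tsum_eq_sum fun e he => ?_
          refine measure_mono_null (t := {Γ.onEdge ψ e 0}) ?_ Real.volume_singleton
          rintro _ ⟨t, -, rfl⟩
          exact hT e he t
      _ ≤ ∑ e ∈ T, (ENNReal.ofReal (c / 2) * volume (S e) +
            ENNReal.ofReal ((∫ t in 0..Γ.len e, deriv (Γ.onEdge ψ e) t ^ 2) / (2 * c))) :=
          Finset.sum_le_sum fun e _ => Γ.volume_image_onEdge_le hψ e (hSm e) (hS e) hc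
      _ ≤ ENNReal.ofReal (c / 2) * ENNReal.ofReal C +
            ENNReal.ofReal (Γ.pairing q ψ ψ / (2 * c)) := by
          rw [Finset.sum_add_distrib, ← Finset.mul_sum, ← ENNReal.ofReal_sum_of_nonneg
            (fun e _ => div_nonneg (hE0 e) (by positivity)), ← Finset.sum_div]
          gcongr
          · exact (ENNReal.sum_le_tsum T).trans (hSr.trans hrC)
          · exact Γ.sum_deriv_sq_le_pairing hq0 hq hψ hT
      _ = ENNReal.ofReal (c / 2 * C + Γ.pairing q ψ ψ / (2 * c)) := by
          rw [← ENNReal.ofReal_mul (by positivity), ENNReal.ofReal_add (by positivity)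
            (by positivity)]
  rcases eq_or_ne (ψ p) (ψ p') with hp | hp
  · rw [hp, sub_self, zero_pow two_ne_zero]
    exact mul_nonneg hC.le hP0
  -- The optimal choice of the constant in the inequality between the two means.
  have hx : 0 < |ψ p' - ψ p| := abs_pos.2 (sub_ne_zero.2 hp.symm)
  have h1 := key (|ψ p' - ψ p| / C) (by positivity)
  have h2 : |ψ p' - ψ p| / C / 2 * C = |ψ p' - ψ p| / 2 := by field_simp
  have h3 : Γ.pairing q ψ ψ / (2 * (|ψ p' - ψ p| / C)) =
      C * Γ.pairing q ψ ψ / (2 * |ψ p' - ψ p|) := by field_simp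
  rw [h2, h3, ← sub_le_iff_le_add', sub_half, le_div_iff₀ (by positivity)] at h1
  rw [← sq_abs, abs_sub_comm]
  linarith

/-- Squared oscillations of eventually flat functions are at most a constant times the energy. -/
theorem exists_sq_sub_le_pairing [Countable V] [G.LocallyFinite] [CompactSpace Γ.Compl]
    (hconn : G.Connected) (hq0 : ∀ p, 0 ≤ q p) (hq : Integrable q Γ.vol) :
    ∃ C > 0, ∀ ψ, Γ.EventuallyFlat ψ → ∀ x y, (ψ x - ψ y) ^ 2 ≤ C * Γ.pairing q ψ ψ := by
  -- The graph is bounded, since its completion is compact.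
  obtain ⟨C, hC, hdiam⟩ : ∃ C > 0, ∀ p p' : Γ.Point, edist p p' < ENNReal.ofReal C := by
    let _ : PseudoMetricSpace Γ.Point :=
      PseudoEMetricSpace.toPseudoMetricSpace fun p q => Γ.edist_ne_top hconn p q
    obtain ⟨C, hC⟩ := Metric.isBounded_iff.1
      (isCompact_univ (X := UniformSpace.Completion Γ.Point)).isBounded
    refine ⟨max C 0 + 1, by positivity, fun p p' => ?_⟩
    have h1 := hC (mem_univ (p : UniformSpace.Completion Γ.Point)) (mem_univ ↑p')
    rw [UniformSpace.Completion.dist_eq] at h1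
    rw [edist_dist]
    refine (ENNReal.ofReal_lt_ofReal_iff (by positivity)).2 ?_
    linarith [le_max_left C 0]
  refine ⟨C, hC, fun ψ hψ => ?_⟩
  have hcl : IsClosed {z : Γ.Compl × Γ.Compl | (ψ z.1 - ψ z.2) ^ 2 ≤ C * Γ.pairing q ψ ψ} :=
    isClosed_le (by fun_prop) continuous_const
  intro x y
  refine UniformSpace.Completion.induction_on₂ x y hcl fun p p' => ?_
  have h1 := hdiam p p'
  rw [edist_def, sInf_lt_iff] at h1
  obtain ⟨r, hr, hrC⟩ := h1
  exact PathLength.sq_sub_le Γ hq0 hq hr hC hrC.le hψ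

/-- For eventually flat functions which vanish on the boundary, the energy controls the uniform
norm. -/
theorem exists_norm_sq_le_pairing [Countable V] [G.LocallyFinite] [CompactSpace Γ.Compl]
    (hconn : G.Connected) (hbdry : Γ.bdry.Nonempty) (hq0 : ∀ p, 0 ≤ q p)
    (hq : Integrable q Γ.vol) : ∃ C > 0, ∀ ψ, Γ.EventuallyFlat ψ → (∀ x ∈ Γ.bdry, ψ x = 0) →
      ‖ψ‖ ^ 2 ≤ C * Γ.pairing q ψ ψ := by
  obtain ⟨C, hC, h⟩ := Γ.exists_sq_sub_le_pairing hconn hq0 hq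
  obtain ⟨y, hy⟩ := hbdry
  refine ⟨C, hC, fun ψ hψ hψ0 => ?_⟩
  have h0 : 0 ≤ C * Γ.pairing q ψ ψ := mul_nonneg hC.le (Γ.pairing_self_nonneg hq0 hq hψ)
  refine (Real.le_sqrt (norm_nonneg _) h0).1 ?_
  rw [ContinuousMap.norm_le _ (Real.sqrt_nonneg _)]
  intro x
  have := h ψ hψ x y
  rw [hψ0 y hy, sub_zero] at this
  exact Real.abs_le_sqrt this

/-! ### Weak solutions on an interval -/

/-- `η` is a test function on the interval `(0, l)`: it is smooth, and vanishes outside of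
`[δ, l - δ]` for some `δ > 0`. -/
def IsTest (l : ℝ) (η : ℝ → ℝ) : Prop :=
  ContDiff ℝ (⊤ : ℕ∞) η ∧ ∃ δ > 0, ∀ t, t < δ ∨ l - δ < t → η t = 0

theorem isTest_of_tsupport {l : ℝ} {η : ℝ → ℝ} (h : ContDiff ℝ (⊤ : ℕ∞) η)
    (hc : HasCompactSupport η) (hs : tsupport η ⊆ Ioo 0 l) : IsTest l η := by
  obtain ⟨δ, hδ, hδ'⟩ := hc.isCompact.exists_forall_le' (f := fun t => min t (l - t)) (a := 0)
    (by fun_prop) fun t ht => lt_min (hs ht).1 (sub_pos.2 (hs ht).2)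
  refine ⟨h, δ, hδ, fun t ht => ?_⟩
  by_contra hne
  have := hδ' t (subset_tsupport _ hne)
  rcases ht with ht | ht
  · linarith [min_le_left t (l - t)]
  · linarith [min_le_right t (l - t)]

theorem IsTest.deriv {l : ℝ} {η : ℝ → ℝ} (h : IsTest l η) : IsTest l (deriv η) := by
  obtain ⟨h, δ, hδ, h0⟩ := h
  refine ⟨(contDiff_infty_iff_deriv.1 h).2, δ, hδ, fun t ht => ?_⟩
  have : η =ᶠ[𝓝 t] fun _ => 0 := by
    rcases ht with ht | ht
    · filter_upwards [Iio_mem_nhds ht] with s hs using h0 s (.inl hs)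
    · filter_upwards [Ioi_mem_nhds ht] with s hs using h0 s (.inr hs)
  rw [this.deriv_eq, deriv_const]

theorem IsTest.sub_mul {l : ℝ} {η ρ : ℝ → ℝ} (h : IsTest l η) (hρ : IsTest l ρ) (c : ℝ) :
    IsTest l fun t => η t - c * ρ t := by
  obtain ⟨h, δ, hδ, h0⟩ := h
  obtain ⟨hρ, δ', hδ', h0'⟩ := hρ
  refine ⟨h.sub (contDiff_const.mul hρ), min δ δ', lt_min hδ hδ', fun t ht => ?_⟩
  change η t - c * ρ t = 0
  rw [h0 t, h0' t, mul_zero, sub_zero]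
  · exact ht.imp (fun h => h.trans_le (min_le_right _ _))
      (fun h => (sub_le_sub_left (min_le_right δ δ') l).trans_lt h)
  · exact ht.imp (fun h => h.trans_le (min_le_left _ _))
      (fun h => (sub_le_sub_left (min_le_left δ δ') l).trans_lt h)

/-- A test function with integral zero is the derivative of a test function. -/
theorem IsTest.exists_primitive {l : ℝ} {g : ℝ → ℝ} (hg : IsTest l g)
    (h0 : ∫ t in 0..l, g t = 0) : ∃ γ, IsTest l γ ∧ ∀ t, HasDerivAt γ (g t) t := by
  obtain ⟨hg, δ, hδ, h⟩ := hg
  have hd : ∀ t, HasDerivAt (fun t => ∫ s in 0..t, g s) (g t) t := fun t =>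
    intervalIntegral.integral_hasDerivAt_right (hg.continuous.intervalIntegrable _ _)
      (hg.continuous.stronglyMeasurableAtFilter _ _) hg.continuous.continuousAt
  refine ⟨fun t => ∫ s in 0..t, g s, ⟨contDiff_infty_iff_deriv.2
    ⟨fun t => (hd t).differentiableAt, ?_⟩, δ, hδ, fun t ht => ?_⟩, hd⟩
  · rwa [show _root_.deriv (fun t => ∫ s in 0..t, g s) = g from funext fun t => (hd t).deriv]
  · rcases ht with ht | ht
    · refine intervalIntegral.integral_zero_ae (Eventually.of_forall fun s hs => h s (.inl ?_))
      exact (mem_uIoc.1 hs).elim (fun h => h.2.trans_lt ht) (fun h => h.2.trans_lt hδ)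
    · change ∫ s in 0..t, g s = 0
      rw [← intervalIntegral.integral_add_adjacent_intervals
        (hg.continuous.intervalIntegrable 0 l) (hg.continuous.intervalIntegrable l t), h0, zero_add]
      refine intervalIntegral.integral_zero_ae (Eventually.of_forall fun s hs => h s (.inr ?_))
      exact (mem_uIoc.1 hs).elim (fun h => by linarith [h.1]) (fun h => ht.trans h.1)

theorem exists_isTest_integral_eq_one {l : ℝ} (hl : 0 < l) :
    ∃ ρ, IsTest l ρ ∧ ∫ t in 0..l, ρ t = 1 := by
  have hs : ContDiff ℝ (⊤ : ℕ∞) fun t => smoothStep (t / l) :=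
    contDiff_smoothStep.comp (by fun_prop)
  have hs' := contDiff_infty_iff_deriv.1 hs
  refine ⟨deriv fun t => smoothStep (t / l), ⟨hs'.2, l / 3, by positivity, fun t ht => ?_⟩, ?_⟩
  · rcases ht with ht | ht
    · have := eventually_smoothStep_zero (f := fun t => t / l) (t := t) (by fun_prop)
        (by rw [div_lt_iff₀ hl]; linarith)
      exact (EventuallyEq.deriv_eq this).trans (deriv_const _ _)
    · have := eventually_smoothStep_one (f := fun t => t / l) (t := t) (by fun_prop)
        (by rw [lt_div_iff₀ hl]; linarith)
      exact (EventuallyEq.deriv_eq this).trans (deriv_const _ _)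
  · rw [intervalIntegral.integral_deriv_eq_sub (fun t _ => hs'.1 t)
      (hs'.2.continuous.intervalIntegrable _ _), div_self hl.ne', zero_div,
      smoothStep_of_ge (by norm_num), smoothStep_of_le (by norm_num), sub_zero]

theorem IsTest.exists_primitive_sub {l : ℝ} {η ρ : ℝ → ℝ} (hη : IsTest l η) (hρ : IsTest l ρ)
    (hρ1 : ∫ t in 0..l, ρ t = 1) :
    ∃ γ, IsTest l γ ∧ ∀ t, HasDerivAt γ (η t - (∫ t in 0..l, η t) * ρ t) t := by
  refine (hη.sub_mul hρ _).exists_primitive ?_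
  rw [intervalIntegral.integral_sub (hη.1.continuous.intervalIntegrable _ _)
    ((hρ.1.continuous.intervalIntegrable _ _).const_mul _),
    intervalIntegral.integral_const_mul, hρ1, mul_one, sub_self]

/-- The lemma of du Bois-Reymond: a function whose weak derivative vanishes is constant. Testing
with a primitive of `η - (∫ η) ρ`, where `∫ ρ = 1`, shows that the constant is `∫ N ρ`. -/
theorem eq_const_of_forall_isTest {l : ℝ} (hl : 0 < l) {N : ℝ → ℝ} (hN : Continuous N)
    (h : ∀ η, IsTest l η → ∫ t in 0..l, N t * deriv η t = 0) :
    ∃ c, ∀ t ∈ Icc 0 l, N t = c := by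
  obtain ⟨ρ, hρ, hρ1⟩ := exists_isTest_integral_eq_one hl
  have hii : ∀ η, IsTest l η → IntervalIntegrable (fun t => N t * η t) volume 0 l := fun η hη =>
    (hN.mul hη.1.continuous).intervalIntegrable _ _
  have key : ∀ η, IsTest l η →
      ∫ t in 0..l, N t * η t = (∫ t in 0..l, N t * ρ t) * ∫ t in 0..l, η t := by
    intro η hη
    obtain ⟨γ, hγ, hγ'⟩ := hη.exists_primitive_sub hρ hρ1
    have h1 := h γ hγ
    simp only [(hγ' _).deriv, mul_sub, mul_left_comm (N _)] at h1
    rw [intervalIntegral.integral_sub (hii η hη) ((hii ρ hρ).const_mul _),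
      intervalIntegral.integral_const_mul] at h1
    linarith
  obtain ⟨k, hk⟩ : ∃ k, k = ∫ t in 0..l, N t * ρ t := ⟨_, rfl⟩
  rw [← hk] at key
  refine ⟨k, ?_⟩
  have hNk : Continuous fun t => N t - k := hN.sub continuous_const
  have hae := isOpen_Ioo.ae_eq_zero_of_integral_contDiff_smul_eq_zero (U := Ioo 0 l) (μ := volume)
    (f := fun t => N t - k) (hNk.locallyIntegrable.locallyIntegrableOn _) fun g hg hgc hgs => by
      have hgt := isTest_of_tsupport hg hgc hgs
      have h1 : ∫ x, g x • (N x - k) = ∫ x in 0..l, g x • (N x - k) := by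
        rw [intervalIntegral.integral_of_le hl.le]
        refine (setIntegral_eq_integral_of_forall_compl_eq_zero fun x hx => ?_).symm
        rw [image_eq_zero_of_notMem_tsupport fun hx' => hx (Ioo_subset_Ioc_self (hgs hx')),
          zero_smul]
      rw [h1]
      simp only [smul_eq_mul, mul_comm (g _), sub_mul]
      rw [intervalIntegral.integral_sub (hii g hgt)
        ((hg.continuous.intervalIntegrable _ _).const_mul _),
        intervalIntegral.integral_const_mul, key g hgt, sub_self]
  have hIoo : EqOn N (fun _ => k) (Ioo 0 l) := by
    refine Measure.eqOn_Ioo_of_ae_eq (μ := volume) ?_ hN.continuousOn continuousOn_const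
    rw [EventuallyEq, ae_restrict_iff' measurableSet_Ioo]
    filter_upwards [hae] with t ht ht' using sub_eq_zero.1 (ht ht')
  intro t ht
  have := hIoo.closure hN continuous_const
  rw [closure_Ioo hl.ne] at this
  exact this ht

/-- A function whose second weak derivative vanishes is affine: the function `N t + t ∫ N ρ'`, where
`ρ` is a test function with integral `1`, satisfies the hypothesis of the lemma of
du Bois-Reymond. -/
theorem eq_affine_of_forall_isTest {l : ℝ} (hl : 0 < l) {N : ℝ → ℝ} (hN : Continuous N)
    (h : ∀ η, IsTest l η → ∫ t in 0..l, N t * deriv (deriv η) t = 0) :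
    ∃ a b, ∀ t ∈ Icc 0 l, N t = a + b * t := by
  obtain ⟨ρ, hρ, hρ1⟩ := exists_isTest_integral_eq_one hl
  have hii : ∀ η, IsTest l η → IntervalIntegrable (fun t => N t * η t) volume 0 l := fun η hη =>
    (hN.mul hη.1.continuous).intervalIntegrable _ _
  obtain ⟨c, hc⟩ := eq_const_of_forall_isTest hl
    (N := fun t => N t + (∫ t in 0..l, N t * deriv ρ t) * t) (by fun_prop) fun η hη => by
      obtain ⟨γ, hγ, hγ'⟩ := hη.exists_primitive_sub hρ hρ1
      have h1 := h γ hγ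
      rw [show deriv γ = _ from funext fun t => (hγ' t).deriv] at h1
      have h2 : ∀ t, deriv (fun t => η t - (∫ t in 0..l, η t) * ρ t) t =
          deriv η t - (∫ t in 0..l, η t) * deriv ρ t := fun t => by
        rw [deriv_fun_sub (hη.1.differentiable (by simp) t)
          ((hρ.1.differentiable (by simp) t).const_mul _),
          deriv_const_mul _ (hρ.1.differentiable (by simp) t)]
      simp only [h2, mul_sub, mul_left_comm (N _)] at h1
      rw [intervalIntegral.integral_sub (hii _ hη.deriv) ((hii _ hρ.deriv).const_mul _),
        intervalIntegral.integral_const_mul] at h1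
      have h3 : ∫ t in 0..l, t * deriv η t = -∫ t in 0..l, η t := by
        rw [intervalIntegral.integral_mul_deriv_eq_deriv_mul (u := fun t => t)
          (u' := fun _ => 1) (v := η) (fun t _ => hasDerivAt_id' t) (fun t _ => (hη.1.differentiable (by simp) t).hasDerivAt)
          (by simp) (hη.deriv.1.continuous.intervalIntegrable _ _)]
        obtain ⟨δ, hδ, h0⟩ := hη.2
        rw [h0 l (.inr (by linarith)), h0 0 (.inl hδ)]
        simp
      have h4 : IntervalIntegrable (fun t => t * deriv η t) volume 0 l :=
        (continuous_id'.mul hη.deriv.1.continuous).intervalIntegrable _ _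
      simp only [add_mul, mul_assoc]
      rw [intervalIntegral.integral_add (hii _ hη.deriv) (h4.const_mul _),
        intervalIntegral.integral_const_mul, h3]
      linarith
  exact ⟨c, -∫ t in 0..l, N t * deriv ρ t, fun t ht => by linarith [hc t ht]⟩

/-- Integration by parts for an absolutely continuous function with derivative `h`. -/
theorem integral_mul_eq_of_absolutelyContinuous {l : ℝ} (hl : 0 < l) {v h η : ℝ → ℝ}
    (hv : AbsolutelyContinuousOnInterval v 0 l)
    (hvh : ∀ᵐ t ∂volume.restrict (Ioo 0 l), HasDerivAt v (h t) t)
    (hη : ContDiff ℝ (⊤ : ℕ∞) η) :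
    ∫ t in 0..l, h t * η t = v l * η l - v 0 * η 0 - ∫ t in 0..l, v t * deriv η t := by
  have hη' : AbsolutelyContinuousOnInterval η 0 l :=
    (hη.of_le (by simp) : ContDiff ℝ 1 η).contDiffOn.absolutelyContinuousOnInterval
  rw [hv.integral_mul_deriv_eq_deriv_mul hη', sub_sub_cancel]
  rw [intervalIntegral.integral_of_le hl.le, intervalIntegral.integral_of_le hl.le,
    integral_Ioc_eq_integral_Ioo, integral_Ioc_eq_integral_Ioo]
  refine integral_congr_ae ?_
  filter_upwards [hvh] with t ht
  rw [ht.deriv]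

/-- A weak solution of `u'' = h` on `(0, l)` is a strong solution. -/
theorem exists_deriv_of_weak {l : ℝ} (hl : 0 < l) {u h : ℝ → ℝ} (hu : Continuous u)
    (hh : IntegrableOn h (Ioo 0 l))
    (hweak : ∀ η, IsTest l η → ∫ t in 0..l, (-(u t * deriv (deriv η) t) + h t * η t) = 0) :
    ∃ u' : ℝ → ℝ, (∀ t ∈ Icc 0 l, HasDerivWithinAt u (u' t) (Icc 0 l) t) ∧
      AbsolutelyContinuousOnInterval u' 0 l ∧
      ∀ᵐ t ∂volume.restrict (Ioo 0 l), HasDerivAt u' (h t) t := by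
  let h₀ : ℝ → ℝ := (Ioo 0 l).indicator h
  have hint : Integrable h₀ := hh.integrable_indicator measurableSet_Ioo
  let H : ℝ → ℝ := fun t => ∫ s in 0..t, h₀ s
  have hHc : Continuous H := intervalIntegral.continuous_primitive
    (fun a b => hint.intervalIntegrable) 0
  have hHac : AbsolutelyContinuousOnInterval H 0 l :=
    hint.intervalIntegrable.absolutelyContinuousOnInterval_intervalIntegral left_mem_uIcc
  have hHd : ∀ᵐ t ∂volume.restrict (Ioo 0 l), HasDerivAt H (h t) t := by
    rw [ae_restrict_iff' measurableSet_Ioo]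
    filter_upwards [LocallyIntegrable.ae_hasDerivAt_integral hint.locallyIntegrable] with t ht ht'
    have := ht 0
    rwa [show h₀ t = h t from indicator_of_mem ht' _] at this
  let K : ℝ → ℝ := fun t => ∫ s in 0..t, H s
  have hKd : ∀ t, HasDerivAt K (H t) t := fun t =>
    intervalIntegral.integral_hasDerivAt_right (hHc.intervalIntegrable _ _)
      (hHc.stronglyMeasurableAtFilter _ _) hHc.continuousAt
  have hKc : Continuous K := continuous_iff_continuousAt.2 fun t => (hKd t).continuousAt
  -- `K'' = h`, so that the second weak derivative of `u - K` vanishes.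
  obtain ⟨a, b, hab⟩ := eq_affine_of_forall_isTest hl (N := fun t => u t - K t) (hu.sub hKc)
    fun η hη => by
      obtain ⟨δ, hδ, h0⟩ := hη.2
      obtain ⟨δ', hδ', h0'⟩ := hη.deriv.2
      have hi : IntervalIntegrable (fun t => h t * η t) volume 0 l := by
        refine IntervalIntegrable.mul_continuousOn ?_ hη.1.continuous.continuousOn
        rwa [intervalIntegrable_iff_integrableOn_Ioo_of_le hl.le]
      have hi1 : IntervalIntegrable (fun t => u t * deriv (deriv η) t) volume 0 l :=
        (hu.mul hη.deriv.deriv.1.continuous).intervalIntegrable _ _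
      have hi1' : IntervalIntegrable (fun t => -(u t * deriv (deriv η) t)) volume 0 l := hi1.neg
      have hi2 : IntervalIntegrable (fun t => K t * deriv (deriv η) t) volume 0 l :=
        (hKc.mul hη.deriv.deriv.1.continuous).intervalIntegrable _ _
      have h1 := hweak η hη
      have h2 := integral_mul_eq_of_absolutelyContinuous hl hHac hHd hη.1
      have h3 := intervalIntegral.integral_mul_deriv_eq_deriv_mul (a := 0) (b := l) (u := K)
        (v := deriv η) (fun t _ => hKd t)
        (fun t _ => (hη.deriv.1.differentiable (by simp) t).hasDerivAt)
        (hHc.intervalIntegrable _ _) (hη.deriv.deriv.1.continuous.intervalIntegrable _ _)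
      rw [intervalIntegral.integral_add hi1' hi, intervalIntegral.integral_neg] at h1
      rw [h0 l (.inr (by linarith)), h0 0 (.inl hδ)] at h2
      rw [h0' l (.inr (by linarith)), h0' 0 (.inl hδ')] at h3
      simp only [sub_mul]
      rw [intervalIntegral.integral_sub hi1 hi2, h3]
      linarith
  refine ⟨fun t => b + H t, fun t ht => ?_, ?_, ?_⟩
  · have h1 : HasDerivAt (fun t => a + b * t + K t) (b + H t) t := by
      have h2 : HasDerivAt (fun t => a + b * t) b t := by
        simpa using ((hasDerivAt_id t).const_mul b).const_add a
      exact h2.add (hKd t)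
    refine h1.hasDerivWithinAt.congr_of_mem (fun s hs => ?_) ht
    linarith [hab s hs]
  · have hconst : AbsolutelyContinuousOnInterval (fun _ => b) 0 l :=
      (contDiff_const : ContDiff ℝ 1 fun _ => b).contDiffOn.absolutelyContinuousOnInterval
    exact hconst.add hHac
  · filter_upwards [hHd] with t ht using ht.const_add b

/-- Integration by parts on an edge, where `u'' = h`: the terms with `ψ'` at the end points are
absent, and the terms with `u'` remain. -/
theorem integral_flux {l : ℝ} (hl : 0 < l) {u u' h ψ : ℝ → ℝ} (hu : Continuous u)
    (hh : IntegrableOn h (Ioo 0 l))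
    (hu' : ∀ t ∈ Icc 0 l, HasDerivWithinAt u (u' t) (Icc 0 l) t)
    (hac : AbsolutelyContinuousOnInterval u' 0 l)
    (hd : ∀ᵐ t ∂volume.restrict (Ioo 0 l), HasDerivAt u' (h t) t)
    (hψ : ContDiff ℝ (⊤ : ℕ∞) ψ) (hψ0 : deriv ψ 0 = 0) (hψl : deriv ψ l = 0) :
    ∫ t in 0..l, (-(u t * deriv (deriv ψ) t) + h t * ψ t) = u' l * ψ l - u' 0 * ψ 0 := by
  have hψ1 := (contDiff_infty_iff_deriv.1 hψ).2
  have hψ2 := (contDiff_infty_iff_deriv.1 hψ1).2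
  have h1 := integral_mul_eq_of_absolutelyContinuous hl hac hd hψ
  rw [← uIcc_of_le hl.le] at hu'
  have h2 := intervalIntegral.integral_mul_deriv_eq_deriv_mul_of_hasDerivWithinAt
    (v := deriv ψ) hu' (fun t _ => ((hψ1.differentiable (by simp) t).hasDerivAt).hasDerivWithinAt)
    (hac.continuousOn.intervalIntegrable) (hψ2.continuous.intervalIntegrable _ _)
  have hi : IntervalIntegrable (fun t => h t * ψ t) volume 0 l := by
    refine IntervalIntegrable.mul_continuousOn ?_ hψ.continuous.continuousOn
    rwa [intervalIntegrable_iff_integrableOn_Ioo_of_le hl.le]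
  have hi1 : IntervalIntegrable (fun t => u t * deriv (deriv ψ) t) volume 0 l :=
    (hu.mul hψ2.continuous).intervalIntegrable _ _
  have hi1' : IntervalIntegrable (fun t => -(u t * deriv (deriv ψ) t)) volume 0 l := hi1.neg
  rw [intervalIntegral.integral_add hi1' hi, intervalIntegral.integral_neg, h1, h2, hψ0, hψl]
  ring

/-! ### Weakly harmonic functions are harmonic -/

/-- If `ψ` vanishes off the edges in `S`, the pairing is a sum of integrals over these edges. -/
theorem pairing_eq_sum_edges [Countable V] [G.LocallyFinite] [CompactSpace Γ.Compl]
    (hq : Integrable q Γ.vol) (u : C(Γ.Compl, ℝ)) {ψ : C(Γ.Compl, ℝ)} (hψ : Γ.EventuallyFlat ψ)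
    {S : Finset G.edgeSet} (hS : ∀ e ∉ S, ∀ t, Γ.onEdge ψ e t = 0) :
    Γ.pairing q u ψ = ∑ e ∈ S, ∫ t in 0..Γ.len e,
      (-(Γ.onEdge u e t * deriv (deriv (Γ.onEdge ψ e)) t) +
        q (Γ.pt e t) * Γ.onEdge u e t * Γ.onEdge ψ e t) := by
  have hL : ∀ e, ∀ t ∈ Ioo 0 (Γ.len e), u (Γ.pt e t) * Γ.L q (fun p => ψ p) (Γ.pt e t) =
      -(Γ.onEdge u e t * deriv (deriv (Γ.onEdge ψ e)) t) +
        q (Γ.pt e t) * Γ.onEdge u e t * Γ.onEdge ψ e t := fun e t ht => by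
    simp only [L, Γ.secondDeriv_pt ψ ht, onEdge]
    ring
  have hflat : Γ.FlatOff S ψ := fun e he t => by rw [hS e he, hS e he]
  rw [pairing, Γ.integral_vol_eq_sum S (fun e he t ht => ?_) (Γ.integrable_mul_L hq u hψ)]
  · refine Finset.sum_congr rfl fun e _ => ?_
    rw [intervalIntegral.integral_of_le (Γ.len_pos e).le,
      intervalIntegral.integral_of_le (Γ.len_pos e).le, integral_Ioc_eq_integral_Ioo,
      integral_Ioc_eq_integral_Ioo]
    exact setIntegral_congr_fun measurableSet_Ioo (hL e)
  · rw [hL e t ht, hflat.deriv2_eq_zero Γ he, hS e he]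
    simp

open Classical in
theorem finsum_incident (w : V) (S : Finset G.edgeSet)
    (hS : ∀ e, Γ.src e = w ∨ Γ.tgt e = w → e ∈ S) (f g : G.edgeSet → ℝ) :
    (∑ᶠ e ∈ {e | Γ.src e = w}, f e) + (∑ᶠ e ∈ {e | Γ.tgt e = w}, g e) =
      ∑ e ∈ S, ((if Γ.src e = w then f e else 0) + if Γ.tgt e = w then g e else 0) := by
  rw [Finset.sum_add_distrib, finsum_mem_def, finsum_mem_def,
    finsum_eq_sum_of_support_subset (s := S), finsum_eq_sum_of_support_subset (s := S)]
  · simp only [indicator_apply, mem_ofPred_eq]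
  · intro e he
    exact hS e (.inr (mem_of_indicator_ne_zero (s := {e | Γ.tgt e = w}) he))
  · intro e he
    exact hS e (.inl (mem_of_indicator_ne_zero (s := {e | Γ.src e = w}) he))

theorem integrableOn_edge [G.LocallyFinite] [CompactSpace Γ.Compl] (hq : Integrable q Γ.vol)
    (u : C(Γ.Compl, ℝ)) (e : G.edgeSet) :
    IntegrableOn (fun t => q (Γ.pt e t) * Γ.onEdge u e t) (Ioo 0 (Γ.len e)) :=
  Γ.integrableOn_of_integrable_vol (Γ.integrable_mul_continuous hq u) e

/-- If `∫ u L ψ = 0` for all eventually flat `ψ` which vanish on the boundary, then `u` is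
`q`-harmonic. Functions `ψ` supported inside an edge give the differential equation, and functions
`ψ` supported near a vertex give the vertex condition. -/
theorem qHarmonic_of_pairing_eq_zero [Countable V] [G.LocallyFinite] [CompactSpace Γ.Compl]
    (hq : Integrable q Γ.vol) {u : C(Γ.Compl, ℝ)}
    (hu : ∀ ψ, Γ.EventuallyFlat ψ → (∀ x ∈ Γ.bdry, ψ x = 0) → Γ.pairing q u ψ = 0) :
    Γ.QHarmonic q fun p => u p := by
  classical
  have hedge : ∀ e, ∃ u' : ℝ → ℝ,
      (∀ t ∈ Icc 0 (Γ.len e), HasDerivWithinAt (Γ.onEdge u e) (u' t) (Icc 0 (Γ.len e)) t) ∧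
      AbsolutelyContinuousOnInterval u' 0 (Γ.len e) ∧
      ∀ᵐ t ∂volume.restrict (Ioo 0 (Γ.len e)),
        HasDerivAt u' (q (Γ.pt e t) * Γ.onEdge u e t) t := by
    intro e
    refine exists_deriv_of_weak (Γ.len_pos e) (Γ.continuous_onEdge u e)
      (Γ.integrableOn_edge hq u e) fun η hη => ?_
    obtain ⟨hηs, δ, hδ, hη0⟩ := hη
    obtain ⟨ψ, hψ, hψv, hψe⟩ := Γ.exists_eventuallyFlat (fun _ => 0)
      (fun e' => if e' = e then η else fun _ => 0) {e}
      (fun e' => by split_ifs; exacts [hηs, contDiff_const])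
      (fun e' => by
        split_ifs
        · filter_upwards [Iio_mem_nhds hδ] with t ht using hη0 t (.inl ht)
        · simp)
      (fun e' => by
        split_ifs with h
        · subst h
          filter_upwards [Ioi_mem_nhds (sub_lt_self _ hδ)] with t ht using hη0 t (.inr ht)
        · simp)
      (fun e' he' t => by rw [if_neg (by simpa using he')])
    have hψe' : ∀ e' ≠ e, ∀ t ∈ Icc 0 (Γ.len e'), Γ.onEdge ψ e' t = 0 := fun e' he t ht => by
      rw [hψe e' t ht, if_neg he]
    have hψ0 : ∀ x ∈ Γ.bdry, ψ x = 0 := by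
      rintro x (⟨v, -, rfl⟩ | hx)
      · exact hψv v
      · refine Γ.eq_const_of_notMem_range (Γ.isCompact_edges {e} (Γ.src e)) (fun p hp => ?_) hx
        rcases Γ.eq_pt_or_vertex p with ⟨e', t, ht, rfl⟩ | ⟨v, rfl⟩
        · refine hψe' e' ?_ t (Ioo_subset_Icc_self ht)
          rintro rfl
          exact hp (.inl (mem_biUnion (x := e') (by simp) ⟨t, Ioo_subset_Icc_self ht, rfl⟩))
        · exact hψv v
    have hψeq : Γ.onEdge ψ e = η := by
      ext t
      have hl := Γ.len_pos e
      rcases lt_or_ge t 0 with h0 | h0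
      · rw [Γ.onEdge_of_nonpos ψ e h0.le, onEdge, Γ.pt_of_nonpos e le_rfl, hψv,
          hη0 t (.inl (h0.trans hδ))]
      rcases lt_or_ge (Γ.len e) t with h1 | h1
      · rw [Γ.onEdge_of_len_le ψ e h1.le, onEdge, Γ.pt_of_len_le e le_rfl, hψv,
          hη0 t (.inr (by linarith))]
      · rw [hψe e t ⟨h0, h1⟩, if_pos rfl]
    have h1 := hu ψ hψ hψ0
    rw [Γ.pairing_eq_sum_edges hq u hψ (S := {e}) (fun e' he' t => ?_), Finset.sum_singleton,
      hψeq] at h1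
    · exact h1
    · have he := Finset.notMem_singleton.1 he'
      have h0 : (0 : ℝ) ∈ Icc 0 (Γ.len e') := ⟨le_rfl, (Γ.len_pos e').le⟩
      have hl : Γ.len e' ∈ Icc 0 (Γ.len e') := ⟨(Γ.len_pos e').le, le_rfl⟩
      rcases le_or_gt t 0 with ht | ht
      · rw [Γ.onEdge_of_nonpos ψ e' ht, hψe' e' he 0 h0]
      rcases le_or_gt (Γ.len e') t with ht' | ht'
      · rw [Γ.onEdge_of_len_le ψ e' ht', hψe' e' he _ hl]
      · exact hψe' e' he t ⟨ht.le, ht'.le⟩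
  choose u' hu1 hu2 hu3 using hedge
  refine ⟨u', hu1, hu2, hu3, fun w hw => ?_⟩
  -- `1 - g` is equal to `1` near `w`, and to `0` at the other vertices and on the boundary.
  obtain ⟨g, hg, -⟩ := Γ.exists_isCutoff (.vertex w) (.vertex w)
  have hψ : Γ.EventuallyFlat (1 - g) :=
    Γ.flatAlgebra.sub_mem Γ.flatAlgebra.one_mem hg.eventuallyFlat
  have hψw : ∀ v, (1 - g) (Point.vertex v : Γ.Point) = if v = w then 1 else 0 := by
    intro v
    split_ifs with h
    · subst h
      simp [hg.apply_self]
    · simp [hg.apply_vertex v fun h' => h (by injection h' with h'; exact h'.symm)]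
  have hψ0 : ∀ x ∈ Γ.bdry, (1 - g) x = 0 := by
    rintro x (⟨v, hv, rfl⟩ | hx)
    · rw [hψw, if_neg]
      rintro rfl
      omega
    · simp [hg.apply_of_notMem_range x hx]
  obtain ⟨S₀, hS₀⟩ := hψ.exists_flatOff
  let S := S₀ ∪ (Γ.finite_incident w).toFinset
  have hSinc : ∀ e, Γ.src e = w ∨ Γ.tgt e = w → e ∈ S := fun e he =>
    Finset.mem_union_right _ (by simpa using he)
  have h1 := hu _ hψ hψ0
  rw [Γ.pairing_eq_sum_edges hq u hψ (S := S) fun e he t => ?_] at h1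
  · have h2 : ∀ e ∈ S, (∫ t in 0..Γ.len e,
        (-(Γ.onEdge u e t * deriv (deriv (Γ.onEdge (1 - g) e)) t) +
          q (Γ.pt e t) * Γ.onEdge u e t * Γ.onEdge (1 - g) e t)) =
        -((if Γ.src e = w then u' e 0 else 0) + if Γ.tgt e = w then -u' e (Γ.len e) else 0) := by
      intro e _
      rw [integral_flux (Γ.len_pos e) (Γ.continuous_onEdge u e) (Γ.integrableOn_edge hq u e)
        (hu1 e) (hu2 e) (hu3 e) (hψ.contDiff Γ e) (hψ.deriv_zero Γ e) (hψ.deriv_len Γ e)]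
      simp only [onEdge, Γ.pt_of_nonpos e le_rfl, Γ.pt_of_len_le e le_rfl, hψw]
      split_ifs <;> ring
    rw [Finset.sum_congr rfl h2, Finset.sum_neg_distrib, neg_eq_zero, Finset.sum_add_distrib] at h1
    rwa [Γ.finsum_incident w S hSinc, Finset.sum_add_distrib]
  · rw [Finset.mem_union, not_or] at he
    rw [hS₀ e he.1 t, onEdge, Γ.pt_of_nonpos e le_rfl, hψw, if_neg]
    intro h
    exact he.2 (by simp [h])

/-! ### The maximum principle -/

/-- On an interval, a solution of `u'' = c u` with `c ≥ 0` which attains a positive maximum `M` at a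
point where its derivative vanishes is constant: where `u` is positive, it is convex. -/
theorem eq_max_of_deriv_eq_zero {l : ℝ} (hl : 0 < l) {u u' c : ℝ → ℝ} (hc : ∀ t, 0 ≤ c t)
    (hu : ∀ t ∈ Icc 0 l, HasDerivWithinAt u (u' t) (Icc 0 l) t)
    (hac : AbsolutelyContinuousOnInterval u' 0 l)
    (hd : ∀ᵐ t ∂volume.restrict (Ioo 0 l), HasDerivAt u' (c t * u t) t) {M : ℝ} (hM : 0 < M)
    (huM : ∀ t ∈ Icc 0 l, u t ≤ M) {t₀ : ℝ} (ht₀ : t₀ ∈ Icc 0 l) (h0 : u t₀ = M)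
    (h0' : u' t₀ = 0) : ∀ t ∈ Icc 0 l, u t = M := by
  have huc : ContinuousOn u (Icc 0 l) := fun t ht => (hu t ht).continuousWithinAt
  have hac' : ContinuousOn u' (Icc 0 l) := by
    have := hac.continuousOn
    rwa [uIcc_of_le hl.le] at this
  have hu_at : ∀ t ∈ Ioo 0 l, HasDerivAt u (u' t) t := fun t ht =>
    (hu t (Ioo_subset_Icc_self ht)).hasDerivAt (Icc_mem_nhds ht.1 ht.2)
  -- Where `u` is nonnegative, `u'` is monotone.
  have hmono : ∀ a ∈ Icc 0 l, ∀ b ∈ Icc 0 l, a ≤ b → (∀ s ∈ Icc a b, 0 ≤ u s) → u' a ≤ u' b := by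
    intro a ha b hb hab hpos
    have h1 := (hac.mono (c := a) (d := b) (by
      rw [uIcc_of_le hab, uIcc_of_le hl.le]
      exact Icc_subset_Icc ha.1 hb.2)).integral_deriv_eq_sub
    have h2 : 0 ≤ ∫ t in a..b, deriv u' t := by
      rw [intervalIntegral.integral_of_le hab, integral_Ioc_eq_integral_Ioo]
      refine integral_nonneg_of_ae ?_
      have hsub : Ioo a b ⊆ Ioo 0 l := Ioo_subset_Ioo ha.1 hb.2
      filter_upwards [ae_restrict_of_ae_restrict_of_subset hsub hd,
        ae_restrict_mem measurableSet_Ioo] with t ht htm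
      rw [ht.deriv]
      exact mul_nonneg (hc t) (hpos t (Ioo_subset_Icc_self htm))
    linarith
  have hslope : ∀ a ∈ Icc 0 l, ∀ b ∈ Icc 0 l, a < b →
      ∃ s ∈ Ioo a b, u' s * (b - a) = u b - u a := by
    intro a ha b hb hab
    obtain ⟨s, hs, h⟩ := exists_hasDerivAt_eq_slope u u' hab
      (huc.mono (Icc_subset_Icc ha.1 hb.2))
      fun x hx => hu_at x ⟨ha.1.trans_lt hx.1, hx.2.trans_le hb.2⟩
    exact ⟨s, hs, by rw [h, div_mul_cancel₀ _ (sub_pos.2 hab).ne']⟩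
  have hloc : ∀ t ∈ Icc 0 l, u t = M → u' t = 0 →
      ∃ ε > 0, ∀ s ∈ Icc 0 l, |s - t| < ε → u s = M := by
    intro t ht htM ht0
    have hev := (huc t ht).eventually (lt_mem_nhds (htM ▸ hM : 0 < u t))
    obtain ⟨ε, hε, hpos⟩ := Metric.mem_nhdsWithin_iff.1 hev
    refine ⟨ε, hε, fun s hs hst => le_antisymm (huM s hs) ?_⟩
    have hball : ∀ r ∈ uIcc t s, 0 ≤ u r := fun r hr => by
      have h1 : |r - t| ≤ |s - t| := abs_sub_left_of_mem_uIcc hr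
      exact le_of_lt (hpos ⟨h1.trans_lt hst, uIcc_subset_Icc ht hs hr⟩)
    rcases lt_trichotomy s t with h | h | h
    · rw [uIcc_of_ge h.le] at hball
      obtain ⟨r, hr, h1⟩ := hslope s hs t ht h
      have h2 := hmono r ⟨hs.1.trans hr.1.le, hr.2.le.trans ht.2⟩ t ht hr.2.le
        fun x hx => hball x ⟨hr.1.le.trans hx.1, hx.2⟩
      nlinarith [sub_pos.2 h]
    · rw [h, htM]
    · rw [uIcc_of_le h.le] at hball
      obtain ⟨r, hr, h1⟩ := hslope t ht s hs h
      have h2 := hmono t ht r ⟨ht.1.trans hr.1.le, hr.2.le.trans hs.2⟩ hr.1.le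
        fun x hx => hball x ⟨hx.1, hx.2.trans hr.2.le⟩
      nlinarith [sub_pos.2 h]
  let T : Set (Icc 0 l) := {t | u t = M ∧ u' t = 0}
  have hT : IsClopen T := by
    refine ⟨(isClosed_eq huc.domRestrict continuous_const).inter
      (isClosed_eq hac'.domRestrict continuous_const), isOpen_iff_mem_nhds.2 ?_⟩
    rintro ⟨t, ht⟩ ⟨htM, ht0⟩
    obtain ⟨ε, hε, h⟩ := hloc t ht htM ht0
    filter_upwards [Metric.ball_mem_nhds _ hε] with s hs
    refine ⟨h s s.2 hs, ?_⟩
    have hev : u =ᶠ[𝓝[Icc 0 l] (s : ℝ)] fun _ => M := by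
      have : ∀ᶠ r in 𝓝 (s : ℝ), |r - t| < ε := Metric.isOpen_ball.mem_nhds hs
      filter_upwards [self_mem_nhdsWithin, this.filter_mono nhdsWithin_le_nhds] with r hr hr'
        using h r hr hr'
    exact ((uniqueDiffOn_Icc hl) s s.2).eq_deriv _ (hu s s.2)
      ((hasDerivWithinAt_const (s : ℝ) (Icc 0 l) M).congr_of_eventuallyEq hev (h s s.2 hs))
  have : PreconnectedSpace (Icc 0 l) := Subtype.preconnectedSpace isPreconnected_Icc
  have huniv := hT.eq_univ ⟨⟨t₀, ht₀⟩, h0, h0'⟩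
  intro t ht
  have : (⟨t, ht⟩ : Icc 0 l) ∈ T := huniv ▸ mem_univ _
  exact this.1

theorem deriv_nonpos_of_max_left {l : ℝ} (hl : 0 < l) {u : ℝ → ℝ} {d : ℝ}
    (hu : HasDerivWithinAt u d (Icc 0 l) 0) (hmax : ∀ t ∈ Icc 0 l, u t ≤ u 0) : d ≤ 0 := by
  have h1 : IsLocalMaxOn u (Icc 0 l) 0 := eventually_mem_nhdsWithin.mono hmax
  have h2 := h1.hasFDerivWithinAt_nonpos hu.hasFDerivWithinAt (y := l)
    (mem_posTangentConeAt_of_segment_subset (by rw [zero_add, segment_eq_Icc hl.le]))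
  simp only [ContinuousLinearMap.toSpanSingleton_apply, smul_eq_mul] at h2
  nlinarith

theorem deriv_nonneg_of_max_right {l : ℝ} (hl : 0 < l) {u : ℝ → ℝ} {d : ℝ}
    (hu : HasDerivWithinAt u d (Icc 0 l) l) (hmax : ∀ t ∈ Icc 0 l, u t ≤ u l) : 0 ≤ d := by
  have h1 : IsLocalMaxOn u (Icc 0 l) l := eventually_mem_nhdsWithin.mono hmax
  have h2 := h1.hasFDerivWithinAt_nonpos hu.hasFDerivWithinAt (y := -l)
    (mem_posTangentConeAt_of_segment_subset
      (by rw [add_neg_cancel, segment_symm, segment_eq_Icc hl.le]))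
  simp only [ContinuousLinearMap.toSpanSingleton_apply, smul_eq_mul] at h2
  nlinarith

theorem adj_src_tgt (e : G.edgeSet) : G.Adj (Γ.src e) (Γ.tgt e) := by
  have h := e.2
  rwa [← Γ.mk_src_tgt e, SimpleGraph.mem_edgeSet] at h

/-- The maximum principle: the set where a positive maximum is attained would contain with a point
the closed edges through this point, and so the whole graph. -/
theorem QHarmonic.nonpos [G.LocallyFinite] [CompactSpace Γ.Compl] (hconn : G.Connected)
    (hbdry : Γ.bdry.Nonempty) {q : Γ.Point → ℝ} (hq0 : ∀ p, 0 ≤ q p) {u : C(Γ.Compl, ℝ)}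
    (hu : Γ.QHarmonic q fun p => u p) (hu0 : ∀ x ∈ Γ.bdry, u x ≤ 0) (x : Γ.Compl) : u x ≤ 0 := by
  classical
  obtain ⟨u', hu1, hu2, hu3, hu4⟩ := hu
  obtain ⟨y, hy⟩ := hbdry
  obtain ⟨z, -, hz⟩ := isCompact_univ.exists_isMaxOn ⟨y, mem_univ y⟩ u.continuous.continuousOn
  have hmax : ∀ x, u x ≤ u z := fun x => hz (mem_univ x)
  obtain ⟨M, hMz⟩ : ∃ M, M = u z := ⟨_, rfl⟩
  rw [← hMz] at hmax
  by_contra! hx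
  have hM : 0 < M := hx.trans_le (hmax x)
  have hl0 : ∀ e, (0 : ℝ) ∈ Icc 0 (Γ.len e) := fun e => ⟨le_rfl, (Γ.len_pos e).le⟩
  have hll : ∀ e, Γ.len e ∈ Icc 0 (Γ.len e) := fun e => ⟨(Γ.len_pos e).le, le_rfl⟩
  have hedge : ∀ e, ∀ t₀ ∈ Icc 0 (Γ.len e), u (Γ.pt e t₀) = M → u' e t₀ = 0 →
      ∀ t ∈ Icc 0 (Γ.len e), u (Γ.pt e t) = M := fun e t₀ ht₀ h h' =>
    eq_max_of_deriv_eq_zero (Γ.len_pos e) (fun t => hq0 (Γ.pt e t)) (hu1 e) (hu2 e) (hu3 e) hM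
      (fun t _ => hmax _) ht₀ h h'
  have hvertex : ∀ v, u (Point.vertex v : Γ.Point) = M → ∀ e, Γ.src e = v ∨ Γ.tgt e = v →
      ∀ t ∈ Icc 0 (Γ.len e), u (Γ.pt e t) = M := by
    intro v hv e he
    have hsrc : ∀ e, Γ.src e = v → u' e 0 ≤ 0 := fun e he =>
      deriv_nonpos_of_max_left (Γ.len_pos e) (hu1 e 0 (hl0 e)) fun t _ => by
        change u (Γ.pt e t) ≤ u (Γ.pt e 0)
        rw [Γ.pt_of_nonpos e le_rfl, he, hv]
        exact hmax _
    have htgt : ∀ e, Γ.tgt e = v → 0 ≤ u' e (Γ.len e) := fun e he =>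
      deriv_nonneg_of_max_right (Γ.len_pos e) (hu1 e _ (hll e)) fun t _ => by
        change u (Γ.pt e t) ≤ u (Γ.pt e (Γ.len e))
        rw [Γ.pt_of_len_le e le_rfl, he, hv]
        exact hmax _
    -- A vertex of degree one belongs to the boundary, where `u ≤ 0`.
    have hdeg : 2 ≤ G.degree v := by
      have h0 : 0 < G.degree v := by
        rw [G.degree_pos_iff_exists_adj]
        rcases he with rfl | rfl
        · exact ⟨_, Γ.adj_src_tgt e⟩
        · exact ⟨_, (Γ.adj_src_tgt e).symm⟩
      have h1 : G.degree v ≠ 1 := fun h => by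
        have := hu0 _ (.inl ⟨v, h, rfl⟩)
        linarith
      omega
    -- At a maximum, all derivatives pointing away from the vertex are nonpositive, so that they
    -- vanish if their sum does.
    have hsum := hu4 v hdeg
    rw [Γ.finsum_incident v (Γ.finite_incident v).toFinset (fun e he => by simpa using he),
      Finset.sum_eq_zero_iff_of_nonpos] at hsum
    · have h := hsum e (by simpa using he)
      rcases he with he | he
      · rw [if_pos he, if_neg fun h' => Γ.src_ne_tgt e (he.trans h'.symm), add_zero] at h
        refine hedge e 0 (hl0 e) ?_ h
        rw [Γ.pt_of_nonpos e le_rfl, he, hv]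
      · rw [if_neg fun h' => Γ.src_ne_tgt e (h'.trans he.symm), if_pos he, zero_add,
          neg_eq_zero] at h
        refine hedge e _ (hll e) ?_ h
        rw [Γ.pt_of_len_le e le_rfl, he, hv]
    · intro e _
      refine add_nonpos ?_ ?_
      · split_ifs with h
        · exact hsrc e h
        · exact le_rfl
      · split_ifs with h
        · exact neg_nonpos.2 (htgt e h)
        · exact le_rfl
  obtain ⟨v₀, hv₀⟩ : ∃ v, u (Point.vertex v : Γ.Point) = M := by
    have hzr : z ∈ range fun p : Γ.Point => (p : Γ.Compl) := by
      by_contra hzr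
      have := hu0 z (.inr hzr)
      linarith
    obtain ⟨p, rfl⟩ := hzr
    rcases Γ.eq_pt_or_vertex p with ⟨e, t, ht, rfl⟩ | ⟨v, rfl⟩
    · refine ⟨Γ.src e, ?_⟩
      rw [← Γ.pt_of_nonpos e le_rfl]
      have hd : u' e t = 0 := by
        refine IsLocalMax.hasDerivAt_eq_zero (f := fun s => u (Γ.pt e s)) (a := t)
          (Eventually.of_forall fun s => ?_)
          ((hu1 e t (Ioo_subset_Icc_self ht)).hasDerivAt (Icc_mem_nhds ht.1 ht.2))
        exact (hmax _).trans_eq hMz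
      exact hedge e t (Ioo_subset_Icc_self ht) hMz.symm hd 0 (hl0 e)
    · exact ⟨v, hMz.symm⟩
  have hall : ∀ v, u (Point.vertex v : Γ.Point) = M := by
    intro v
    obtain ⟨π⟩ := hconn.preconnected v v₀
    induction π with
    | nil => exact hv₀
    | @cons v w _ h _ ih =>
      have hw := ih hv₀
      have hs := Γ.mk_src_tgt ⟨s(v, w), h⟩
      rcases Sym2.eq_iff.1 hs with ⟨h1, h2⟩ | ⟨h1, h2⟩
      · rw [← h1, ← Γ.pt_of_nonpos _ le_rfl]
        exact hvertex w hw _ (.inr h2) 0 (hl0 _)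
      · rw [← h2, ← Γ.pt_of_len_le _ le_rfl]
        exact hvertex w hw _ (.inl h1) _ (hll _)
  have hpt : ∀ p : Γ.Point, u p = M := by
    intro p
    rcases Γ.eq_pt_or_vertex p with ⟨e, t, ht, rfl⟩ | ⟨v, rfl⟩
    · exact hvertex _ (hall (Γ.src e)) e (.inl rfl) t (Ioo_subset_Icc_self ht)
    · exact hall v
  have hyM : u y = M :=
    UniformSpace.Completion.induction_on y (isClosed_eq u.continuous continuous_const) hpt
  linarith [hu0 y hy]

/-! ### The reduced energy form and harmonic extension -/

/-- Let `B` be a positive semidefinite form on `X`. The part of `B` orthogonal to a subspace `X₀` is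
a form `b`, and there are approximate `B`-orthogonal projections to `X₀`, Cauchy for the seminorm of
`B`. This is orthogonal projection in the Hilbert space completion of `X`. -/
theorem exists_orthogonal_part {X : Type*} [AddCommGroup X] [Module ℝ X] (B : X →ₗ[ℝ] X →ₗ[ℝ] ℝ)
    (hsymm : ∀ x y, B x y = B y x) (hpos : ∀ x, 0 ≤ B x x) (X₀ : Submodule ℝ X) :
    ∃ b : X →ₗ[ℝ] X →ₗ[ℝ] ℝ, (∀ x y, b x y = b y x) ∧ (∀ x, 0 ≤ b x x) ∧ (∀ x, b x x ≤ B x x) ∧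
      (∀ x, ∀ y ∈ X₀, b x y = 0) ∧ ∀ x, ∃ v : ℕ → X, (∀ n, v n ∈ X₀) ∧
        (∀ ε > 0, ∃ N, ∀ m ≥ N, ∀ n ≥ N, B (v m - v n) (v m - v n) < ε) ∧
        (∀ y, Tendsto (fun n => B (x - v n) y) atTop (𝓝 (b x y))) ∧
        Tendsto (fun n => B (x - v n) (x - v n)) atTop (𝓝 (b x x)) := by
  let core : PreInnerProductSpace.Core ℝ X :=
    { inner := fun x y => B x y
      conj_inner_symm := fun x y => hsymm y x
      re_inner_nonneg := hpos
      add_left := fun x y z => by simp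
      smul_left := fun x y r => by simp }
  let _ : SeminormedAddCommGroup X := InnerProductSpace.Core.toSeminormedAddCommGroup (𝕜 := ℝ)
  let _ : InnerProductSpace ℝ X := InnerProductSpace.ofCore core
  let 𝓗 := UniformSpace.Completion X
  let J : X →ₗ[ℝ] 𝓗 := (UniformSpace.Completion.toComplL (𝕜 := ℝ) (E := X) : X →L[ℝ] 𝓗)
  have hJ : ∀ x y, inner ℝ (J x) (J y) = B x y := fun x y => UniformSpace.Completion.inner_coe x y
  let K : Submodule ℝ 𝓗 := (X₀.map J).topologicalClosure
  have : CompleteSpace K := (X₀.map J).isClosed_topologicalClosure.completeSpace_coe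
  let Q : 𝓗 →L[ℝ] 𝓗 := Kᗮ.starProjection
  have hQ : ∀ x y, inner ℝ (Q x) (Q y) = inner ℝ (Q x) y := fun x y => by
    rw [← Submodule.inner_starProjection_left_eq_right]
    congr 1
    exact Submodule.starProjection_eq_self_iff.2 (Submodule.starProjection_apply_mem _ _)
  have hQz : ∀ x, ∀ y ∈ X₀, inner ℝ (Q (J x)) (J y) = 0 := fun x y hy => by
    rw [real_inner_comm]
    exact (Submodule.mem_orthogonal _ _).1 (Submodule.starProjection_apply_mem _ _) _
      ((X₀.map J).le_topologicalClosure (Submodule.mem_map_of_mem hy))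
  refine ⟨(innerₗ 𝓗).compl₁₂ (Q.toLinearMap ∘ₗ J) J, fun x y => ?_, fun x => ?_, fun x => ?_, hQz,
    fun x => ?_⟩
  · change inner ℝ (Q (J x)) (J y) = inner ℝ (Q (J y)) (J x)
    rw [← hQ, real_inner_comm, hQ]
  · change 0 ≤ inner ℝ (Q (J x)) (J x)
    rw [← hQ]
    exact real_inner_self_nonneg
  · change inner ℝ (Q (J x)) (J x) ≤ _
    rw [← hQ, ← hJ, real_inner_self_eq_norm_sq, real_inner_self_eq_norm_sq]
    exact pow_le_pow_left₀ (norm_nonneg _) (Submodule.norm_starProjection_apply_le _ _) 2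
  · have hmem : J x - Q (J x) ∈ closure (X₀.map J : Set 𝓗) := by
      have h1 : J x - Q (J x) = K.starProjection (J x) := by
        rw [sub_eq_iff_eq_add]
        exact (K.starProjection_add_starProjection_orthogonal _).symm
      rw [h1]
      exact Submodule.starProjection_apply_mem K (J x)
    obtain ⟨w, hw, hlim⟩ := mem_closure_iff_seq_limit.1 hmem
    choose v hv hvw using hw
    obtain rfl : (fun n => J (v n)) = w := funext hvw
    have hlim' : Tendsto (fun n => J (x - v n)) atTop (𝓝 (Q (J x))) := by
      have := hlim.const_sub (J x)
      simpa using this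
    refine ⟨v, hv, fun ε hε => ?_, fun y => ?_, ?_⟩
    · obtain ⟨N, hN⟩ := Metric.cauchySeq_iff.1 hlim.cauchySeq (√ε) (Real.sqrt_pos.2 hε)
      refine ⟨N, fun m hm n hn => ?_⟩
      rw [← hJ, real_inner_self_eq_norm_sq, map_sub, ← dist_eq_norm]
      exact (Real.lt_sqrt dist_nonneg).1 (hN m hm n hn)
    · exact (hlim'.inner (𝕜 := ℝ) tendsto_const_nhds).congr fun n => hJ _ _
    · have := hlim'.inner (𝕜 := ℝ) hlim'
      rw [hQ] at this
      exact this.congr fun n => hJ _ _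

/-- The quadratic form of the pairing, on eventually flat functions. -/
def energyForm [Countable V] [G.LocallyFinite] [CompactSpace Γ.Compl] (hq : Integrable q Γ.vol) :
    Γ.flatAlgebra →ₗ[ℝ] Γ.flatAlgebra →ₗ[ℝ] ℝ :=
  LinearMap.mk₂ ℝ (fun φ ψ => Γ.pairing q φ ψ) (fun φ ψ χ => Γ.pairing_add_left hq φ ψ χ.2)
    (fun c φ ψ => Γ.pairing_smul_left c φ ψ) (fun φ ψ χ => Γ.pairing_add_right hq φ ψ.2 χ.2)
    fun c φ ψ => Γ.pairing_smul_right c φ ψ.2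

/-- The eventually flat functions which vanish on the boundary. -/
def flatZero [G.LocallyFinite] : Submodule ℝ Γ.flatAlgebra where
  carrier := {φ | ∀ x ∈ Γ.bdry, (φ : C(Γ.Compl, ℝ)) x = 0}
  zero_mem' := fun _ _ => rfl
  add_mem' := fun hφ hψ x hx => by
    change (_ : ℝ) + _ = 0
    rw [hφ x hx, hψ x hx, add_zero]
  smul_mem' := fun c φ hφ x hx => by
    change c * (_ : ℝ) = 0
    rw [hφ x hx, mul_zero]

theorem QHarmonic.sub [G.LocallyFinite] {u v : Γ.Point → ℝ} (hu : Γ.QHarmonic q u)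
    (hv : Γ.QHarmonic q v) : Γ.QHarmonic q fun p => u p - v p := by
  obtain ⟨u', hu1, hu2, hu3, hu4⟩ := hu
  obtain ⟨v', hv1, hv2, hv3, hv4⟩ := hv
  refine ⟨fun e t => u' e t - v' e t, fun e t ht => (hu1 e t ht).sub (hv1 e t ht),
    fun e => (hu2 e).sub (hv2 e), fun e => ?_, fun v hv => ?_⟩
  · filter_upwards [hu3 e, hv3 e] with t h1 h2
    rw [mul_sub]
    exact h1.sub h2
  · classical
    have h1 := hu4 v hv
    have h2 := hv4 v hv
    rw [Γ.finsum_incident v (Γ.finite_incident v).toFinset (fun e he => by simpa using he)]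
      at h1 h2 ⊢
    have h := congrArg₂ (· - ·) h1 h2
    simp only [← Finset.sum_sub_distrib, sub_zero] at h
    refine Eq.trans ?_ h
    refine Finset.sum_congr rfl fun e _ => ?_
    split_ifs <;> ring

theorem HarmonicExtension.nonneg [G.LocallyFinite] [CompactSpace Γ.Compl] (hconn : G.Connected)
    (hbdry : Γ.bdry.Nonempty) (hq0 : ∀ p, 0 ≤ q p) {F : C(Γ.bdry, ℝ)} {u : C(Γ.Compl, ℝ)}
    (hu : Γ.HarmonicExtension q F u) (hF : ∀ x, 0 ≤ F x) (x : Γ.Compl) : 0 ≤ u x := by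
  -- The maximum principle applies to `-u`, written as `u - u - u`.
  have h0 : Γ.QHarmonic q fun p => (u - u : C(Γ.Compl, ℝ)) p := hu.2.sub Γ hu.2
  have h1 : Γ.QHarmonic q fun p => (u - u - u : C(Γ.Compl, ℝ)) p := h0.sub Γ hu.2
  have := h1.nonpos Γ hconn hbdry hq0 (fun y hy => ?_) x
  · simpa using this
  · have := hF ⟨y, hy⟩
    rw [← hu.1] at this
    simpa using this

theorem HarmonicExtension.unique [G.LocallyFinite] [CompactSpace Γ.Compl] (hconn : G.Connected)
    (hbdry : Γ.bdry.Nonempty) (hq0 : ∀ p, 0 ≤ q p) {F : C(Γ.bdry, ℝ)} {u v : C(Γ.Compl, ℝ)}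
    (hu : Γ.HarmonicExtension q F u) (hv : Γ.HarmonicExtension q F v) : u = v := by
  have key : ∀ u v : C(Γ.Compl, ℝ), Γ.HarmonicExtension q F u → Γ.HarmonicExtension q F v →
      ∀ x, u x ≤ v x := fun u v hu hv x => by
    have h : Γ.QHarmonic q fun p => (u - v : C(Γ.Compl, ℝ)) p := hu.2.sub Γ hv.2
    refine sub_nonpos.1 (h.nonpos Γ hconn hbdry hq0 (fun y hy => ?_) x)
    rw [ContinuousMap.sub_apply, hu.1 ⟨y, hy⟩, hv.1 ⟨y, hy⟩, sub_self]
  ext x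
  exact le_antisymm (key u v hu hv x) (key v u hv hu x)

/-- The form `b` is the energy form reduced to boundary values: `b φ ψ` is the pairing with `ψ` of
the `q`-harmonic function with the boundary values of `φ`, and `b φ φ` is the infimum of the energies
of the eventually flat functions with the boundary values of `φ`. -/
structure IsBoundaryForm [G.LocallyFinite] (q : Γ.Point → ℝ)
    (b : Γ.flatAlgebra →ₗ[ℝ] Γ.flatAlgebra →ₗ[ℝ] ℝ) : Prop where
  symm : ∀ φ ψ, b φ ψ = b ψ φ
  nonneg : ∀ φ, 0 ≤ b φ φ
  le_pairing : ∀ φ : Γ.flatAlgebra, b φ φ ≤ Γ.pairing q φ φ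
  apply_flatZero : ∀ φ, ∀ ψ ∈ Γ.flatZero, b φ ψ = 0
  exists_pairing_lt : ∀ φ, ∀ c > b φ φ,
    ∃ ψ : Γ.flatAlgebra, φ - ψ ∈ Γ.flatZero ∧ Γ.pairing q ψ ψ < c
  exists_harmonic : ∀ φ : Γ.flatAlgebra, ∃ u : C(Γ.Compl, ℝ),
    (∀ x ∈ Γ.bdry, u x = (φ : C(Γ.Compl, ℝ)) x) ∧ Γ.QHarmonic q (fun p => u p) ∧
      ∀ ψ : Γ.flatAlgebra, Γ.pairing q u ψ = b φ ψ

theorem exists_isBoundaryForm [Countable V] [G.LocallyFinite] [CompactSpace Γ.Compl]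
    (hconn : G.Connected) (hbdry : Γ.bdry.Nonempty) (hq0 : ∀ p, 0 ≤ q p)
    (hq : Integrable q Γ.vol) : ∃ b, Γ.IsBoundaryForm q b := by
  obtain ⟨b, hsymm, hpos, hle, hzero, happrox⟩ := exists_orthogonal_part (Γ.energyForm hq)
    (fun φ ψ => Γ.pairing_comm hq φ.2 ψ.2) (fun φ => Γ.pairing_self_nonneg hq0 hq φ.2) Γ.flatZero
  refine ⟨b, hsymm, hpos, hle, hzero, fun φ c hc => ?_, fun φ => ?_⟩
  · obtain ⟨v, hv, -, -, hlim⟩ := happrox φ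
    obtain ⟨n, hn⟩ := (hlim.eventually (gt_mem_nhds hc)).exists
    refine ⟨φ - v n, ?_, hn⟩
    rw [sub_sub_cancel]
    exact hv n
  · obtain ⟨v, hv, hcauchy, hlim, -⟩ := happrox φ
    obtain ⟨C, hC, hbound⟩ := Γ.exists_norm_sq_le_pairing hconn hbdry hq0 hq
    have hc : CauchySeq fun n => (v n : C(Γ.Compl, ℝ)) := by
      refine Metric.cauchySeq_iff.2 fun ε hε => ?_
      obtain ⟨N, hN⟩ := hcauchy (ε ^ 2 / C) (by positivity)
      refine ⟨N, fun m hm n hn => ?_⟩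
      have h1 := hbound (v m - v n : Γ.flatAlgebra) (v m - v n : Γ.flatAlgebra).2
        (Γ.flatZero.sub_mem (hv m) (hv n))
      have h2 : C * _ < _ := (lt_div_iff₀' hC).1 (hN m hm n hn)
      rw [dist_eq_norm]
      exact lt_of_pow_lt_pow_left₀ 2 hε.le (h1.trans_lt h2)
    obtain ⟨w, hw⟩ := cauchySeq_tendsto_of_complete hc
    have hu : Tendsto (fun n => ((φ - v n : Γ.flatAlgebra) : C(Γ.Compl, ℝ))) atTop
        (𝓝 ((φ : C(Γ.Compl, ℝ)) - w)) := hw.const_sub _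
    have hpair : ∀ ψ : Γ.flatAlgebra, Γ.pairing q ((φ : C(Γ.Compl, ℝ)) - w) ψ = b φ ψ :=
      fun ψ => tendsto_nhds_unique (((Γ.continuous_pairing_left hq ψ.2).tendsto _).comp hu) (hlim ψ)
    refine ⟨φ - w, fun x hx => ?_, Γ.qHarmonic_of_pairing_eq_zero hq fun ψ hψ h0 => ?_, hpair⟩
    · have h0 : w x = 0 := tendsto_nhds_unique
        (((continuous_eval_const x).tendsto _).comp hw)
        (tendsto_const_nhds.congr fun n => (hv n x hx).symm)
      rw [ContinuousMap.sub_apply, h0, sub_zero]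
    · exact (hpair ⟨ψ, hψ⟩).trans (hzero φ ⟨ψ, hψ⟩ h0)

/-! ### Functions of finite range and measures on compact totally disconnected spaces -/

section Clopen

variable {X : Type*} [TopologicalSpace X]

/-- The continuous real functions with finite range. -/
def finiteRange (X : Type*) [TopologicalSpace X] : Subalgebra ℝ C(X, ℝ) where
  carrier := {F | (range F).Finite}
  mul_mem' hF hH := (hF.image2 (· * ·) hH).subset
    (range_subset_iff.2 fun x => mem_image2_of_mem (mem_range_self x) (mem_range_self x))
  add_mem' hF hH := (hF.image2 (· + ·) hH).subset
    (range_subset_iff.2 fun x => mem_image2_of_mem (mem_range_self x) (mem_range_self x))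
  algebraMap_mem' c := (finite_singleton c).subset (range_subset_iff.2 fun _ => rfl)

theorem mem_finiteRange {F : C(X, ℝ)} : F ∈ finiteRange X ↔ (range F).Finite := Iff.rfl

/-- The indicator function of a clopen set, as a continuous function. -/
def clopenIndicator {E : Set X} (hE : IsClopen E) : C(X, ℝ) :=
  ⟨E.indicator 1, hE.continuous_indicator continuous_one⟩

theorem clopenIndicator_mem {E : Set X} (hE : IsClopen E) : clopenIndicator hE ∈ finiteRange X := by
  refine (toFinite {(0 : ℝ), 1}).subset (range_subset_iff.2 fun x => ?_)
  by_cases h : x ∈ E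
  · exact .inr (indicator_of_mem h _)
  · exact .inl (indicator_of_notMem h _)

theorem isClopen_fiber {F : C(X, ℝ)} (hF : F ∈ finiteRange X) (c : ℝ) : IsClopen (F ⁻¹' {c}) := by
  refine ⟨isClosed_singleton.preimage F.continuous, isClosed_compl_iff.1 ?_⟩
  have h : (F ⁻¹' {c})ᶜ = F ⁻¹' (range F \ {c}) := by
    ext x
    simp
  rw [h]
  exact ((mem_finiteRange.1 hF).subset sdiff_subset).isClosed.preimage F.continuous

theorem apply_eq_sum_fibers {F : C(X, ℝ)} (hF : (range F).Finite) (x : X) :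
    F x = ∑ c ∈ hF.toFinset, (F ⁻¹' {c}).indicator (fun _ => c) x := by
  rw [Finset.sum_eq_single (F x)]
  · exact (indicator_of_mem (s := F ⁻¹' {F x}) rfl _).symm
  · intro c _ hc
    exact indicator_of_notMem (s := F ⁻¹' {c}) (fun h : F x = c => hc h.symm) _
  · exact fun h => absurd (hF.mem_toFinset.2 (mem_range_self x)) h

theorem eq_sum_clopenIndicator {F : C(X, ℝ)} (hF : F ∈ finiteRange X) :
    F = ∑ c ∈ (mem_finiteRange.1 hF).toFinset, c • clopenIndicator (isClopen_fiber hF c) := by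
  ext x
  rw [apply_eq_sum_fibers hF, ContinuousMap.sum_apply]
  refine Finset.sum_congr rfl fun (c : ℝ) _ => ?_
  change (F ⁻¹' {c}).indicator (fun _ => c) x = c * (F ⁻¹' {c}).indicator (1 : X → ℝ) x
  by_cases h : x ∈ F ⁻¹' {c}
  · rw [indicator_of_mem h, indicator_of_mem h, Pi.one_apply, mul_one]
  · rw [indicator_of_notMem h, indicator_of_notMem h, mul_zero]

theorem finiteRange_eq_span : (finiteRange X).toSubmodule =
    Submodule.span ℝ {F : C(X, ℝ) | ∃ E : Set X, IsClopen E ∧ ⇑F = E.indicator 1} := by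
  refine le_antisymm (fun F hF => ?_) (Submodule.span_le.2 ?_)
  · rw [eq_sum_clopenIndicator hF]
    exact Submodule.sum_mem _ fun c _ => Submodule.smul_mem _ _
      (Submodule.subset_span ⟨_, isClopen_fiber hF c, rfl⟩)
  · rintro F ⟨E, hE, h⟩
    have : F = clopenIndicator hE := ContinuousMap.coe_injective h
    rw [this]
    exact clopenIndicator_mem hE

theorem integral_finiteRange [MeasurableSpace X] [BorelSpace X] (ν : SignedMeasure X) {F : C(X, ℝ)} (hF : F ∈ finiteRange X) :
    ∫ᵛ x, F x ∂<•ν = ∑ c ∈ (mem_finiteRange.1 hF).toFinset, c * ν (F ⁻¹' {c}) := by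
  have hfin : IsFiniteMeasure ν.variation := by
    rw [← SignedMeasure.totalVariation_eq_variation]
    infer_instance
  have hm : ∀ c, MeasurableSet (F ⁻¹' {c}) := fun c => (isClopen_fiber hF c).isOpen.measurableSet
  simp only [apply_eq_sum_fibers hF]
  rw [VectorMeasure.integral_finsetSum]
  · refine Finset.sum_congr rfl fun c _ => ?_
    rw [VectorMeasure.integral_indicator_const c (hm c)]
    simp [mul_comm]
  · exact fun c _ => (integrable_const c).indicator (hm c)

variable [CompactSpace X] [T2Space X] [TotallyDisconnectedSpace X]

theorem dense_finiteRange : Dense (finiteRange X : Set C(X, ℝ)) := by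
  have h : (finiteRange X).SeparatesPoints := fun x y hxy => by
    obtain ⟨E, hE, hxE, hEy⟩ := compact_exists_isClopen_in_isOpen isOpen_compl_singleton hxy
    refine ⟨_, ⟨clopenIndicator hE, clopenIndicator_mem hE, rfl⟩, ?_⟩
    change E.indicator (1 : X → ℝ) x ≠ E.indicator (1 : X → ℝ) y
    rw [indicator_of_mem hxE, indicator_of_notMem fun h => hEy h rfl]
    exact one_ne_zero
  intro F
  exact ContinuousMap.continuousMap_mem_subalgebra_closure_of_separatesPoints _ h F

variable [SecondCountableTopology X] [MeasurableSpace X] [BorelSpace X]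

theorem borel_eq_generateFrom_isClopen :
    ‹MeasurableSpace X› = MeasurableSpace.generateFrom {E : Set X | IsClopen E} := by
  rw [BorelSpace.measurable_eq (α := X)]
  exact isTopologicalBasis_isClopen.borel_eq_generateFrom

theorem signedMeasure_ext_of_isClopen {μ ν : SignedMeasure X}
    (h : ∀ E, IsClopen E → μ E = ν E) : μ = ν :=
  VectorMeasure.ext_of_generateFrom _ h borel_eq_generateFrom_isClopen
    (fun _ hs _ ht _ => IsClopen.inter hs ht) (h _ isClopen_univ)

/-- A nonnegative additive function on the clopen sets of a compact totally disconnected space is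
the restriction of a measure: countable additivity holds because a clopen set is never a disjoint
union of infinitely many nonempty clopen sets. -/
theorem exists_measure_of_isClopen (m : Set X → ℝ) (h0 : ∀ E, IsClopen E → 0 ≤ m E)
    (hadd : ∀ E E', IsClopen E → IsClopen E' → Disjoint E E' → m (E ∪ E') = m E + m E') :
    ∃ μ : Measure X, IsFiniteMeasure μ ∧ ∀ E, IsClopen E → μ.real E = m E := by
  have hring : IsSetRing {E : Set X | IsClopen E} :=
    ⟨isClopen_empty, fun _ _ hs ht => IsClopen.union hs ht, fun _ _ hs ht => IsClopen.diff hs ht⟩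
  have hempty : m ∅ = 0 := by
    have := hadd ∅ ∅ isClopen_empty isClopen_empty (disjoint_bot_left)
    rw [union_self] at this
    linarith
  let c : AddContent ℝ≥0∞ {E : Set X | IsClopen E} :=
    hring.addContent_of_union (fun E => ENNReal.ofReal (m E)) (by simp [hempty])
      fun {s t} hs ht hd => by rw [hadd s t hs ht hd, ENNReal.ofReal_add (h0 s hs) (h0 t ht)]
  have hc : c.IsSigmaSubadditive := by
    intro f hf hU
    obtain ⟨I, hI⟩ := (IsClopen.isClosed hU).isCompact.elim_finite_subcover f
      (fun i => IsClopen.isOpen (hf i)) subset_rfl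
    calc c (⋃ i, f i) ≤ c (⋃ i ∈ I, f i) := addContent_mono hring.isSetSemiring hU
          (hring.biUnion_mem I fun i _ => hf i) hI
      _ ≤ ∑ i ∈ I, c (f i) := addContent_biUnion_le hring fun i _ => hf i
      _ ≤ _ := ENNReal.sum_le_tsum I
  let μ := c.measure hring.isSetSemiring borel_eq_generateFrom_isClopen.le hc
  have hμ : ∀ E, IsClopen E → μ E = ENNReal.ofReal (m E) := fun E hE =>
    c.measure_eq hring.isSetSemiring borel_eq_generateFrom_isClopen hc hE
  refine ⟨μ, ⟨?_⟩, fun E hE => ?_⟩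
  · rw [hμ _ isClopen_univ]
    exact ENNReal.ofReal_lt_top
  · rw [measureReal_def, hμ E hE, ENNReal.toReal_ofReal (h0 E hE)]

end Clopen

/-! ### Signs of the boundary form -/

/-- The energy is at most multiplied by `K²` under composition with a `K`-Lipschitz function
vanishing at zero. -/
theorem pairing_comp_le [Countable V] [G.LocallyFinite] [CompactSpace Γ.Compl]
    (hq0 : ∀ p, 0 ≤ q p) (hq : Integrable q Γ.vol) {φ : C(Γ.Compl, ℝ)} (hφ : Γ.EventuallyFlat φ)
    {η : C(ℝ, ℝ)} (hη : ContDiff ℝ (⊤ : ℕ∞) η) {K : ℝ} (hη' : ∀ s, |deriv η s| ≤ K)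
    (hη0 : ∀ s, |η s| ≤ K * |s|) :
    Γ.pairing q (η.comp φ) (η.comp φ) ≤ K ^ 2 * Γ.pairing q φ φ := by
  obtain ⟨S, hS⟩ := hφ.exists_flatOff
  have hS' : Γ.FlatOff S (η.comp φ) := fun e he t => congrArg η (hS e he t)
  have hηφ := hφ.comp Γ η hη
  have hsq : ∀ {a b : ℝ}, |a| ≤ K * |b| → a * a ≤ K ^ 2 * (b * b) := fun {a b} h => by
    have := mul_self_le_mul_self (abs_nonneg a) h
    rw [abs_mul_abs_self] at this
    calc a * a ≤ _ := this
      _ = K ^ 2 * (|b| * |b|) := by ring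
      _ = _ := by rw [abs_mul_abs_self]
  have hderiv : ∀ e t, deriv (Γ.onEdge (η.comp φ) e) t =
      deriv η (Γ.onEdge φ e t) * deriv (Γ.onEdge φ e) t := fun e t =>
    deriv_comp t (hη.differentiable (by simp)).differentiableAt
      ((hφ.contDiff Γ e).differentiable (by simp)).differentiableAt
  rw [Γ.pairing_eq_energy hq hηφ hηφ hS', Γ.pairing_eq_energy hq hφ hφ hS, mul_add, Finset.mul_sum]
  refine add_le_add (Finset.sum_le_sum fun e _ => ?_) ?_
  · rw [← intervalIntegral.integral_const_mul]
    have h1 := (hηφ.contDiff_deriv Γ e).continuous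
    have h2 := (hφ.contDiff_deriv Γ e).continuous
    refine intervalIntegral.integral_mono (Γ.len_pos e).le ((h1.mul h1).intervalIntegrable _ _)
      ((continuous_const.mul (h2.mul h2)).intervalIntegrable _ _) fun t => hsq ?_
    rw [hderiv, abs_mul]
    exact mul_le_mul_of_nonneg_right (hη' _) (abs_nonneg _)
  · rw [← integral_const_mul]
    refine integral_mono (Γ.integrable_mul_continuous hq _)
      ((Γ.integrable_mul_continuous hq _).const_mul _) fun p => ?_
    change q p * (η (φ p) * η (φ p)) ≤ K ^ 2 * (q p * (φ p * φ p))
    have := mul_le_mul_of_nonneg_left (hsq (hη0 (φ p))) (hq0 p)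
    linarith

/-- A smooth approximation of the absolute value, normalized to be `1` at `1` and at `-1`. -/
def smoothAbs (δ : ℝ) : C(ℝ, ℝ) :=
  ⟨fun s => (√(s ^ 2 + δ ^ 2) - δ) / (√(1 + δ ^ 2) - δ), by fun_prop⟩

theorem smoothAbs_scale_pos {δ : ℝ} : 0 < √(1 + δ ^ 2) - δ := by
  rw [sub_pos]
  exact Real.lt_sqrt_of_sq_lt (by linarith)

theorem hasDerivAt_smoothAbs {δ : ℝ} (hδ : 0 < δ) (s : ℝ) : HasDerivAt (smoothAbs δ)
    (s / √(s ^ 2 + δ ^ 2) / (√(1 + δ ^ 2) - δ)) s := by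
  have h : s ^ 2 + δ ^ 2 ≠ 0 := by positivity
  have h1 := ((((hasDerivAt_pow 2 s).add_const (δ ^ 2)).sqrt h).sub_const δ).div_const
    (√(1 + δ ^ 2) - δ)
  refine HasDerivAt.congr_deriv (f := smoothAbs δ) h1 ?_
  rw [Nat.cast_ofNat, pow_one, mul_div_mul_left _ _ two_ne_zero]

theorem contDiff_smoothAbs {δ : ℝ} (hδ : 0 < δ) : ContDiff ℝ (⊤ : ℕ∞) (smoothAbs δ) := by
  refine ContDiff.div_const (ContDiff.sub (ContDiff.sqrt ?_ fun s => ?_) contDiff_const) _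
  · exact (contDiff_id.pow 2).add contDiff_const
  · positivity

theorem abs_deriv_smoothAbs_le {δ : ℝ} (hδ : 0 < δ) (s : ℝ) :
    |deriv (smoothAbs δ) s| ≤ (√(1 + δ ^ 2) - δ)⁻¹ := by
  have hκ := smoothAbs_scale_pos (δ := δ)
  rw [(hasDerivAt_smoothAbs hδ s).deriv, div_eq_mul_inv, abs_mul, abs_of_pos (inv_pos.2 hκ)]
  refine mul_le_of_le_one_left (inv_pos.2 hκ).le ?_
  rw [abs_div, abs_of_nonneg (Real.sqrt_nonneg _)]
  exact div_le_one_of_le₀ (Real.abs_le_sqrt (by nlinarith)) (Real.sqrt_nonneg _)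

theorem abs_smoothAbs_le {δ : ℝ} (hδ : 0 < δ) (s : ℝ) : |smoothAbs δ s| ≤ (√(1 + δ ^ 2) - δ)⁻¹ * |s| := by
  have hκ := smoothAbs_scale_pos (δ := δ)
  change |(√(s ^ 2 + δ ^ 2) - δ) / (√(1 + δ ^ 2) - δ)| ≤ _
  rw [div_eq_mul_inv, abs_mul, abs_of_pos (inv_pos.2 hκ), mul_comm]
  refine mul_le_mul_of_nonneg_left ?_ (inv_pos.2 hκ).le
  rw [abs_of_nonneg (sub_nonneg.2 (Real.le_sqrt_of_sq_le (by nlinarith))), sub_le_iff_le_add]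
  refine Real.sqrt_le_iff.2 ⟨by positivity, ?_⟩
  have := mul_nonneg (abs_nonneg s) hδ.le
  nlinarith [sq_abs s]

theorem smoothAbs_zero {δ : ℝ} (hδ : 0 < δ) : smoothAbs δ 0 = 0 := by
  change (√(0 ^ 2 + δ ^ 2) - δ) / (√(1 + δ ^ 2) - δ) = 0
  rw [zero_pow two_ne_zero, zero_add, Real.sqrt_sq hδ.le, sub_self, zero_div]

theorem smoothAbs_of_sq_eq_one {δ s : ℝ} (hs : s ^ 2 = 1) : smoothAbs δ s = 1 := by
  change (√(s ^ 2 + δ ^ 2) - δ) / (√(1 + δ ^ 2) - δ) = 1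
  rw [hs, div_self smoothAbs_scale_pos.ne']

theorem TestFunction.sub_mem_flatZero [G.LocallyFinite] {E : Set Γ.bdry} {φ ψ : Γ.flatAlgebra}
    (hφ : Γ.TestFunction E φ) (hψ : Γ.TestFunction E ψ) : φ - ψ ∈ Γ.flatZero := by
  intro x hx
  change (φ : C(Γ.Compl, ℝ)) x - (ψ : C(Γ.Compl, ℝ)) x = 0
  by_cases h : (⟨x, hx⟩ : Γ.bdry) ∈ E
  · rw [hφ.2.1 _ h, hψ.2.1 _ h, sub_self]
  · rw [hφ.2.2 _ h, hψ.2.2 _ h, sub_self]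

theorem TestFunction.union_sub_mem_flatZero [G.LocallyFinite] {E E' : Set Γ.bdry}
    {φ ψ χ : Γ.flatAlgebra} (hφ : Γ.TestFunction E φ) (hψ : Γ.TestFunction E' ψ)
    (hχ : Γ.TestFunction (E ∪ E') χ) (hd : Disjoint E E') : χ - (φ + ψ) ∈ Γ.flatZero := by
  refine TestFunction.sub_mem_flatZero Γ hχ ⟨(φ + ψ).2, fun x hx => ?_, fun x hx => ?_⟩
  · change (φ : C(Γ.Compl, ℝ)) x + (ψ : C(Γ.Compl, ℝ)) x = 1
    rcases hx with h | h
    · rw [hφ.2.1 x h, hψ.2.2 x (disjoint_left.1 hd h), add_zero]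
    · rw [hψ.2.1 x h, hφ.2.2 x (disjoint_right.1 hd h), zero_add]
  · change (φ : C(Γ.Compl, ℝ)) x + (ψ : C(Γ.Compl, ℝ)) x = 0
    rw [hφ.2.2 x fun h => hx (.inl h), hψ.2.2 x fun h => hx (.inr h), add_zero]

theorem flatOff_one : Γ.FlatOff ∅ 1 := fun _ _ _ => rfl

namespace IsBoundaryForm

variable [G.LocallyFinite] {b : Γ.flatAlgebra →ₗ[ℝ] Γ.flatAlgebra →ₗ[ℝ] ℝ}

theorem congr_right (hb : Γ.IsBoundaryForm q b) (φ : Γ.flatAlgebra) {ψ ψ' : Γ.flatAlgebra}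
    (h : ψ - ψ' ∈ Γ.flatZero) : b φ ψ = b φ ψ' := by
  rw [← sub_eq_zero, ← map_sub]
  exact hb.apply_flatZero φ _ h

theorem congr_left (hb : Γ.IsBoundaryForm q b) (φ : Γ.flatAlgebra) {ψ ψ' : Γ.flatAlgebra}
    (h : ψ - ψ' ∈ Γ.flatZero) : b ψ φ = b ψ' φ := by
  rw [hb.symm, hb.symm ψ', hb.congr_right Γ φ h]

/-- Taking the absolute value does not increase the energy, and changes `1_E - 1_E'` to
`1_E + 1_E'`. -/
theorem nonpos_of_disjoint [Countable V] [CompactSpace Γ.Compl] (hb : Γ.IsBoundaryForm q b)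
    (hq0 : ∀ p, 0 ≤ q p) (hq : Integrable q Γ.vol) {E E' : Set Γ.bdry} (hd : Disjoint E E')
    {φ ψ : Γ.flatAlgebra} (hφ : Γ.TestFunction E φ) (hψ : Γ.TestFunction E' ψ) : b φ ψ ≤ 0 := by
  suffices h : b (φ + ψ) (φ + ψ) ≤ b (φ - ψ) (φ - ψ) by
    simp only [map_add, map_sub, LinearMap.add_apply, LinearMap.sub_apply] at h
    linarith [hb.symm φ ψ]
  refine le_of_forall_gt_imp_ge_of_dense fun c hc => ?_
  obtain ⟨f, hf, hfc⟩ := hb.exists_pairing_lt _ c hc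
  have hcont : ContinuousWithinAt (fun δ : ℝ => (√(1 + δ ^ 2) - δ) ^ 2 * b (φ + ψ) (φ + ψ))
      (Ioi 0) 0 := by fun_prop
  -- The energy grows by the factor `(√(1 + δ ^ 2) - δ)⁻¹ ^ 2`, which tends to `1`.
  have hlim : Tendsto (fun δ : ℝ => (√(1 + δ ^ 2) - δ) ^ 2 * b (φ + ψ) (φ + ψ)) (𝓝[>] 0)
      (𝓝 (b (φ + ψ) (φ + ψ))) := by
    have := hcont.tendsto
    simpa using this
  refine le_of_tendsto hlim ?_
  filter_upwards [self_mem_nhdsWithin] with δ (hδ : 0 < δ)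
  have hκ := smoothAbs_scale_pos (δ := δ)
  let g : Γ.flatAlgebra := ⟨(smoothAbs δ).comp f, f.2.comp Γ _ (contDiff_smoothAbs hδ)⟩
  have hg : φ + ψ - g ∈ Γ.flatZero := by
    intro x hx
    change (φ : C(Γ.Compl, ℝ)) x + (ψ : C(Γ.Compl, ℝ)) x -
      smoothAbs δ ((f : C(Γ.Compl, ℝ)) x) = 0
    have hfx : (φ : C(Γ.Compl, ℝ)) x - (ψ : C(Γ.Compl, ℝ)) x = (f : C(Γ.Compl, ℝ)) x :=
      sub_eq_zero.1 (hf x hx)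
    rw [← hfx]
    by_cases h : (⟨x, hx⟩ : Γ.bdry) ∈ E
    · rw [hφ.2.1 _ h, hψ.2.2 _ (disjoint_left.1 hd h), smoothAbs_of_sq_eq_one (by norm_num)]
      norm_num
    · rw [hφ.2.2 _ h]
      by_cases h' : (⟨x, hx⟩ : Γ.bdry) ∈ E'
      · rw [hψ.2.1 _ h', smoothAbs_of_sq_eq_one (by norm_num)]
        norm_num
      · rw [hψ.2.2 _ h', sub_zero, smoothAbs_zero hδ]
        norm_num
  have h1 : b (φ + ψ) (φ + ψ) ≤ ((√(1 + δ ^ 2) - δ)⁻¹) ^ 2 * Γ.pairing q f f := by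
    rw [hb.congr_left Γ _ hg, hb.congr_right Γ _ hg]
    exact (hb.le_pairing g).trans (Γ.pairing_comp_le hq0 hq f.2 (contDiff_smoothAbs hδ)
      (abs_deriv_smoothAbs_le hδ) (abs_smoothAbs_le hδ))
  calc (√(1 + δ ^ 2) - δ) ^ 2 * b (φ + ψ) (φ + ψ)
      ≤ (√(1 + δ ^ 2) - δ) ^ 2 * (((√(1 + δ ^ 2) - δ)⁻¹) ^ 2 * Γ.pairing q f f) :=
        mul_le_mul_of_nonneg_left h1 (sq_nonneg _)
    _ = Γ.pairing q f f := by
        rw [← mul_assoc, ← mul_pow, mul_inv_cancel₀ hκ.ne', one_pow, one_mul]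
    _ ≤ c := hfc.le

/-- The value is `∫ q u`, where `u` is the nonnegative `q`-harmonic function with boundary
values `1_E`. -/
theorem nonneg_one [Countable V] [CompactSpace Γ.Compl] (hb : Γ.IsBoundaryForm q b)
    (hconn : G.Connected) (hbdry : Γ.bdry.Nonempty) (hq0 : ∀ p, 0 ≤ q p)
    (hq : Integrable q Γ.vol) {E : Set Γ.bdry} (hE : IsClopen E)
    {φ : Γ.flatAlgebra} (hφ : Γ.TestFunction E φ) : 0 ≤ b φ 1 := by
  obtain ⟨u, hu, huq, hub⟩ := hb.exists_harmonic φ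
  have hext : Γ.HarmonicExtension q (clopenIndicator hE) u := by
    refine ⟨fun x => ?_, huq⟩
    rw [hu x x.2]
    change _ = E.indicator (1 : Γ.bdry → ℝ) x
    by_cases h : x ∈ E
    · rw [hφ.2.1 _ h, indicator_of_mem h, Pi.one_apply]
    · rw [hφ.2.2 _ h, indicator_of_notMem h]
  have hu0 := hext.nonneg Γ hconn hbdry hq0 fun x => indicator_nonneg (fun _ _ => zero_le_one) x
  rw [← hub]
  have h1 : Γ.EventuallyFlat 1 := Γ.flatAlgebra.one_mem
  change 0 ≤ Γ.pairing q u 1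
  rw [Γ.pairing_eq_sum hq u h1 Γ.flatOff_one, Finset.sum_empty, zero_add, mul_one]
  exact integral_nonneg fun p => mul_nonneg (hq0 p) (hu0 p)

end IsBoundaryForm

/-! ### The Dirichlet to Neumann map -/

section Lift

variable [G.LocallyFinite] {T : Set Γ.bdry → Γ.flatAlgebra}

/-- The eventually flat function with boundary values `F`, a continuous function with finite range,
built from the test functions `T`. -/
def flatLift (T : Set Γ.bdry → Γ.flatAlgebra) {F : C(Γ.bdry, ℝ)} (hF : F ∈ finiteRange Γ.bdry) :
    Γ.flatAlgebra :=
  ∑ c ∈ (mem_finiteRange.1 hF).toFinset, c • T (F ⁻¹' {c})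

theorem flatLift_apply (hT : ∀ E, IsClopen E → Γ.TestFunction E (T E)) {F : C(Γ.bdry, ℝ)}
    (hF : F ∈ finiteRange Γ.bdry) (x : Γ.bdry) : (Γ.flatLift T hF : C(Γ.Compl, ℝ)) x = F x := by
  have h : (Γ.flatLift T hF : C(Γ.Compl, ℝ)) =
      ∑ c ∈ (mem_finiteRange.1 hF).toFinset, c • (T (F ⁻¹' {c}) : C(Γ.Compl, ℝ)) := by
    simp [flatLift]
  rw [h, ContinuousMap.sum_apply, apply_eq_sum_fibers hF]
  refine Finset.sum_congr rfl fun (c : ℝ) _ => ?_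
  have hc := hT _ (isClopen_fiber hF c)
  change c * (T (F ⁻¹' {c}) : C(Γ.Compl, ℝ)) x = (F ⁻¹' {c}).indicator (fun _ => c) x
  by_cases h : x ∈ F ⁻¹' {c}
  · rw [indicator_of_mem h, hc.2.1 x h, mul_one]
  · rw [indicator_of_notMem h, hc.2.2 x h, mul_zero]

theorem integral_eq_flatLift (b : Γ.flatAlgebra →ₗ[ℝ] Γ.flatAlgebra →ₗ[ℝ] ℝ)
    {F H : C(Γ.bdry, ℝ)} (hF : F ∈ finiteRange Γ.bdry) (hH : H ∈ finiteRange Γ.bdry)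
    {ν : SignedMeasure Γ.bdry} (hν : ∀ E, IsClopen E → ν E = b (Γ.flatLift T hF) (T E)) :
    ∫ᵛ x, H x ∂<•ν = b (Γ.flatLift T hF) (Γ.flatLift T hH) := by
  rw [integral_finiteRange ν hH, flatLift, flatLift, map_sum]
  refine Finset.sum_congr rfl fun c _ => ?_
  rw [map_smul, smul_eq_mul, hν _ (isClopen_fiber hH c), flatLift]

end Lift

namespace IsBoundaryForm

variable [G.LocallyFinite] {b : Γ.flatAlgebra →ₗ[ℝ] Γ.flatAlgebra →ₗ[ℝ] ℝ}
  {T : Set Γ.bdry → Γ.flatAlgebra}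

/-- For a clopen set `Ω`, the boundary form is nonnegative on the clopen subsets of `Ω` and
nonpositive on those of its complement, so that its two parts are measures. -/
theorem exists_signedMeasure_of_isClopen [Countable V] [CompactSpace Γ.Compl]
    [SecondCountableTopology Γ.bdry] [CompactSpace Γ.bdry] [TotallyDisconnectedSpace Γ.bdry]
    (hb : Γ.IsBoundaryForm q b)
    (hconn : G.Connected) (hbdry : Γ.bdry.Nonempty) (hq0 : ∀ p, 0 ≤ q p)
    (hq : Integrable q Γ.vol) (hT : ∀ E, IsClopen E → Γ.TestFunction E (T E))
    {Ω : Set Γ.bdry} (hΩ : IsClopen Ω) :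
    ∃ ν : SignedMeasure Γ.bdry, ∀ E, IsClopen E → ν E = b (T Ω) (T E) := by
  have hadd : ∀ E E', IsClopen E → IsClopen E' → Disjoint E E' →
      b (T Ω) (T (E ∪ E')) = b (T Ω) (T E) + b (T Ω) (T E') := fun E E' hE hE' hd => by
    rw [← map_add]
    exact hb.congr_right Γ _ ((hT E hE).union_sub_mem_flatZero Γ (hT E' hE')
      (hT _ (hE.union hE')) hd)
  have hone : 1 - (T Ω + T Ωᶜ) ∈ Γ.flatZero := by
    refine (hT Ω hΩ).union_sub_mem_flatZero Γ (hT _ hΩ.compl) ?_ disjoint_compl_right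
    rw [union_compl_self]
    exact ⟨Γ.flatAlgebra.one_mem, fun _ _ => rfl, fun _ h => absurd (mem_univ _) h⟩
  obtain ⟨μ₁, _, hμ₁⟩ := exists_measure_of_isClopen (fun E => b (T Ω) (T (E ∩ Ω)))
    (fun E hE => by
      have h1 := hb.nonneg_one Γ hconn hbdry hq0 hq (hE.inter hΩ) (hT _ (hE.inter hΩ))
      have h2 := hb.nonpos_of_disjoint Γ hq0 hq (E := Ωᶜ) (E' := E ∩ Ω)
        (disjoint_compl_left.mono_right inter_subset_right) (hT _ hΩ.compl) (hT _ (hE.inter hΩ))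
      rw [hb.symm, hb.congr_left Γ _ hone, map_add, LinearMap.add_apply] at h1
      linarith)
    (fun E E' hE hE' hd => by
      rw [union_inter_distrib_right]
      exact hadd _ _ (hE.inter hΩ) (hE'.inter hΩ)
        (hd.mono inter_subset_left inter_subset_left))
  obtain ⟨μ₂, _, hμ₂⟩ := exists_measure_of_isClopen (fun E => -b (T Ω) (T (E ∩ Ωᶜ)))
    (fun E hE => neg_nonneg.2 (hb.nonpos_of_disjoint Γ hq0 hq
      (disjoint_compl_right.mono_right inter_subset_right) (hT _ hΩ) (hT _ (hE.inter hΩ.compl))))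
    (fun E E' hE hE' hd => by
      rw [union_inter_distrib_right, hadd _ _ (hE.inter hΩ.compl) (hE'.inter hΩ.compl)
        (hd.mono inter_subset_left inter_subset_left), neg_add])
  refine ⟨μ₁.toSignedMeasure - μ₂.toSignedMeasure, fun E hE => ?_⟩
  rw [_root_.sub_apply, Measure.toSignedMeasure_apply_measurable hE.isOpen.measurableSet,
    Measure.toSignedMeasure_apply_measurable hE.isOpen.measurableSet, hμ₁ E hE, hμ₂ E hE,
    sub_neg_eq_add, ← hadd _ _ (hE.inter hΩ) (hE.inter hΩ.compl)
      (disjoint_compl_right.mono inter_subset_right inter_subset_right), inter_union_compl]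

theorem exists_signedMeasure [Countable V] [CompactSpace Γ.Compl]
    [SecondCountableTopology Γ.bdry] [CompactSpace Γ.bdry] [TotallyDisconnectedSpace Γ.bdry]
    (hb : Γ.IsBoundaryForm q b)
    (hconn : G.Connected) (hbdry : Γ.bdry.Nonempty) (hq0 : ∀ p, 0 ≤ q p)
    (hq : Integrable q Γ.vol) (hT : ∀ E, IsClopen E → Γ.TestFunction E (T E))
    {F : C(Γ.bdry, ℝ)} (hF : F ∈ finiteRange Γ.bdry) :
    ∃ ν : SignedMeasure Γ.bdry, ∀ E, IsClopen E → ν E = b (Γ.flatLift T hF) (T E) := by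
  choose ν hν using fun c =>
    hb.exists_signedMeasure_of_isClopen Γ hconn hbdry hq0 hq hT (isClopen_fiber hF c)
  refine ⟨∑ c ∈ (mem_finiteRange.1 hF).toFinset, c • ν c, fun E hE => ?_⟩
  rw [flatLift, map_sum, LinearMap.sum_apply, _root_.sum_apply]
  refine Finset.sum_congr rfl fun c _ => ?_
  rw [map_smul, LinearMap.smul_apply, _root_.smul_apply, hν c E hE]

theorem dnValue [Countable V] [CompactSpace Γ.Compl] (hb : Γ.IsBoundaryForm q b)
    (hconn : G.Connected) (hbdry : Γ.bdry.Nonempty) (hq0 : ∀ p, 0 ≤ q p)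
    (hq : Integrable q Γ.vol) (hT : ∀ E, IsClopen E → Γ.TestFunction E (T E))
    {F : C(Γ.bdry, ℝ)} (hF : F ∈ finiteRange Γ.bdry) {E : Set Γ.bdry} (hE : IsClopen E) :
    Γ.DNValue q F E (b (Γ.flatLift T hF) (T E)) := by
  obtain ⟨u, hu, huq, hub⟩ := hb.exists_harmonic (Γ.flatLift T hF)
  have hext : Γ.HarmonicExtension q F u := ⟨fun x => by rw [hu x x.2, Γ.flatLift_apply hT hF], huq⟩
  refine ⟨⟨u, hext, fun v hv => hv.unique Γ hconn hbdry hq0 hext⟩, ⟨_, hT E hE⟩,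
    fun v φ hv hφ => ⟨Γ.integrable_mul_L hq v hφ.1, ?_⟩⟩
  rw [hv.unique Γ hconn hbdry hq0 hext]
  refine (hub ⟨φ, hφ.1⟩).trans (hb.congr_right Γ _ ?_)
  exact TestFunction.sub_mem_flatZero Γ (φ := ⟨φ, hφ.1⟩) hφ (hT E hE)

end IsBoundaryForm

theorem DNValue.unique [G.LocallyFinite] {F : C(Γ.bdry, ℝ)} {E : Set Γ.bdry} {c c' : ℝ}
    (h : Γ.DNValue q F E c) (h' : Γ.DNValue q F E c') : c = c' := by
  obtain ⟨⟨u, hu, -⟩, ⟨φ, hφ⟩, hc⟩ := h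
  rw [← (hc u φ hu hφ).2, (h'.2.2 u φ hu hφ).2]

end MetricGraph
end

theorem mainTheorem1 {V : Type*} [Countable V] (G : SimpleGraph V) [G.LocallyFinite]
    (hconn : G.Connected) (Γ : MetricGraph G) (hcompact : CompactSpace Γ.Compl)
    (hweak : Γ.WeaklyConnected) (hbdry : Γ.bdry.Nonempty)
    (q : Γ.Point → ℝ) (hq_nonneg : ∀ p, 0 ≤ q p) (hq_int : Integrable q Γ.vol)
    (w : G.edgeSet → ℝ) (hw_pos : ∀ e, 0 < w e) (hw_sum : Summable w)
    (hqw : ∑' e, ∫⁻ t in Ioo 0 (Γ.len e),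
      ENNReal.ofReal (((w e)⁻¹ * q (Γ.pt e t)) ^ 2 * w e) < ∞) :
    ∃ Λ : C(Γ.bdry, ℝ) →ₗ.[ℝ] SignedMeasure Γ.bdry,
      Γ.IsDirichletNeumannMap q Λ ∧
      (∀ Λ', Γ.IsDirichletNeumannMap q Λ' → Λ' = Λ) ∧
      Λ.domain = Submodule.span ℝ
        {F : C(Γ.bdry, ℝ) | ∃ Ω : Set Γ.bdry, IsClopen Ω ∧ ⇑F = Ω.indicator 1} ∧
      (∀ F : Λ.domain, (Λ F).totalVariation.Regular) ∧
      Dense (Λ.domain : Set C(Γ.bdry, ℝ)) ∧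
      (∀ F H : Λ.domain, ∫ᵛ x, (H : C(Γ.bdry, ℝ)) x ∂<•(Λ F) =
        ∫ᵛ x, (F : C(Γ.bdry, ℝ)) x ∂<•(Λ H)) ∧
      (∀ F : Λ.domain, 0 ≤ ∫ᵛ x, (F : C(Γ.bdry, ℝ)) x ∂<•(Λ F)) := by
  have hcb : CompactSpace Γ.bdry := isCompact_iff_compactSpace.1 Γ.isClosed_bdry.isCompact
  have htd : TotallyDisconnectedSpace Γ.bdry := Γ.totallyDisconnectedSpace_bdry hweak
  have hmetr : TopologicalSpace.MetrizableSpace Γ.Compl := Γ.metrizableSpace_compl hconn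
  obtain ⟨b, hb⟩ := Γ.exists_isBoundaryForm hconn hbdry hq_nonneg hq_int
  have hT' : ∀ E : Set Γ.bdry, ∃ φ : Γ.flatAlgebra, IsClopen E → Γ.TestFunction E φ := fun E => by
    by_cases hE : IsClopen E
    · obtain ⟨φ, hφ⟩ := Γ.exists_testFunction hweak hE
      exact ⟨⟨φ, hφ.1⟩, fun _ => hφ⟩
    · exact ⟨0, fun h => absurd h hE⟩
  choose T hT using hT'
  -- `T E` is a test function for `E` if `E` is clopen.
  let D : Submodule ℝ C(Γ.bdry, ℝ) := (MetricGraph.finiteRange Γ.bdry).toSubmodule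
  choose ν hν using fun F : D => hb.exists_signedMeasure Γ hconn hbdry hq_nonneg hq_int hT F.2
  have hzero : ∀ φ : Γ.flatAlgebra, (∀ x : Γ.bdry, (φ : C(Γ.Compl, ℝ)) x = 0) → φ ∈ Γ.flatZero :=
    fun φ h x hx => h ⟨x, hx⟩
  have hlift : ∀ (F : D) (x : Γ.bdry),
      (Γ.flatLift T F.2 : C(Γ.Compl, ℝ)) x = (F : C(Γ.bdry, ℝ)) x :=
    fun F => Γ.flatLift_apply hT F.2
  let Λ : C(Γ.bdry, ℝ) →ₗ.[ℝ] SignedMeasure Γ.bdry :=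
    { domain := D
      toFun :=
        { toFun := ν
          map_add' := fun F H => MetricGraph.signedMeasure_ext_of_isClopen fun E hE => by
            rw [_root_.add_apply, hν _ E hE, hν _ E hE, hν _ E hE, ← LinearMap.add_apply,
              ← map_add]
            refine hb.congr_left Γ _ (hzero _ fun x => ?_)
            change (Γ.flatLift T (F + H).2 : C(Γ.Compl, ℝ)) x -
              ((Γ.flatLift T F.2 : C(Γ.Compl, ℝ)) x +
                (Γ.flatLift T H.2 : C(Γ.Compl, ℝ)) x) = 0
            rw [hlift, hlift, hlift]
            exact sub_self _
          map_smul' := fun c F => MetricGraph.signedMeasure_ext_of_isClopen fun E hE => by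
            rw [RingHom.id_apply, _root_.smul_apply, hν _ E hE, hν _ E hE,
              ← LinearMap.smul_apply, ← map_smul]
            refine hb.congr_left Γ _ (hzero _ fun x => ?_)
            change (Γ.flatLift T (c • F).2 : C(Γ.Compl, ℝ)) x -
              c * (Γ.flatLift T F.2 : C(Γ.Compl, ℝ)) x = 0
            rw [hlift, hlift]
            exact sub_self _ } }
  have hΛ : Γ.IsDirichletNeumannMap q Λ := by
    refine ⟨fun F => Iff.rfl, fun F E hE => ?_⟩
    change Γ.DNValue q F E (ν F E)
    rw [hν F E hE]
    exact hb.dnValue Γ hconn hbdry hq_nonneg hq_int hT F.2 hE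
  have hint : ∀ F H : Λ.domain, ∫ᵛ x, (H : C(Γ.bdry, ℝ)) x ∂<•(Λ F) =
      b (Γ.flatLift T F.2) (Γ.flatLift T H.2) :=
    fun F H => Γ.integral_eq_flatLift b F.2 H.2 (hν F)
  refine ⟨Λ, hΛ, fun Λ' hΛ' => ?_, MetricGraph.finiteRange_eq_span, fun F => inferInstance,
    MetricGraph.dense_finiteRange, fun F H => ?_, fun F => ?_⟩
  · refine LinearPMap.ext (Submodule.ext fun F => (hΛ'.1 F).trans (hΛ.1 F).symm) ?_
    intro F hF hF'
    exact MetricGraph.signedMeasure_ext_of_isClopen fun E hE =>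
      (hΛ'.2 ⟨F, hF⟩ E hE).unique Γ (hΛ.2 ⟨F, hF'⟩ E hE)
  · rw [hint, hint, hb.symm]
  · rw [hint]
    exact hb.nonneg _
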